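/- **Setting.** Let $\mathcal X$ be a finite set, $x^*\in\mathcal X$, $l\in\mathbb N_0$, $\alpha>0$. For $\theta\in\mathbb R^l$ let $P_\theta$ be a stochastic matrix on $\mathcal X$ and $C_\theta:\mathcal X\to\mathbb R$ a cost function. Assume: 1. every matrix in the closure of $\{P_\theta:\theta\in\mathbb R^l\}$ is irreducible and aperiodic; 2. for all $x,y$, the functions $\theta\mapsto P_\theta(x,y)$ and $\theta\mapsto C_\theta(x)$ are bounded and twice differentiable with bounded first and second derivatives; 3. for all $x,y$ there are bounded functions $L_\theta(x,y)$, $L^{(2)}_\theta(x,y)$ of $\theta$ with $\nabla_\theta P_\theta(x,y)=P_\theta(x,y)L_\theta(x,y)$ and $\nabla^2_\theta P_\theta(x,y)=P_\theta(x,y)L^{(2)}_\theta(x,y)$; 4. the step sizes satisfy $\gamma_m>0$, $\sum_m\gamma_m=\infty$, $\sum_m\gamma_m^2<\infty$, $\sup_m\gamma_m<1$. Write $\mathbb E^\theta_x$ for the expectation under the Markov chain $(\Phi_i)$ with transition matrix $P_\theta$ and $\Phi_0=x$, and $\tau=\min\{n\ge1:\Phi_n=x^*\}$. The risk-sensitive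 cost is $$\Lambda_\theta=\lim_{n\to\infty}\frac1n\ln\mathbb E^\theta_x\Big[\exp\Big(\alpha\sum_{i=0}^{n-1}C_\theta(\Phi_i)\Big)\Big].$$ For $M>1$ put $H(\theta,\Lambda)=\exp\big(\sum_{i=0}^{\tau-1}(\alpha C_\theta(\Phi_i)-\Lambda)\big)$, $$G^{(M)}(\theta,\Lambda)=\begin{cases}H(\theta,\Lambda), & H(\theta,\Lambda)\le M,\\ M\sum_{i=0}^4\frac1{i!}\big(\ln(M^{-1}H(\theta,\Lambda))\big)^i, & H(\theta,\Lambda)>M,\end{cases}$$ $$F^{(M)}(\theta,\Lambda)=G^{(M)}(\theta,\Lambda)\sum_{i=0}^{\tau-1}L_\theta(\Phi_i,\Phi_{i+1})+\nabla_\theta G^{(M)}(\theta,\Lambda),$$ and let $\Lambda^{(M)}_\theta$ be the solution $\Lambda$ of $\mathbb E^\theta_{x^*}[G^{(M)}(\theta,\Lambda)]=1$. **Algorithm.** Let $\eta>0$, let $(M_m)$ be a sequence of truncation levels in $(1,\infty)$, and let $\theta_0\in\mathbb R^l$, $\tilde\Lambda_0\in\mathbb R$ be deterministic. Let $t_0=0$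 and let $t_{m+1}$ be the first time after $t_m$ at which the process $(\Phi_i)$ is in $x^*$; $\Phi_0$ may have any distribution. During $\{t_m,\dots,t_{m+1}-1\}$ the process moves according to $P_{\theta_m}$, that is, given the past up to a time $n$ with $t_m\le n<t_{m+1}$, the state $\Phi_{n+1}$ has law $P_{\theta_m}(\Phi_n,\cdot)$. At time $t_{m+1}$ set $$\theta_{m+1}=\theta_m-\gamma_mF_m(\theta_m,\tilde\Lambda_m),\qquad \tilde\Lambda_{m+1}=\tilde\Lambda_m+\eta\gamma_m\big(G_m(\theta_m,\tilde\Lambda_m)-1\big),$$ where $F_m,G_m$ are $F^{(M_m)},G^{(M_m)}$ evaluated on the path segment $\Phi_{t_m},\dots,\Phi_{t_{m+1}}$. Alternatively (projected version), for fixed $a,b>0$ both increments $\gamma_mF_m$ and $\eta\gamma_m(G_m-1)$ are first projected, coordinatewise, to $[-a,a]$ and to $[-b,b]$ respectively. **Theorem.** The limit defining $\Lambda_\theta$ exists and does not depend on $x$; for every $M>1$ and $\theta$ the equation defining $\Lambda^{(M)}_\theta$ has exactly one solution; $\theta\mapsto\Lambda_\theta$ and $\theta\mapsto\Lambda_\theta^{(M)}$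 are differentiable. Moreover, for both versions of the algorithm: (i) If $M_m=M$ for all $m$, with a fixed $M>1$, then almost surely $\Lambda^{(M)}_{\theta_m}$ converges in $\mathbb R$ and $\nabla_\theta\Lambda^{(M)}_{\theta_m}\to0$. (ii) Suppose $\sum_m\gamma_m^{2(1-\beta)}<\infty$ for some $\beta\in(0,\tfrac12)$. Let $(N_i)_{i\ge0}$ be a nondecreasing sequence in $(1,\infty)$ with $N_i\to\infty$ and $\sum_i\sup_\theta\big(\Lambda^{(N_{i+1})}_\theta-\Lambda^{(N_i)}_\theta\big)<\infty$. For each $m$ let $M_m$ be the largest of the $N_i$ with $N_i\le\gamma_m^{-\beta}$ (assumed to exist), and suppose that $(M_m)$ is nondecreasing (which holds, for instance, if $(\gamma_m)$ is nonincreasing). Then almost surely $\Lambda_{\theta_m}$ converges in $\mathbb R$ and $\nabla_\theta\Lambda_{\theta_m}\to0$. -/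

import Mathlib

open MeasureTheory ProbabilityTheory Filter Topology
open scoped ENNReal

noncomputable section

namespace RiskSensitive

/-- The parameter space `ℝ^l` with its Euclidean structure. -/
abbrev Param (l : ℕ) : Type := EuclideanSpace ℝ (Fin l)

/-- A parameterized finite-state Markov chain with one-step costs: the transition matrices
`P θ`, the cost functions `C θ`, the likelihood-ratio vectors `L θ x y` (the data `L_θ(x,y)`
with `∇P_θ(x,y) = P_θ(x,y) L_θ(x,y)`, a condition that is imposed separately in
`LikelihoodRatio`), the distinguished state and the risk factor. -/
structure Model (l : ℕ) (X : Type*) [Fintype X] where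
  P : Param l → Matrix X X ℝ
  P_nonneg : ∀ θ x y, 0 ≤ P θ x y
  P_sum : ∀ θ x, ∑ y, P θ x y = 1
  C : Param l → X → ℝ
  L : Param l → X → X → Param l
  xstar : X
  α : ℝ
  α_pos : 0 < α

/-- Aperiodicity: for every state, the only common divisor of the possible return times is `1`. -/
def IsAperiodic {X : Type*} [Fintype X] [DecidableEq X] (Q : Matrix X X ℝ) : Prop :=
  ∀ x, ∀ d : ℕ, (∀ n : ℕ, 0 < n → 0 < (Q ^ n) x x → d ∣ n) → d = 1

/-- The `m`-th step size of a step-size sequence is positive and bounded by a constant smaller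
than one; the sum of the step sizes diverges and the sum of their squares converges. -/
structure IsStepSize (γ : ℕ → ℝ) : Prop where
  pos : ∀ m, 0 < γ m
  sum_diverges : Tendsto (fun n => ∑ m ∈ Finset.range n, γ m) atTop atTop
  sum_sq : Summable fun m => γ m ^ 2
  sup_lt_one : ∃ c < 1, ∀ m, γ m ≤ c

/-- Projection of a real number to `[-a, a]`. -/
def clip (a x : ℝ) : ℝ := max (-a) (min x a)

/-- The plain update, or the update whose increments are projected coordinatewise to `[-a, a]`
(for the parameter) and to `[-b, b]` (for the cost estimate). -/
inductive UpdateRule : Type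
  | plain : UpdateRule
  | projected (a b : ℝ) (ha : 0 < a) (hb : 0 < b) : UpdateRule

/-- The map applied to the increment of the parameter. -/
def UpdateRule.onParam {l : ℕ} : UpdateRule → Param l → Param l
  | .plain, v => v
  | .projected a _ _ _, v => WithLp.toLp 2 fun i => clip a (v i)

/-- The map applied to the increment of the cost estimate. -/
def UpdateRule.onCost : UpdateRule → ℝ → ℝ
  | .plain, s => s
  | .projected _ b _ _, s => clip b s

namespace Model

variable {l : ℕ} {X : Type*} [Fintype X] (S : Model l X)

/-! ### Standing assumptions -/

/-- Every matrix in the closure of `{P θ}` is irreducible and aperiodic. -/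
def Ergodic [DecidableEq X] : Prop :=
  ∀ Q ∈ closure (Set.range S.P), Q.IsIrreducible ∧ IsAperiodic Q

/-- A function on the parameter space that is bounded and twice differentiable, with bounded
first and second derivatives. -/
def BoundedC2 {l : ℕ} (u : Param l → ℝ) : Prop :=
  Differentiable ℝ u ∧ Differentiable ℝ (fderiv ℝ u) ∧
    ∃ B : ℝ, ∀ θ, |u θ| ≤ B ∧ ‖fderiv ℝ u θ‖ ≤ B ∧ ‖fderiv ℝ (fderiv ℝ u) θ‖ ≤ B

/-- Transition probabilities and costs are bounded and twice differentiable with bounded first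
and second derivatives. -/
def Smooth : Prop :=
  (∀ x y, BoundedC2 fun θ => S.P θ x y) ∧ ∀ x, BoundedC2 fun θ => S.C θ x

/-- `∇P_θ(x,y) = P_θ(x,y) L_θ(x,y)` and `∇²P_θ(x,y) = P_θ(x,y) L⁽²⁾_θ(x,y)` with `L` and `L⁽²⁾`
bounded. Second derivatives are bilinear forms. -/
def LikelihoodRatio : Prop :=
  ∀ x y,
    (∃ B : ℝ, ∀ θ, ‖S.L θ x y‖ ≤ B) ∧
    (∀ θ, gradient (fun ϑ => S.P ϑ x y) θ = S.P θ x y • S.L θ x y) ∧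
    ∃ L₂ : Param l → Param l →L[ℝ] Param l →L[ℝ] ℝ,
      (∃ B : ℝ, ∀ θ, ‖L₂ θ‖ ≤ B) ∧
      ∀ θ, fderiv ℝ (fderiv ℝ fun ϑ => S.P ϑ x y) θ = S.P θ x y • L₂ θ

/-! ### Functionals of a path -/

/-- The first return time `τ` to the distinguished state (`0` on paths that never return). -/
def returnTime (ω : ℕ → X) : ℕ := sInf {n | 0 < n ∧ ω n = S.xstar}

/-- `H(θ,Λ) = exp(∑_{i<τ} (α C_θ(Φ_i) - Λ))`. -/
def H (θ : Param l) (Λ : ℝ) (ω : ℕ → X) : ℝ :=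
  Real.exp (∑ i ∈ Finset.range (S.returnTime ω), (S.α * S.C θ (ω i) - Λ))

/-- The smooth truncation `G^{(M)}(θ,Λ)` of `H(θ,Λ)`: equal to `H` where `H ≤ M`, and to
`M ∑_{i≤4} (ln(H/M))^i / i!` where `H > M`. -/
def G (M : ℝ) (θ : Param l) (Λ : ℝ) (ω : ℕ → X) : ℝ :=
  if S.H θ Λ ω ≤ M then S.H θ Λ ω
  else M * ∑ i ∈ Finset.range 5, Real.log (M⁻¹ * S.H θ Λ ω) ^ i / (i.factorial : ℝ)

/-- `F^{(M)}(θ,Λ) = G^{(M)}(θ,Λ) ∑_{i<τ} L_θ(Φ_i,Φ_{i+1}) + ∇_θ G^{(M)}(θ,Λ)`. -/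
def F (M : ℝ) (θ : Param l) (Λ : ℝ) (ω : ℕ → X) : Param l :=
  S.G M θ Λ ω • (∑ i ∈ Finset.range (S.returnTime ω), S.L θ (ω i) (ω (i + 1)))
    + gradient (fun ϑ => S.G M ϑ Λ ω) θ

/-! ### The algorithm -/

/-- `t_m`: `t_0 = 0` and `t_{m+1}` is the first time after `t_m` at which the path is at `x*`. -/
def visit (ω : ℕ → X) : ℕ → ℕ
  | 0 => 0
  | m + 1 => visit ω m + S.returnTime fun i => ω (visit ω m + i)

/-- The pair `(θ_m, Λ̃_m)` produced by the algorithm on the path `ω` with step sizes `γ`,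
tuning parameter `η` and truncation levels `M m`. -/
def iterate (U : UpdateRule) (γ : ℕ → ℝ) (η : ℝ) (M : ℕ → ℝ) (θ₀ : Param l) (Λ₀ : ℝ)
    (ω : ℕ → X) : ℕ → Param l × ℝ
  | 0 => (θ₀, Λ₀)
  | m + 1 =>
    let r := iterate U γ η M θ₀ Λ₀ ω m
    let cycle : ℕ → X := fun i => ω (S.visit ω m + i)
    (r.1 - U.onParam (γ m • S.F (M m) r.1 r.2 cycle),
      r.2 + U.onCost (η * γ m * (S.G (M m) r.1 r.2 cycle - 1)))

/-- The number of visits to `x*` at the times `1, …, n`. It equals `m` when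
`t_m ≤ n < t_{m+1}`. -/
def visitCount [DecidableEq X] (ω : ℕ → X) (n : ℕ) : ℕ :=
  ((Finset.Icc 1 n).filter fun k => ω k = S.xstar).card

/-- `Φ` is a sample path of the chain controlled by the algorithm, adapted to `𝓕`: given the
past up to time `n`, the next state has law `P_{θ_m}(Φ_n, ·)`, where `m` is such that
`t_m ≤ n < t_{m+1}`. The initial state is arbitrary. -/
structure IsControlledPath [DecidableEq X] [MeasurableSpace X] (U : UpdateRule)
    (γ : ℕ → ℝ) (η : ℝ) (M : ℕ → ℝ) (θ₀ : Param l) (Λ₀ : ℝ) {Ω : Type*} [mΩ : MeasurableSpace Ω] (μ : Measure Ω)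
    (𝓕 : Filtration ℕ mΩ) (Φ : ℕ → Ω → X) : Prop where
  adapted : ∀ n, Measurable[𝓕 n] (Φ n)
  transition : ∀ (n : ℕ) (y : X),
    μ[(Φ (n + 1) ⁻¹' {y}).indicator (fun _ => (1 : ℝ)) | 𝓕 n] =ᵐ[μ] fun w =>
      S.P (S.iterate U γ η M θ₀ Λ₀ (fun k => Φ k w)
        (S.visitCount (fun k => Φ k w) n)).1 (Φ n w) y

/-! ### The law of the chain -/

/-- The row `P θ x` as a probability mass function. -/
def row (θ : Param l) (x : X) : PMF X :=
  PMF.ofFintype (fun y => ENNReal.ofReal (S.P θ x y)) (by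
    rw [← ENNReal.ofReal_sum_of_nonneg fun y _ => S.P_nonneg θ x y, S.P_sum, ENNReal.ofReal_one])

variable [MeasurableSpace X] [DiscreteMeasurableSpace X]

/-- The transition kernel of the chain with parameter `θ`, as a function of the past. -/
def step (θ : Param l) (n : ℕ) : Kernel (Π _ : Finset.Iic n, X) X where
  toFun past := (S.row θ (past ⟨n, Finset.mem_Iic.2 le_rfl⟩)).toMeasure
  measurable' := (Measurable.of_discrete (f := fun x : X => (S.row θ x).toMeasure)).comp
    (measurable_pi_apply _)

instance (θ : Param l) (n : ℕ) : IsMarkovKernel (S.step θ n) :=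
  ⟨fun past => by
    change IsProbabilityMeasure (PMF.toMeasure _)
    infer_instance⟩

/-- The law on `ℕ → X` of the Markov chain with transition matrix `P θ` started at `x`. -/
def law (θ : Param l) (x : X) : Measure (ℕ → X) :=
  Kernel.traj (X := fun _ => X) (S.step θ) 0 fun _ => x

/-! ### The risk-sensitive cost and its truncation -/

/-- `(1/n) ln E_x[exp(α ∑_{i<n} C_θ(Φ_i))]`. -/
def finiteCost (θ : Param l) (x : X) (n : ℕ) : ℝ :=
  1 / (n : ℝ) * Real.log
    (∫ ω, Real.exp (S.α * ∑ i ∈ Finset.range n, S.C θ (ω i)) ∂S.law θ x)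

/-- The risk-sensitive cost `Λ_θ`, as the limit of the finite-horizon costs. -/
def riskCost (θ : Param l) : ℝ :=
  limUnder atTop (S.finiteCost θ S.xstar)

/-- `g^{(M)}(θ,Λ)`, the expectation of `G^{(M)}(θ,Λ)` for the chain started at `x*`. -/
def g (M : ℝ) (θ : Param l) (Λ : ℝ) : ℝ :=
  ∫ ω, S.G M θ Λ ω ∂S.law θ S.xstar

/-- The truncated risk-sensitive cost `Λ^{(M)}_θ`: the solution `Λ` of `g^{(M)}(θ,Λ) = 1`. -/
def truncCost (M : ℝ) (θ : Param l) : ℝ :=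
  Classical.epsilon fun Λ : ℝ => S.g M θ Λ = 1

/-- A truncation sequence increasing to infinity along which the suprema over the parameter of
the increments of the truncated cost are summable. -/
def SummableTruncation (N : ℕ → ℝ) : Prop :=
  Monotone N ∧ Tendsto N atTop atTop ∧
    ∑' i, ⨆ θ, ENNReal.ofReal (S.truncCost (N (i + 1)) θ - S.truncCost (N i) θ) ≠ ∞

end Model
end RiskSensitive

end

/-!
The proof describes everything by the *loops* at the state `xstar`: a loop is the list of states
between two successive visits, a cycle of the algorithm is one loop, and all the functionals of a
cycle are functions of the loop. For a fixed parameter the loops are independent, so the expected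
values are sums over the countable set of loops.

**Uniform ergodicity.** The closure of the transition matrices is compact and consists of
irreducible matrices, so every state is reached from every state within a bounded number of steps
with a probability bounded away from zero (`exists_uniform_reaches`). A Lyapunov function turns
this into a uniform exponential moment of the loop length (`sum_loopProb_exp_le`). Perron's theorem
(`exists_perron`) yields the risk-sensitive cost `Λ_θ` as the logarithm of the Perron eigenvalue of
`e^{α C(x)} P(x,y)`; dividing by the eigenvalue and conjugating with the eigenvector gives a tilted
stochastic matrix that is uniformly ergodic as well (`exists_tilt`). Thus `E[H(θ,Λ_θ)] = 1`, with a
uniform exponential moment under the tilted weights. All this is collected in the structure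
`LoopFamily`, on which the rest of the analysis is based (`exists_loopFamily`).

**The costs as implicit functions.** `G^{(M)}` is `Γ(ln H)` with a convex, increasing function `Γ`
of polynomial growth that equals `exp` up to `ln M`; the untruncated case is `Γ = exp`. As the loop
length has exponential moments, `g(θ,Λ) = E[Γ(ln H(θ,Λ))]` can be expanded to second order in
`(θ,Λ)` with uniform constants (`LoopFamily.Moment.taylor`), it decreases in `Λ` at a rate bounded
below, and the equation `g(θ,Λ) = 1` has a unique solution `h(θ)`. A quantitative implicit function
theorem (`LoopFamily.exists_levelCore`) bounds `h` and its first two orders of expansion uniformly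
in `θ` and in `M`, and shows that `∇_θ g` is a positive multiple of `∇h` up to an error of order
`Λ - h(θ)`. The solutions increase to `Λ_θ` uniformly as `M → ∞`
(`LoopFamily.exists_risk_sub_le_root`), and then so do their gradients, because of the uniform
second-order bounds.

**The recursion.** Let `z = Λ̃ - h(θ)`. The mean drift of `z` pulls it back to zero, and that of
`h(θ)` is at most a negative multiple of `‖∇h(θ)‖²` up to an error of order `z²`. Both components
move on the same time scale, so these facts have to be combined in a Lyapunov function `h(θ) + φ(z)`
with `φ'` a truncated linear function of large slope, which decreases along the mean drift as soon
as `z` is nearly nonnegative; that this is eventually the case follows from a second Lyapunov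
function, which is active for slightly negative `z` only (`scalar_converges`). The argument is made
path by path, given that finitely many noise series converge (`exists_lyapunov_tests`).

**The noise.** The sequence of loops is a process with countable histories (`isWordProcess_words`),
in which the noise series are martingales. They converge by the `L²` theorem, because the second
moment of `G^{(M)}` is of order `M²` while the cost estimates are bounded below, and `∑ γ_m² M_m²`
is finite (`ae_seriesConverges_noise`). That the estimates are bounded below follows by comparison
with the recursion in which they are raised to a fixed level before the increments are computed
(`ae_lower_bound`). Projecting the increments changes them by at most a multiple of their squares,
which are summable.
-/

noncomputable section

namespace RiskSensitive

/-! ### Functions with exponentially controlled Taylor expansions -/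

/-- A function whose first two derivatives are bounded by `k` and `k²` times its value has a
first-order Taylor remainder that is dominated by the one of `f 0 * exp (k t)`. -/
theorem abs_taylor_le_exp {f f₁ f₂ : ℝ → ℝ} {k : ℝ}
    (hf : ∀ t, HasDerivAt f (f₁ t) t) (hf₁ : ∀ t, HasDerivAt f₁ (f₂ t) t)
    (h₁ : ∀ t, |f₁ t| ≤ k * f t) (h₂ : ∀ t, |f₂ t| ≤ k ^ 2 * f t) :
    |f 1 - f 0 - f₁ 0| ≤ f 0 * (Real.exp k - 1 - k) := by
  have hexp : ∀ t : ℝ, HasDerivAt (fun t : ℝ => Real.exp (k * t)) (Real.exp (k * t) * k) t :=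
    fun t => by simpa using ((hasDerivAt_id t).const_mul k).exp
  have hgrow : ∀ t ∈ Set.Icc (0 : ℝ) 1, f t ≤ f 0 * Real.exp (k * t) := by
    have hd : ∀ t, HasDerivAt (fun t => f t * Real.exp (-k * t))
        (f₁ t * Real.exp (-k * t) + f t * (Real.exp (-k * t) * -k)) t := fun t =>
      (hf t).mul (by simpa using ((hasDerivAt_id t).const_mul (-k)).exp)
    have hanti : Antitone fun t => f t * Real.exp (-k * t) := by
      apply antitone_of_deriv_nonpos (fun t => (hd t).differentiableAt)
      intro t
      rw [(hd t).deriv]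
      have := (abs_le.1 (h₁ t)).2
      nlinarith [Real.exp_pos (-k * t)]
    intro t ht
    have := hanti ht.1
    simp only [mul_zero, Real.exp_zero, mul_one] at this
    calc f t = f t * Real.exp (-k * t) * Real.exp (k * t) := by
          rw [mul_assoc, ← Real.exp_add]; simp
      _ ≤ _ := by gcongr
  have hone : ∀ t ∈ Set.Icc (0 : ℝ) 1, ‖f₁ t - f₁ 0‖ ≤ f 0 * k * (Real.exp (k * t) - 1) := by
    apply image_norm_le_of_norm_deriv_right_le_deriv_boundary (f := fun t => f₁ t - f₁ 0)
      (f' := f₂) (B := fun t => f 0 * k * (Real.exp (k * t) - 1))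
      (B' := fun t => f 0 * k * (Real.exp (k * t) * k))
    · exact fun t _ => ((hf₁ t).sub_const _).continuousAt.continuousWithinAt
    · exact fun t _ => ((hf₁ t).sub_const _).hasDerivWithinAt
    · simp
    · exact fun t => ((hexp t).sub_const 1).const_mul _
    · intro t ht
      have := hgrow t ⟨ht.1, ht.2.le⟩
      calc ‖f₂ t‖ ≤ k ^ 2 * f t := h₂ t
        _ ≤ k ^ 2 * (f 0 * Real.exp (k * t)) := by gcongr
        _ = _ := by ring
  have htwo : ∀ t ∈ Set.Icc (0 : ℝ) 1,
      ‖f t - f 0 - f₁ 0 * t‖ ≤ f 0 * (Real.exp (k * t) - 1 - k * t) := by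
    have hB : ∀ t, HasDerivAt (fun t => f 0 * (Real.exp (k * t) - 1 - k * t))
        (f 0 * (Real.exp (k * t) * k - k)) t := fun t =>
      (((hexp t).sub_const 1).sub (by simpa using (hasDerivAt_id t).const_mul k)).const_mul _
    have hA : ∀ t, HasDerivAt (fun t => f t - f 0 - f₁ 0 * t) (f₁ t - f₁ 0) t := fun t =>
      ((hf t).sub_const _).sub (by simpa using (hasDerivAt_id t).const_mul (f₁ 0))
    apply image_norm_le_of_norm_deriv_right_le_deriv_boundary
      (f := fun t => f t - f 0 - f₁ 0 * t) (f' := fun t => f₁ t - f₁ 0)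
      (B := fun t => f 0 * (Real.exp (k * t) - 1 - k * t))
      (B' := fun t => f 0 * (Real.exp (k * t) * k - k))
    · exact fun t _ => (hA t).continuousAt.continuousWithinAt
    · exact fun t _ => (hA t).hasDerivWithinAt
    · simp
    · exact hB
    · intro t ht
      have := hone t ⟨ht.1, ht.2.le⟩
      calc _ ≤ _ := this
        _ = _ := by ring
  simpa using htwo 1 (by simp)

theorem exp_sub_one_sub_le {x : ℝ} (hx : 0 ≤ x) : Real.exp x - 1 - x ≤ x ^ 2 * Real.exp x := by
  have h := Real.add_one_le_exp (-x)
  have h2 : Real.exp x * Real.exp (-x) = 1 := by rw [← Real.exp_add]; simp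
  nlinarith [Real.exp_pos x, Real.add_one_le_exp x,
    mul_le_mul_of_nonneg_left h (Real.exp_pos x).le]

theorem exp_sub_one_sub_mono {x y : ℝ} (hx : 0 ≤ x) (hxy : x ≤ y) :
    Real.exp x - 1 - x ≤ Real.exp y - 1 - y := by
  have h := Real.add_one_le_exp (y - x)
  have h1 : Real.exp y = Real.exp x * Real.exp (y - x) := by rw [← Real.exp_add]; ring_nf
  have h2 : 1 ≤ Real.exp x := Real.one_le_exp hx
  rw [h1]
  nlinarith

/-- `φ` is nonnegative, and near every point `e` its first-order expansion with the linear part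
`ℓ e` holds with the same relative error as the one of `exp (k ‖v‖)`. This bounds the first two
derivatives of `φ` relative to `φ` itself, and is stable under products (the constants `k`
add up). -/
structure ExpTaylor {E : Type*} [NormedAddCommGroup E] (k : ℝ) (φ : E → ℝ)
    (ℓ : E → E → ℝ) : Prop where
  rate_nonneg : 0 ≤ k
  nonneg : ∀ e, 0 ≤ φ e
  lin : ∀ e v, |ℓ e v| ≤ k * ‖v‖ * φ e
  taylor : ∀ e v, |φ (e + v) - φ e - ℓ e v| ≤ φ e * (Real.exp (k * ‖v‖) - 1 - k * ‖v‖)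

namespace ExpTaylor

variable {E : Type*} [NormedAddCommGroup E] {k m : ℝ} {φ ψ : E → ℝ} {ℓ ℓ' : E → E → ℝ}

theorem le (h : ExpTaylor k φ ℓ) (e v : E) : φ (e + v) ≤ φ e * Real.exp (k * ‖v‖) := by
  have h1 := (abs_le.1 (h.taylor e v)).2
  have h2 := (abs_le.1 (h.lin e v)).2
  nlinarith

theorem mul (h : ExpTaylor k φ ℓ) (h' : ExpTaylor m ψ ℓ') :
    ExpTaylor (k + m) (fun e => φ e * ψ e) (fun e v => φ e * ℓ' e v + ψ e * ℓ e v) where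
  rate_nonneg := add_nonneg h.rate_nonneg h'.rate_nonneg
  nonneg e := mul_nonneg (h.nonneg e) (h'.nonneg e)
  lin e v := by
    have h1 := h.nonneg e
    have h2 := h'.nonneg e
    calc |φ e * ℓ' e v + ψ e * ℓ e v| ≤ |φ e * ℓ' e v| + |ψ e * ℓ e v| := abs_add_le _ _
      _ = φ e * |ℓ' e v| + ψ e * |ℓ e v| := by
          rw [abs_mul, abs_mul, abs_of_nonneg h1, abs_of_nonneg h2]
      _ ≤ φ e * (m * ‖v‖ * ψ e) + ψ e * (k * ‖v‖ * φ e) := by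
          gcongr
          exacts [h'.lin e v, h.lin e v]
      _ = _ := by ring
  taylor e v := by
    have h1 := h.nonneg e
    have h2 := h'.nonneg e
    have hk := mul_nonneg h.rate_nonneg (norm_nonneg v)
    have hm := mul_nonneg h'.rate_nonneg (norm_nonneg v)
    set a := ℓ e v with ha
    set b := ℓ' e v with hb
    obtain ⟨A, hA⟩ : ∃ A, A = φ (e + v) - φ e - a := ⟨_, rfl⟩
    obtain ⟨B, hB⟩ : ∃ B, B = ψ (e + v) - ψ e - b := ⟨_, rfl⟩
    have tA : |A| ≤ φ e * (Real.exp (k * ‖v‖) - 1 - k * ‖v‖) := hA ▸ h.taylor e v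
    have tB : |B| ≤ ψ e * (Real.exp (m * ‖v‖) - 1 - m * ‖v‖) := hB ▸ h'.taylor e v
    have ta : |a| ≤ k * ‖v‖ * φ e := h.lin e v
    have tb : |b| ≤ m * ‖v‖ * ψ e := h'.lin e v
    have e1 : φ (e + v) = φ e + a + A := by rw [hA]; ring
    have e2 : ψ (e + v) = ψ e + b + B := by rw [hB]; ring
    have nk := mul_nonneg h1 (sub_nonneg.2 (by
      have := Real.add_one_le_exp (k * ‖v‖); linarith : k * ‖v‖ ≤ Real.exp (k * ‖v‖) - 1))
    have nm := mul_nonneg h2 (sub_nonneg.2 (by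
      have := Real.add_one_le_exp (m * ‖v‖); linarith : m * ‖v‖ ≤ Real.exp (m * ‖v‖) - 1))
    have hexp : Real.exp ((k + m) * ‖v‖) = Real.exp (k * ‖v‖) * Real.exp (m * ‖v‖) := by
      rw [← Real.exp_add]; ring_nf
    -- the terms of the expanded product are dominated one by one by those of the majorant
    calc |φ (e + v) * ψ (e + v) - φ e * ψ e - (φ e * b + ψ e * a)|
        = |φ e * B + a * b + a * B + A * ψ e + A * b + A * B| := by rw [e1, e2]; ring_nf
      _ ≤ |φ e * B| + |a * b| + |a * B| + |A * ψ e| + |A * b| + |A * B| := by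
          refine (abs_add_le _ _).trans (add_le_add_left ?_ _)
          refine (abs_add_le _ _).trans (add_le_add_left ?_ _)
          refine (abs_add_le _ _).trans (add_le_add_left ?_ _)
          refine (abs_add_le _ _).trans (add_le_add_left ?_ _)
          exact abs_add_le _ _
      _ = φ e * |B| + |a| * |b| + |a| * |B| + |A| * ψ e + |A| * |b| + |A| * |B| := by
          simp only [abs_mul, abs_of_nonneg h1, abs_of_nonneg h2]
      _ ≤ φ e * (ψ e * (Real.exp (m * ‖v‖) - 1 - m * ‖v‖))
          + (k * ‖v‖ * φ e) * (m * ‖v‖ * ψ e)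
          + (k * ‖v‖ * φ e) * (ψ e * (Real.exp (m * ‖v‖) - 1 - m * ‖v‖))
          + (φ e * (Real.exp (k * ‖v‖) - 1 - k * ‖v‖)) * ψ e
          + (φ e * (Real.exp (k * ‖v‖) - 1 - k * ‖v‖)) * (m * ‖v‖ * ψ e)
          + (φ e * (Real.exp (k * ‖v‖) - 1 - k * ‖v‖))
            * (ψ e * (Real.exp (m * ‖v‖) - 1 - m * ‖v‖)) := by gcongr
      _ = _ := by rw [hexp]; ring

theorem one : ExpTaylor 0 (fun _ : E => 1) (fun _ _ => 0) where
  rate_nonneg := le_rfl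
  nonneg _ := zero_le_one
  lin e v := by simp
  taylor e v := by simp

/-- Products of functions given with their logarithmic derivatives. -/
theorem prod {k : ℝ} {φ : ℕ → E → ℝ} {s : ℕ → E → E → ℝ}
    (h : ∀ i, ExpTaylor k (φ i) fun e v => φ i e * s i e v) (n : ℕ) :
    ExpTaylor (k * n) (fun e => ∏ i ∈ Finset.range n, φ i e)
      (fun e v => (∏ i ∈ Finset.range n, φ i e) * ∑ i ∈ Finset.range n, s i e v) := by
  induction n with
  | zero => simpa using one (E := E)
  | succ n ih =>
    have := ih.mul (h n)
    simp only [Finset.prod_range_succ, Finset.sum_range_succ, Nat.cast_succ, mul_add, mul_one]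
    convert this using 3
    ring

end ExpTaylor

/-- The relative Taylor bound from bounds on the first two derivatives relative to the value. -/
theorem ExpTaylor.of_fderiv {E : Type*} [NormedAddCommGroup E] [NormedSpace ℝ E] {φ : E → ℝ}
    {k : ℝ} (hk : 0 ≤ k) (h0 : ∀ e, 0 ≤ φ e) (hd : Differentiable ℝ φ)
    (hd2 : Differentiable ℝ (fderiv ℝ φ))
    (h₁ : ∀ e, ‖fderiv ℝ φ e‖ ≤ k * φ e) (h₂ : ∀ e, ‖fderiv ℝ (fderiv ℝ φ) e‖ ≤ k ^ 2 * φ e) :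
    ExpTaylor k φ fun e v => fderiv ℝ φ e v where
  rate_nonneg := hk
  nonneg := h0
  lin e v := by
    calc |fderiv ℝ φ e v| ≤ ‖fderiv ℝ φ e‖ * ‖v‖ := (fderiv ℝ φ e).le_opNorm v
      _ ≤ k * φ e * ‖v‖ := by gcongr; exact h₁ e
      _ = _ := by ring
  taylor e v := by
    have hline : ∀ t : ℝ, HasDerivAt (fun t : ℝ => e + t • v) v t := fun t => by
      simpa using ((hasDerivAt_id t).smul_const v).const_add e
    have := abs_taylor_le_exp (f := fun t : ℝ => φ (e + t • v))
      (f₁ := fun t => fderiv ℝ φ (e + t • v) v)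
      (f₂ := fun t => fderiv ℝ (fderiv ℝ φ) (e + t • v) v v) (k := k * ‖v‖)
      (fun t => (hd (e + t • v)).hasFDerivAt.comp_hasDerivAt t (hline t))
      (fun t => by
        have := ((hd2 (e + t • v)).hasFDerivAt.comp_hasDerivAt t (hline t))
        exact this.clm_apply (hasDerivAt_const t v) |>.congr_deriv (by simp))
      (fun t => by
        calc |fderiv ℝ φ (e + t • v) v| ≤ ‖fderiv ℝ φ (e + t • v)‖ * ‖v‖ :=
              (fderiv ℝ φ _).le_opNorm v
          _ ≤ k * φ (e + t • v) * ‖v‖ := by gcongr; exact h₁ _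
          _ = _ := by ring)
      (fun t => by
        calc |fderiv ℝ (fderiv ℝ φ) (e + t • v) v v|
            ≤ ‖fderiv ℝ (fderiv ℝ φ) (e + t • v)‖ * ‖v‖ * ‖v‖ :=
              (fderiv ℝ (fderiv ℝ φ) (e + t • v)).le_opNorm₂ v v
          _ ≤ k ^ 2 * φ (e + t • v) * ‖v‖ * ‖v‖ := by gcongr; exact h₂ _
          _ = _ := by ring)
    simpa using this

/-! ### Smooth truncations of the exponential -/

/-- The properties of a truncation `Γ` of the exponential function, with derivative `Γ'`, that
the analysis uses. They hold for the exponential function itself as well. -/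
structure IsTruncation (Γ Γ' : ℝ → ℝ) : Prop where
  tangent_le : ∀ s δ, Γ s + Γ' s * δ ≤ Γ (s + δ)
  deriv_le : ∀ s, Γ' s ≤ Γ s
  min_le_deriv : ∀ s, min (Real.exp s) 1 ≤ Γ' s
  le_exp : ∀ s, Γ s ≤ Real.exp s
  eq_exp : ∀ s, s ≤ 0 → Γ s = Real.exp s
  taylor : ∀ s δ, |Γ (s + δ) - Γ s - Γ' s * δ| ≤ Γ s * (Real.exp |δ| - 1 - |δ|)

namespace IsTruncation

variable {Γ Γ' : ℝ → ℝ} (h : IsTruncation Γ Γ')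

theorem deriv_pos (h : IsTruncation Γ Γ') (s : ℝ) : 0 < Γ' s :=
  (lt_min (Real.exp_pos s) one_pos).trans_le (h.min_le_deriv s)

theorem pos (h : IsTruncation Γ Γ') (s : ℝ) : 0 < Γ s := (h.deriv_pos s).trans_le (h.deriv_le s)

theorem mono (h : IsTruncation Γ Γ') : Monotone Γ := fun s t hst => by
  have := h.tangent_le s (t - s)
  have h2 := mul_nonneg (h.deriv_pos s).le (sub_nonneg.2 hst)
  simp only [add_sub_cancel] at this
  linarith

theorem one_le {s : ℝ} (h : IsTruncation Γ Γ') (hs : 0 ≤ s) : 1 ≤ Γ s := by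
  have := h.mono hs
  rwa [h.eq_exp 0 le_rfl, Real.exp_zero] at this

theorem le_one {s : ℝ} (h : IsTruncation Γ Γ') (hs : s ≤ 0) : Γ s ≤ 1 := by
  rw [h.eq_exp s hs]
  exact Real.exp_le_one_iff.2 hs

end IsTruncation

/-- `exp x` for `x ≤ 0`, continued by its Taylor polynomial with `j` terms. -/
def taylorExp (j : ℕ) (x : ℝ) : ℝ :=
  if x ≤ 0 then Real.exp x else ∑ i ∈ Finset.range j, x ^ i / (i.factorial : ℝ)

theorem taylorExp_of_nonpos (j : ℕ) {x : ℝ} (hx : x ≤ 0) : taylorExp j x = Real.exp x := if_pos hx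

theorem taylorExp_of_nonneg (j : ℕ) {x : ℝ} (hx : 0 ≤ x) :
    taylorExp (j + 1) x = ∑ i ∈ Finset.range (j + 1), x ^ i / (i.factorial : ℝ) := by
  rcases hx.eq_or_lt with rfl | hx
  · simp [taylorExp, Finset.sum_range_succ']
  · exact if_neg hx.not_ge

theorem hasDerivAt_taylorExp (j : ℕ) (x : ℝ) :
    HasDerivAt (taylorExp (j + 2)) (taylorExp (j + 1) x) x := by
  have hpoly : ∀ x : ℝ, HasDerivAt (fun x : ℝ => ∑ i ∈ Finset.range (j + 2),
      x ^ i / (i.factorial : ℝ)) (∑ i ∈ Finset.range (j + 1), x ^ i / (i.factorial : ℝ)) x := by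
    intro x
    have : ∀ i ∈ Finset.range (j + 1), HasDerivAt
        (fun x : ℝ => x ^ (i + 1) / ((i + 1).factorial : ℝ)) (x ^ i / (i.factorial : ℝ)) x := by
      intro i _
      refine ((hasDerivAt_pow (i + 1) x).div_const _).congr_deriv ?_
      have := Nat.factorial_pos i
      rw [Nat.factorial_succ]
      push_cast
      field_simp
    have h := (HasDerivAt.fun_sum this).add_const (1 : ℝ)
    refine h.congr_of_eventuallyEq (Eventually.of_forall fun y => ?_)
    simp [Finset.sum_range_succ' _ (j + 1)]
  have hleft : ∀ {x : ℝ}, x ≤ 0 → HasDerivWithinAt (taylorExp (j + 2)) (taylorExp (j + 1) x)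
      (Set.Iic 0) x := fun {x} hx => by
    rw [taylorExp_of_nonpos _ hx]
    exact (Real.hasDerivAt_exp x).hasDerivWithinAt.congr
      (fun y hy => taylorExp_of_nonpos _ hy) (taylorExp_of_nonpos _ hx)
  have hright : ∀ {x : ℝ}, 0 ≤ x → HasDerivWithinAt (taylorExp (j + 2)) (taylorExp (j + 1) x)
      (Set.Ici 0) x := fun {x} hx => by
    rw [taylorExp_of_nonneg _ hx]
    exact (hpoly x).hasDerivWithinAt.congr
      (fun y hy => taylorExp_of_nonneg _ hy) (taylorExp_of_nonneg _ hx)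
  rcases lt_trichotomy x 0 with hx | rfl | hx
  · exact (hleft hx.le).hasDerivAt (Iic_mem_nhds hx)
  · have := (hleft (le_refl (0 : ℝ))).union (hright le_rfl)
    rwa [Set.Iic_union_Ici, hasDerivWithinAt_univ] at this
  · exact (hright hx.le).hasDerivAt (Ici_mem_nhds hx)

theorem taylorExp_le_succ (j : ℕ) (x : ℝ) : taylorExp j x ≤ taylorExp (j + 1) x := by
  unfold taylorExp
  split_ifs with hx
  · exact le_rfl
  · rw [Finset.sum_range_succ]
    have : 0 < x := not_le.1 hx
    exact le_add_of_nonneg_right (by positivity)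

theorem taylorExp_nonneg (j : ℕ) (x : ℝ) : 0 ≤ taylorExp j x := by
  unfold taylorExp
  split_ifs with hx
  · exact (Real.exp_pos x).le
  · have : 0 < x := not_le.1 hx
    exact Finset.sum_nonneg fun i _ => by positivity

theorem taylorExp_le_exp (j : ℕ) (x : ℝ) : taylorExp j x ≤ Real.exp x := by
  unfold taylorExp
  split_ifs with hx
  · exact le_rfl
  · exact Real.sum_le_exp_of_nonneg (not_le.1 hx).le j

theorem min_exp_one_le_taylorExp (j : ℕ) (x : ℝ) : min (Real.exp x) 1 ≤ taylorExp (j + 1) x := by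
  rcases le_total x 0 with hx | hx
  · rw [taylorExp_of_nonpos _ hx]; exact min_le_left _ _
  · rw [taylorExp_of_nonneg _ hx, Finset.sum_range_succ']
    refine (min_le_right _ _).trans ?_
    simp only [pow_zero, Nat.factorial_zero, Nat.cast_one, div_one]
    exact le_add_of_nonneg_left (Finset.sum_nonneg fun i _ => by positivity)

/-- The function `Γ` for which `G^{(M)} = Γ (ln H)`. -/
def truncExp (M s : ℝ) : ℝ := M * taylorExp 5 (s - Real.log M)

/-- The derivative of `truncExp M`. -/
def truncExpDeriv (M s : ℝ) : ℝ := M * taylorExp 4 (s - Real.log M)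

theorem hasDerivAt_truncExp (M s : ℝ) : HasDerivAt (truncExp M) (truncExpDeriv M s) s := by
  have h := (hasDerivAt_taylorExp 3 (s - Real.log M)).comp s
    ((hasDerivAt_id s).sub_const (Real.log M))
  simpa [truncExp, truncExpDeriv, Function.comp_def] using! h.const_mul M

theorem isTruncation_truncExp {M : ℝ} (hM : 1 < M) :
    IsTruncation (truncExp M) (truncExpDeriv M) := by
  have hM0 : 0 < M := one_pos.trans hM
  have hd1 : ∀ s, HasDerivAt (truncExpDeriv M) (M * taylorExp 3 (s - Real.log M)) s := fun s => by
    have h := (hasDerivAt_taylorExp 2 (s - Real.log M)).comp s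
      ((hasDerivAt_id s).sub_const (Real.log M))
    simpa [truncExpDeriv, Function.comp_def] using! h.const_mul M
  have hconv : ConvexOn ℝ Set.univ (truncExp M) := by
    have hmono : Monotone (truncExpDeriv M) := monotone_of_deriv_nonneg
      (fun s => (hd1 s).differentiableAt) fun s => by
        rw [(hd1 s).deriv]; exact mul_nonneg hM0.le (taylorExp_nonneg _ _)
    have : deriv (truncExp M) = truncExpDeriv M := funext fun s => (hasDerivAt_truncExp M s).deriv
    exact Monotone.convexOn_univ_of_deriv
      (fun s => (hasDerivAt_truncExp M s).differentiableAt) (this ▸ hmono)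
  refine ⟨fun s δ => ?_, fun s => ?_, fun s => ?_, fun s => ?_, fun s hs => ?_, fun s δ => ?_⟩
  · rcases lt_trichotomy δ 0 with hδ | rfl | hδ
    · have := hconv.slope_le_of_hasDerivAt (x := s + δ) (y := s) trivial trivial
        (by linarith) (hasDerivAt_truncExp M s)
      rw [slope_def_field, div_le_iff₀ (by linarith)] at this
      linarith
    · simp
    · have := hconv.le_slope_of_hasDerivAt (x := s) (y := s + δ) trivial trivial
        (by linarith) (hasDerivAt_truncExp M s)
      rw [slope_def_field, le_div_iff₀ (by linarith)] at this
      linarith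
  · exact mul_le_mul_of_nonneg_left (taylorExp_le_succ 4 _) hM0.le
  · have h := mul_le_mul_of_nonneg_left (min_exp_one_le_taylorExp 3 (s - Real.log M)) hM0.le
    refine le_trans ?_ h
    rw [mul_min_of_nonneg _ _ hM0.le, Real.exp_sub, Real.exp_log hM0, mul_one,
      mul_div_cancel₀ _ hM0.ne']
    exact min_le_min_left _ hM.le
  · calc truncExp M s ≤ M * Real.exp (s - Real.log M) :=
          mul_le_mul_of_nonneg_left (taylorExp_le_exp 5 _) hM0.le
      _ = Real.exp s := by rw [Real.exp_sub, Real.exp_log hM0, mul_div_cancel₀ _ hM0.ne']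
  · rw [truncExp, taylorExp_of_nonpos _ (by linarith [Real.log_pos hM]), Real.exp_sub,
      Real.exp_log hM0, mul_div_cancel₀ _ hM0.ne']
  · have hline : ∀ t : ℝ, HasDerivAt (fun t : ℝ => s + t * δ) δ t := fun t => by
      simpa using ((hasDerivAt_id t).mul_const δ).const_add s
    have hle : ∀ x, truncExpDeriv M x ≤ truncExp M x := fun x =>
      mul_le_mul_of_nonneg_left (taylorExp_le_succ 4 _) hM0.le
    have hle' : ∀ x, M * taylorExp 3 (x - Real.log M) ≤ truncExp M x := fun x =>
      mul_le_mul_of_nonneg_left ((taylorExp_le_succ 3 _).trans (taylorExp_le_succ 4 _)) hM0.le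
    have := abs_taylor_le_exp (f := fun t : ℝ => truncExp M (s + t * δ))
      (f₁ := fun t => truncExpDeriv M (s + t * δ) * δ)
      (f₂ := fun t => M * taylorExp 3 (s + t * δ - Real.log M) * δ * δ) (k := |δ|)
      (fun t => (hasDerivAt_truncExp M _).comp t (hline t))
      (fun t => ((hd1 _).comp t (hline t)).mul_const δ)
      (fun t => by
        rw [abs_mul, mul_comm]
        gcongr
        rw [truncExpDeriv, abs_of_nonneg (mul_nonneg hM0.le (taylorExp_nonneg _ _))]
        exact hle _)
      (fun t => by
        rw [mul_assoc, ← sq, abs_mul, mul_comm, abs_of_nonneg (sq_nonneg δ), sq_abs]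
        gcongr
        rw [abs_of_nonneg (mul_nonneg hM0.le (taylorExp_nonneg _ _))]
        exact hle' _)
    simpa using this

theorem isTruncation_exp : IsTruncation Real.exp Real.exp where
  tangent_le s δ := by
    rw [Real.exp_add]
    nlinarith [Real.exp_pos s, Real.add_one_le_exp δ]
  deriv_le s := le_rfl
  min_le_deriv s := min_le_left _ _
  le_exp s := le_rfl
  eq_exp s _ := rfl
  taylor s δ := by
    have h1 : Real.exp (s + δ) - Real.exp s - Real.exp s * δ
        = Real.exp s * (Real.exp δ - 1 - δ) := by rw [Real.exp_add]; ring
    rw [h1, abs_mul, abs_of_pos (Real.exp_pos s)]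
    gcongr
    have := abs_taylor_le_exp (f := fun t : ℝ => Real.exp (t * δ))
      (f₁ := fun t => Real.exp (t * δ) * δ) (f₂ := fun t => Real.exp (t * δ) * δ * δ) (k := |δ|)
      (fun t => by simpa using ((hasDerivAt_id t).mul_const δ).exp)
      (fun t => by simpa using (((hasDerivAt_id t).mul_const δ).exp).mul_const δ)
      (fun t => by rw [abs_mul, abs_of_pos (Real.exp_pos _), mul_comm])
      (fun t => by
        rw [abs_mul, abs_mul, abs_of_pos (Real.exp_pos _)]
        exact le_of_eq (by ring))
    simpa using this

/-- Polynomial growth of the truncation. -/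
theorem truncExp_le {M : ℝ} (hM : 1 < M) (s : ℝ) : truncExp M s ≤ M * (1 + max s 0) ^ 4 := by
  have hM0 : 0 < M := one_pos.trans hM
  refine mul_le_mul_of_nonneg_left ?_ hM0.le
  rcases le_total (s - Real.log M) 0 with h | h
  · rw [taylorExp_of_nonpos _ h]
    refine (Real.exp_le_one_iff.2 h).trans (one_le_pow₀ ?_)
    linarith [le_max_right s 0]
  · rw [taylorExp_of_nonneg _ h]
    have hs : s - Real.log M ≤ max s 0 := by linarith [le_max_left s 0, Real.log_pos hM]
    set y := max s 0
    set x := s - Real.log M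
    have e : ∑ i ∈ Finset.range (4 + 1), x ^ i / (i.factorial : ℝ)
        ≤ ∑ i ∈ Finset.range (4 + 1), y ^ i / (i.factorial : ℝ) := by gcongr
    refine e.trans ?_
    have hy : 0 ≤ y := le_max_right _ _
    simp only [Finset.sum_range_succ, Finset.range_zero, Finset.sum_empty, Nat.factorial]
    norm_num
    nlinarith [pow_nonneg hy 2, pow_nonneg hy 3, pow_nonneg hy 4]

/-! ### Loops of a finite Markov chain -/

section Loops

variable {X : Type*}

/-- The path that starts at `x`, runs through the states of `l` and is constantly equal to `z`
afterwards. For `l` a list of states different from `z`, it describes the piece of a path up to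
the first return time `l.length + 1` to `z`. -/
def loopPath (z : X) : X → List {y : X // y ≠ z} → ℕ → X
  | x, _, 0 => x
  | _, [], _ + 1 => z
  | _, y :: l, i + 1 => loopPath z y l i

@[simp] theorem loopPath_zero (z x : X) (l : List {y : X // y ≠ z}) : loopPath z x l 0 = x := by
  cases l <;> rfl

@[simp] theorem loopPath_nil_succ (z x : X) (i : ℕ) : loopPath z x [] (i + 1) = z := rfl

@[simp] theorem loopPath_cons_succ (z x : X) (y : {y : X // y ≠ z}) (l : List {y : X // y ≠ z})
    (i : ℕ) : loopPath z x (y :: l) (i + 1) = loopPath z y l i := rfl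

theorem loopPath_eq_of_length_lt (z : X) (l : List {y : X // y ≠ z}) :
    ∀ (x : X) (i : ℕ), l.length < i → loopPath z x l i = z := by
  induction l with
  | nil => intro x i hi; cases i with
    | zero => simp at hi
    | succ i => rfl
  | cons y l ih => intro x i hi; cases i with
    | zero => simp at hi
    | succ i => exact ih y i (by simpa using hi)

theorem loopPath_ne (z : X) (l : List {y : X // y ≠ z}) :
    ∀ (x : X) (i : ℕ), 0 < i → i ≤ l.length → loopPath z x l i ≠ z := by
  induction l with
  | nil => intro x i h0 hi; simp at hi; omega
  | cons y l ih => intro x i h0 hi; cases i with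
    | zero => simp at h0
    | succ i =>
      rcases Nat.eq_zero_or_pos i with rfl | hi0
      · simpa using y.2
      · exact ih y i hi0 (by simpa using hi)

/-- The probability that the chain with transition matrix `Q` started at `x` moves along
`loopPath z x l` up to its first return to `z`. -/
def loopProb (z : X) (Q : Matrix X X ℝ) (x : X) (l : List {y : X // y ≠ z}) : ℝ :=
  ∏ i ∈ Finset.range (l.length + 1), Q (loopPath z x l i) (loopPath z x l (i + 1))

theorem loopProb_nil (z : X) (Q : Matrix X X ℝ) (x : X) : loopProb z Q x [] = Q x z := by
  simp [loopProb]

theorem loopProb_cons (z : X) (Q : Matrix X X ℝ) (x : X) (y : {y : X // y ≠ z})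
    (l : List {y : X // y ≠ z}) : loopProb z Q x (y :: l) = Q x y * loopProb z Q y l := by
  simp only [loopProb, List.length_cons]
  rw [Finset.prod_range_succ', mul_comm]
  simp

theorem loopProb_nonneg (z : X) {Q : Matrix X X ℝ} (hQ : ∀ x y, 0 ≤ Q x y) (x : X)
    (l : List {y : X // y ≠ z}) : 0 ≤ loopProb z Q x l :=
  Finset.prod_nonneg fun _ _ => hQ _ _

variable [Fintype X] [DecidableEq X]

/-- The lists with fewer than `n` elements. -/
def shortLists (z : X) : ℕ → Finset (List {y : X // y ≠ z})
  | 0 => ∅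
  | n + 1 => insert [] ((Finset.univ ×ˢ shortLists z n).image fun p => p.1 :: p.2)

theorem mem_shortLists {z : X} {n : ℕ} {l : List {y : X // y ≠ z}} :
    l ∈ shortLists z n ↔ l.length < n := by
  induction n generalizing l with
  | zero => simp [shortLists]
  | succ n ih =>
    cases l with
    | nil => simp [shortLists]
    | cons y l => simp [shortLists, ih]

theorem sum_shortLists_succ (z : X) (n : ℕ) (f : List {y : X // y ≠ z} → ℝ) :
    ∑ l ∈ shortLists z (n + 1), f l
      = f [] + ∑ y : {y : X // y ≠ z}, ∑ l ∈ shortLists z n, f (y :: l) := by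
  rw [shortLists, Finset.sum_insert (by simp), Finset.sum_image, Finset.sum_product]
  rintro ⟨a, b⟩ _ ⟨c, d⟩ _ h
  simpa using h

theorem tendsto_shortLists (z : X) : Tendsto (shortLists z) atTop atTop :=
  tendsto_atTop_finset_of_monotone
    (fun _ _ hmn _ hl => mem_shortLists.2 ((mem_shortLists.1 hl).trans_le hmn))
    fun l => ⟨l.length + 1, mem_shortLists.2 (Nat.lt_succ_self _)⟩

/-- The probability that the chain started at `x` does not visit `z` at the times `1, …, k`. -/
def survival (z : X) (Q : Matrix X X ℝ) : ℕ → X → ℝ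
  | 0, _ => 1
  | k + 1, x => ∑ y : {y : X // y ≠ z}, Q x y * survival z Q k y

end Loops

/-- Stochastic matrices. -/
structure IsStochastic {X : Type*} [Fintype X] (Q : Matrix X X ℝ) : Prop where
  nonneg : ∀ x y, 0 ≤ Q x y
  sum_eq : ∀ x, ∑ y, Q x y = 1

section Stochastic

variable {X : Type*} [Fintype X] [DecidableEq X] {Q : Matrix X X ℝ} {z : X}

theorem IsStochastic.add_sum_ne (hQ : IsStochastic Q) (z x : X) :
    Q x z + ∑ y : {y : X // y ≠ z}, Q x y = 1 := by
  rw [← hQ.sum_eq x, Fintype.sum_eq_add_sum_subtype_ne _ z]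

theorem survival_nonneg (hQ : IsStochastic Q) (k : ℕ) (x : X) : 0 ≤ survival z Q k x := by
  induction k generalizing x with
  | zero => exact zero_le_one
  | succ k ih => exact Finset.sum_nonneg fun y _ => mul_nonneg (hQ.nonneg _ _) (ih _)

theorem survival_le_one (hQ : IsStochastic Q) (k : ℕ) (x : X) : survival z Q k x ≤ 1 := by
  induction k generalizing x with
  | zero => exact le_rfl
  | succ k ih =>
    calc survival z Q (k + 1) x ≤ ∑ y : {y : X // y ≠ z}, Q x y * 1 :=
          Finset.sum_le_sum fun y _ => mul_le_mul_of_nonneg_left (ih y) (hQ.nonneg _ _)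
      _ ≤ 1 := by
          have := hQ.add_sum_ne z x
          have := hQ.nonneg x z
          simp only [mul_one]
          linarith

theorem survival_anti (hQ : IsStochastic Q) (x : X) : Antitone fun k => survival z Q k x := by
  refine antitone_nat_of_succ_le fun k => ?_
  induction k generalizing x with
  | zero => exact survival_le_one hQ 1 x
  | succ k ih =>
    exact Finset.sum_le_sum fun y _ => mul_le_mul_of_nonneg_left (ih y) (hQ.nonneg _ _)

theorem IsStochastic.pow (hQ : IsStochastic Q) (k : ℕ) : IsStochastic (Q ^ k) := by
  induction k with
  | zero =>
    refine ⟨fun x y => ?_, fun x => by simp [Matrix.one_apply]⟩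
    rw [pow_zero, Matrix.one_apply]; split_ifs <;> norm_num
  | succ k ih =>
    refine ⟨fun x y => ?_, fun x => ?_⟩
    · rw [pow_succ, Matrix.mul_apply]
      exact Finset.sum_nonneg fun w _ => mul_nonneg (ih.nonneg _ _) (hQ.nonneg _ _)
    · simp only [pow_succ, Matrix.mul_apply]
      rw [Finset.sum_comm]
      simp only [← Finset.mul_sum, hQ.sum_eq, mul_one, ih.sum_eq]

/-- The chain cannot be at `z` at time `k + 1` and avoid `z` up to that time. -/
theorem survival_add_pow_le (hQ : IsStochastic Q) (k : ℕ) (x : X) :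
    survival z Q (k + 1) x + (Q ^ (k + 1)) x z ≤ 1 := by
  induction k generalizing x with
  | zero =>
    have := hQ.add_sum_ne z x
    simp only [survival, mul_one, zero_add, pow_one]
    linarith
  | succ k ih =>
    have h1 : (Q ^ (k + 1 + 1)) x z = ∑ y, Q x y * (Q ^ (k + 1)) y z := by
      rw [pow_succ', Matrix.mul_apply]
    rw [h1, Fintype.sum_eq_add_sum_subtype_ne _ z]
    have h2 : (Q ^ (k + 1)) z z ≤ 1 := by
      rw [← (hQ.pow (k + 1)).sum_eq z]
      exact Finset.single_le_sum (fun y _ => (hQ.pow (k + 1)).nonneg z y) (Finset.mem_univ z)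
    have h3 : survival z Q (k + 1 + 1) x + ∑ y : {y : X // y ≠ z}, Q x y * (Q ^ (k + 1)) y z
        ≤ ∑ y : {y : X // y ≠ z}, Q x y := by
      rw [survival, ← Finset.sum_add_distrib]
      refine Finset.sum_le_sum fun y _ => ?_
      rw [← mul_add]
      exact mul_le_of_le_one_right (hQ.nonneg _ _) (ih y)
    have := hQ.add_sum_ne z x
    have := mul_le_of_le_one_right (hQ.nonneg x z) h2
    linarith

theorem sum_shortLists_loopProb (hQ : IsStochastic Q) (n : ℕ) (x : X) :
    ∑ l ∈ shortLists z n, loopProb z Q x l = 1 - survival z Q n x := by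
  induction n generalizing x with
  | zero => simp [shortLists, survival]
  | succ n ih =>
    rw [sum_shortLists_succ]
    simp only [loopProb_nil, loopProb_cons, ← Finset.mul_sum, ih, mul_sub, mul_one,
      Finset.sum_sub_distrib, survival]
    rw [← hQ.add_sum_ne z x]
    ring

/-- Every state reaches `z` after between one and `N` steps, at a fixed time at which the
probability of being at `z` is at least `δ`. -/
def Reaches (N : ℕ) (δ : ℝ) (Q : Matrix X X ℝ) (z : X) : Prop :=
  ∀ x, ∃ k, 1 ≤ k ∧ k ≤ N ∧ δ ≤ (Q ^ k) x z

/-- The function `c ∑_{k<N} e^{κk} P(τ > k)` with `κ = δ/(2N)`: a Lyapunov function for the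
exponential moment `E[e^{κτ}]` of the return time `τ`. -/
def returnLyapunov (N : ℕ) (δ : ℝ) (z : X) (Q : Matrix X X ℝ) (x : X) : ℝ :=
  2 * Real.exp (δ / (2 * N)) / δ *
    ∑ k ∈ Finset.range N, Real.exp (δ / (2 * N) * k) * survival z Q k x

/-- A bound of `returnLyapunov` that is uniform in the transition matrix. -/
def returnBound (N : ℕ) (δ : ℝ) : ℝ :=
  2 * Real.exp (δ / (2 * N)) / δ * (N * Real.exp (δ / 2))

theorem returnLyapunov_le (hQ : IsStochastic Q) {N : ℕ} (hN : 0 < N) {δ : ℝ} (hδ : 0 < δ) (x : X) :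
    returnLyapunov N δ z Q x ≤ returnBound N δ := by
  have hN' : (0 : ℝ) < N := by exact_mod_cast hN
  unfold returnLyapunov returnBound
  gcongr
  calc ∑ k ∈ Finset.range N, Real.exp (δ / (2 * N) * k) * survival z Q k x
      ≤ ∑ k ∈ Finset.range N, Real.exp (δ / 2) := by
        refine Finset.sum_le_sum fun k hk => ?_
        have hkN : (k : ℝ) ≤ N := by exact_mod_cast (Finset.mem_range.1 hk).le
        refine (mul_le_of_le_one_right (Real.exp_pos _).le (survival_le_one hQ k x)).trans
          (Real.exp_le_exp.2 ?_)
        rw [div_mul_eq_mul_div, div_le_div_iff₀ (by positivity) two_pos]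
        nlinarith
    _ = _ := by simp

/-- The drift inequality of the Lyapunov function. One step shifts the sum that defines it by one
index, so the term `1` is traded for `e^{κN} P(τ > N)`, which is at most `1 - δ/2` because
`P(τ > N) ≤ 1 - δ`. -/
theorem returnLyapunov_drift (hQ : IsStochastic Q) {N : ℕ} (hN : 0 < N) {δ : ℝ} (hδ : 0 < δ)
    (hreach : Reaches N δ Q z) (x : X) :
    Real.exp (δ / (2 * N)) * (Q x z + ∑ y : {y : X // y ≠ z}, Q x y * returnLyapunov N δ z Q y)
      ≤ returnLyapunov N δ z Q x := by
  have hN' : (0 : ℝ) < N := by exact_mod_cast hN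
  set κ := δ / (2 * (N : ℝ)) with hκ
  have hκN : κ * N = δ / 2 := by rw [hκ]; field_simp
  have hSN : survival z Q N x ≤ 1 - δ := by
    obtain ⟨k, hk1, hkN, hk⟩ := hreach x
    have h1 := survival_add_pow_le (z := z) hQ (k - 1) x
    rw [Nat.sub_add_cancel hk1] at h1
    have := survival_anti (z := z) hQ x hkN
    simp only at this
    linarith
  have hδ1 : δ ≤ 1 := by
    have := survival_nonneg (z := z) hQ N x; linarith
  set f : X → ℝ := fun x => ∑ k ∈ Finset.range N, Real.exp (κ * k) * survival z Q k x with hf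
  have hF : ∀ x, returnLyapunov N δ z Q x = 2 * Real.exp κ / δ * f x := fun x => rfl
  have hshift : Real.exp κ * ∑ y : {y : X // y ≠ z}, Q x y * f y
      = f x - 1 + Real.exp (κ * N) * survival z Q N x := by
    have h1 : ∑ y : {y : X // y ≠ z}, Q x y * f y
        = ∑ k ∈ Finset.range N, Real.exp (κ * k) * survival z Q (k + 1) x := by
      simp only [hf, Finset.mul_sum, survival]
      rw [Finset.sum_comm]
      refine Finset.sum_congr rfl fun k _ => Finset.sum_congr rfl fun y _ => by ring
    have h2 := Finset.sum_range_succ' (fun k : ℕ => Real.exp (κ * k) * survival z Q k x) N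
    rw [Finset.sum_range_succ] at h2
    rw [h1, Finset.mul_sum]
    have h3 : ∑ k ∈ Finset.range N, Real.exp κ * (Real.exp (κ * k) * survival z Q (k + 1) x)
        = ∑ k ∈ Finset.range N, Real.exp (κ * ((k + 1 : ℕ) : ℝ)) * survival z Q (k + 1) x := by
      refine Finset.sum_congr rfl fun k _ => ?_
      rw [← mul_assoc, ← Real.exp_add]
      congr 2
      push_cast; ring
    rw [h3]
    have h4 : survival z Q 0 x = 1 := rfl
    simp only [h4, Nat.cast_zero, mul_zero, Real.exp_zero, mul_one] at h2
    simp only [hf]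
    linarith
  have hexp : Real.exp (κ * N) * survival z Q N x ≤ 1 - δ / 2 := by
    rw [hκN]
    have h1 : Real.exp (δ / 2) * (1 - δ / 2) ≤ 1 := by
      have := Real.add_one_le_exp (-(δ / 2))
      calc Real.exp (δ / 2) * (1 - δ / 2) ≤ Real.exp (δ / 2) * Real.exp (-(δ / 2)) := by
            gcongr; linarith
        _ = 1 := by rw [← Real.exp_add]; simp
    calc Real.exp (δ / 2) * survival z Q N x ≤ Real.exp (δ / 2) * (1 - δ) := by gcongr
      _ ≤ Real.exp (δ / 2) * ((1 - δ / 2) * (1 - δ / 2)) := by gcongr; nlinarith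
      _ = Real.exp (δ / 2) * (1 - δ / 2) * (1 - δ / 2) := by ring
      _ ≤ 1 * (1 - δ / 2) := mul_le_mul_of_nonneg_right h1 (by linarith)
      _ = _ := one_mul _
  have hz1 : Q x z ≤ 1 := by
    have := hQ.add_sum_ne z x
    have : 0 ≤ ∑ y : {y : X // y ≠ z}, Q x y := Finset.sum_nonneg fun y _ => hQ.nonneg _ _
    linarith
  simp only [hF]
  have : ∑ y : {y : X // y ≠ z}, Q x y * (2 * Real.exp κ / δ * f y)
      = 2 * Real.exp κ / δ * ∑ y : {y : X // y ≠ z}, Q x y * f y := by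
    rw [Finset.mul_sum]; exact Finset.sum_congr rfl fun y _ => by ring
  rw [this]
  have e1 : Real.exp κ * (Q x z + 2 * Real.exp κ / δ * ∑ y : {y : X // y ≠ z}, Q x y * f y)
      = Real.exp κ * Q x z + 2 * Real.exp κ / δ
        * (f x - 1 + Real.exp (κ * N) * survival z Q N x) := by rw [← hshift]; ring
  rw [e1]
  have e2 : 2 * Real.exp κ / δ * (f x - 1 + Real.exp (κ * N) * survival z Q N x)
      ≤ 2 * Real.exp κ / δ * (f x - δ / 2) := by gcongr; linarith
  have e3 : 2 * Real.exp κ / δ * (f x - δ / 2) = 2 * Real.exp κ / δ * f x - Real.exp κ := by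
    field_simp
  have e4 : Real.exp κ * Q x z ≤ Real.exp κ := mul_le_of_le_one_right (Real.exp_pos _).le hz1
  linarith

theorem returnLyapunov_nonneg (hQ : IsStochastic Q) (N : ℕ) {δ : ℝ} (hδ : 0 < δ) (x : X) :
    0 ≤ returnLyapunov N δ z Q x := by
  unfold returnLyapunov
  have : ∀ k, 0 ≤ survival z Q k x := fun k => survival_nonneg hQ k x
  have : 0 ≤ ∑ k ∈ Finset.range N, Real.exp (δ / (2 * N) * k) * survival z Q k x :=
    Finset.sum_nonneg fun k _ => mul_nonneg (Real.exp_pos _).le (this k)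
  positivity

/-- The return time to a uniformly reachable state has a uniform exponential moment. -/
theorem sum_loopProb_exp_le (hQ : IsStochastic Q) {N : ℕ} (hN : 0 < N) {δ : ℝ} (hδ : 0 < δ)
    (hreach : Reaches N δ Q z) (x : X) (s : Finset (List {y : X // y ≠ z})) :
    ∑ l ∈ s, loopProb z Q x l * Real.exp (δ / (2 * N) * (l.length + 1)) ≤ returnBound N δ := by
  have hn : ∀ n x, ∑ l ∈ shortLists z n, loopProb z Q x l * Real.exp (δ / (2 * N) * (l.length + 1))
      ≤ returnLyapunov N δ z Q x := by
    intro n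
    induction n with
    | zero => intro x; simpa [shortLists] using returnLyapunov_nonneg hQ N hδ x
    | succ n ih =>
      intro x
      refine le_trans ?_ (returnLyapunov_drift hQ hN hδ hreach x)
      rw [sum_shortLists_succ, mul_add _ (Q x z), Finset.mul_sum]
      refine add_le_add (le_of_eq (by simp [loopProb_nil, mul_comm])) ?_
      refine Finset.sum_le_sum fun y _ => ?_
      calc ∑ l ∈ shortLists z n, loopProb z Q x (y :: l)
            * Real.exp (δ / (2 * N) * (((y :: l).length : ℝ) + 1))
          = Real.exp (δ / (2 * N)) * (Q x y * ∑ l ∈ shortLists z n, loopProb z Q y l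
            * Real.exp (δ / (2 * N) * (l.length + 1))) := by
            rw [Finset.mul_sum, Finset.mul_sum]
            refine Finset.sum_congr rfl fun l _ => ?_
            have : Real.exp (δ / (2 * N) * (((y :: l).length : ℝ) + 1))
                = Real.exp (δ / (2 * N)) * Real.exp (δ / (2 * N) * (l.length + 1)) := by
              rw [← Real.exp_add]; congr 1; push_cast [List.length_cons]; ring
            rw [loopProb_cons, this]; ring
        _ ≤ _ := by
            have := hQ.nonneg x y
            gcongr
            exact ih y
  obtain ⟨n, hn'⟩ := ((tendsto_shortLists z).eventually (eventually_ge_atTop s)).exists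
  calc _ ≤ ∑ l ∈ shortLists z n, loopProb z Q x l * Real.exp (δ / (2 * N) * (l.length + 1)) :=
        Finset.sum_le_sum_of_subset_of_nonneg hn' fun l _ _ =>
          mul_nonneg (loopProb_nonneg z hQ.nonneg x l) (Real.exp_pos _).le
    _ ≤ _ := (hn n x).trans (returnLyapunov_le hQ hN hδ x)

theorem hasSum_loopProb (hQ : IsStochastic Q) {N : ℕ} (hN : 0 < N) {δ : ℝ} (hδ : 0 < δ)
    (hreach : Reaches N δ Q z) (x : X) : HasSum (loopProb z Q x) 1 := by
  have hN' : (0 : ℝ) < N := by exact_mod_cast hN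
  set κ := δ / (2 * (N : ℝ)) with hκ
  have hκ0 : 0 < κ := by positivity
  have hδ1 : δ ≤ 1 := by
    obtain ⟨k, hk1, hkN, hk⟩ := hreach x
    have h1 := survival_add_pow_le (z := z) hQ (k - 1) x
    rw [Nat.sub_add_cancel hk1] at h1
    have := survival_nonneg (z := z) hQ k x
    linarith
  have hs : ∀ n x, survival z Q n x ≤ Real.exp (-κ * n) * returnLyapunov N δ z Q x := by
    intro n
    induction n with
    | zero =>
      intro x
      have h1 : (1 : ℝ) ≤ ∑ k ∈ Finset.range N, Real.exp (κ * k) * survival z Q k x := by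
        have := Finset.single_le_sum (f := fun k : ℕ => Real.exp (κ * k) * survival z Q k x)
          (fun k _ => mul_nonneg (Real.exp_pos _).le (survival_nonneg hQ k x))
          (Finset.mem_range.2 hN)
        simpa [survival] using this
      have h2 : (1 : ℝ) ≤ 2 * Real.exp κ / δ := by
        rw [le_div_iff₀ hδ]
        have := Real.one_le_exp hκ0.le
        linarith
      simp only [survival, Nat.cast_zero, mul_zero, Real.exp_zero, one_mul]
      exact one_le_mul_of_one_le_of_one_le h2 h1
    | succ n ih =>
      intro x
      have hd := returnLyapunov_drift hQ hN hδ hreach x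
      rw [← hκ] at hd
      have h1 : survival z Q (n + 1) x
          ≤ Real.exp (-κ * n) * ∑ y : {y : X // y ≠ z}, Q x y * returnLyapunov N δ z Q y := by
        rw [survival, Finset.mul_sum]
        refine Finset.sum_le_sum fun y _ => ?_
        calc Q x y * survival z Q n y ≤ Q x y * (Real.exp (-κ * n) * returnLyapunov N δ z Q y) :=
              mul_le_mul_of_nonneg_left (ih y) (hQ.nonneg _ _)
          _ = _ := by ring
      have h2 : ∑ y : {y : X // y ≠ z}, Q x y * returnLyapunov N δ z Q y
          ≤ Real.exp (-κ) * returnLyapunov N δ z Q x := by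
        have h3 : Real.exp (-κ) * Real.exp κ = 1 := by rw [← Real.exp_add]; simp
        have h4 := mul_le_mul_of_nonneg_left hd (Real.exp_pos (-κ)).le
        rw [← mul_assoc, h3, one_mul] at h4
        have := hQ.nonneg x z
        linarith
      calc _ ≤ _ := h1
        _ ≤ Real.exp (-κ * n) * (Real.exp (-κ) * returnLyapunov N δ z Q x) := by gcongr
        _ = _ := by
            rw [← mul_assoc, ← Real.exp_add]; congr 2; push_cast; ring
  have hsum : Summable (loopProb z Q x) := by
    refine summable_of_sum_le (c := returnBound N δ)
      (fun l => loopProb_nonneg z hQ.nonneg x l) fun s => ?_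
    refine le_trans (Finset.sum_le_sum fun l _ => ?_) (sum_loopProb_exp_le hQ hN hδ hreach x s)
    exact le_mul_of_one_le_right (loopProb_nonneg z hQ.nonneg x l)
      (Real.one_le_exp (by positivity))
  have hlim : Tendsto (fun n => ∑ l ∈ shortLists z n, loopProb z Q x l) atTop (𝓝 1) := by
    simp only [sum_shortLists_loopProb hQ]
    have h0 : Tendsto (fun n => survival z Q n x) atTop (𝓝 0) := by
      refine squeeze_zero (fun n => survival_nonneg hQ n x) (fun n => hs n x) ?_
      have : Tendsto (fun n : ℕ => Real.exp (-κ * n)) atTop (𝓝 0) := by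
        apply Real.tendsto_exp_atBot.comp
        exact tendsto_natCast_atTop_atTop.const_mul_atTop_of_neg (by linarith)
      simpa using this.mul_const (returnLyapunov N δ z Q x)
    simpa using h0.const_sub 1
  have h2 := hsum.hasSum.comp (tendsto_shortLists z)
  rw [← tendsto_nhds_unique h2 hlim]
  exact hsum.hasSum

end Stochastic

/-! ### Perron eigenvectors and the tilted chain -/

section Perron

variable {X : Type*} [Fintype X] [DecidableEq X]

theorem pow_nonneg_of_nonneg {A : Matrix X X ℝ} (hA : ∀ x y, 0 ≤ A x y) (k : ℕ) (x y : X) :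
    0 ≤ (A ^ k) x y := by
  induction k generalizing x y with
  | zero => rw [pow_zero, Matrix.one_apply]; split_ifs <;> norm_num
  | succ k ih =>
    rw [pow_succ, Matrix.mul_apply]
    exact Finset.sum_nonneg fun w _ => mul_nonneg (ih _ _) (hA _ _)

theorem pow_mulVec_eq {A : Matrix X X ℝ} {r : ℝ} {v : X → ℝ} (h : A.mulVec v = r • v) (k : ℕ) :
    (A ^ k).mulVec v = r ^ k • v := by
  induction k with
  | zero => simp
  | succ k ih => rw [pow_succ, ← Matrix.mulVec_mulVec, h, Matrix.mulVec_smul, ih, smul_smul,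
      pow_succ']

/-- **Perron's theorem**, by maximization of the Collatz–Wielandt quotient: a nonnegative
irreducible matrix has a positive eigenvector with a positive eigenvalue. -/
theorem exists_perron [Nonempty X] {A : Matrix X X ℝ} (hA : ∀ x y, 0 ≤ A x y)
    (hirr : ∀ x y, ∃ k, 1 ≤ k ∧ 0 < (A ^ k) x y) :
    ∃ r : ℝ, 0 < r ∧ ∃ v : X → ℝ, (∀ x, 0 < v x) ∧ A.mulVec v = r • v := by
  choose k hk1 hk using hirr
  obtain ⟨K, hK⟩ : ∃ K, ∀ x y, k x y < K := by
    refine ⟨(Finset.univ.sup fun x => Finset.univ.sup fun y => k x y) + 1, fun x y => ?_⟩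
    rw [Nat.lt_succ_iff]
    exact (Finset.le_sup (f := fun y => k x y) (Finset.mem_univ y)).trans
      (Finset.le_sup (f := fun x => Finset.univ.sup fun y => k x y) (Finset.mem_univ x))
  -- a polynomial of `A` with positive entries
  set B : Matrix X X ℝ := ∑ j ∈ Finset.range K, A ^ j with hB
  have hBpos : ∀ x y, 0 < B x y := fun x y => by
    rw [hB, Matrix.sum_apply]
    exact Finset.sum_pos' (fun j _ => pow_nonneg_of_nonneg hA j x y)
      ⟨k x y, Finset.mem_range.2 (hK x y), hk x y⟩
  have hBA : B * A = A * B := by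
    rw [hB, Finset.sum_mul, Finset.mul_sum]
    exact Finset.sum_congr rfl fun j _ => ((Commute.refl A).pow_left j).eq
  have hBvpos : ∀ w : X → ℝ, (∀ x, 0 ≤ w x) → (∃ x, 0 < w x) → ∀ x, 0 < B.mulVec w x := by
    rintro w hw ⟨y, hy⟩ x
    exact Finset.sum_pos' (fun j _ => mul_nonneg (hBpos x j).le (hw j))
      ⟨y, Finset.mem_univ y, mul_pos (hBpos x y) hy⟩
  set R := ∑ x, ∑ y, A x y with hR
  have hbound : ∀ (r : ℝ) (v : X → ℝ), v ∈ stdSimplex ℝ X → (∀ x, r * v x ≤ A.mulVec v x) →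
      r ≤ R := by
    intro r v hv h
    calc r = ∑ x, r * v x := by rw [← Finset.mul_sum, hv.2, mul_one]
      _ ≤ ∑ x, A.mulVec v x := Finset.sum_le_sum fun x _ => h x
      _ ≤ R := by
          refine Finset.sum_le_sum fun x _ => Finset.sum_le_sum fun y _ => ?_
          refine mul_le_of_le_one_right (hA x y) ?_
          rw [← hv.2]
          exact Finset.single_le_sum (fun y _ => hv.1 y) (Finset.mem_univ y)
  -- the numbers below the Collatz–Wielandt quotients of the vectors in the simplex
  set T : Set (ℝ × (X → ℝ)) :=
    (Set.Icc 0 R ×ˢ stdSimplex ℝ X) ∩ {p | ∀ x, p.1 * p.2 x ≤ A.mulVec p.2 x} with hT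
  have hTc : IsCompact T := by
    refine (isCompact_Icc.prod (isCompact_stdSimplex ℝ X)).inter_right ?_
    simp only [Set.ofPred_forall]
    refine isClosed_iInter fun x => isClosed_le (by fun_prop) ?_
    simp only [Matrix.mulVec, dotProduct]
    fun_prop
  have hTne : T.Nonempty := by
    obtain ⟨x⟩ := ‹Nonempty X›
    refine ⟨(0, Pi.single x 1), ⟨⟨le_rfl, ?_⟩, single_mem_stdSimplex ℝ x⟩, fun y => ?_⟩
    · exact Finset.sum_nonneg fun x _ => Finset.sum_nonneg fun y _ => hA x y
    · simp only [zero_mul]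
      exact Finset.sum_nonneg fun w _ => mul_nonneg (hA _ _) ((single_mem_stdSimplex ℝ x).1 w)
  obtain ⟨⟨r, v⟩, ⟨⟨⟨hr0, -⟩, hv⟩, hrv⟩, hmax⟩ :=
    hTc.exists_isMaxOn hTne continuous_fst.continuousOn
  simp only at hr0 hv hrv
  have hvne : ∃ x, 0 < v x := by
    by_contra! h
    have : ∑ x, v x ≤ 0 := Finset.sum_nonpos fun x _ => h x
    rw [hv.2] at this
    linarith
  have hupos := hBvpos v hv.1 hvne
  -- if `A v ≥ r v` were not an equation, the vector `B v` would have a larger quotient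
  have heq : A.mulVec v = r • v := by
    by_contra hne
    set w : X → ℝ := A.mulVec v - r • v with hw
    have hw0 : ∀ x, 0 ≤ w x := fun x => by simpa [hw] using hrv x
    have hwne : ∃ x, 0 < w x := by
      by_contra! h
      exact hne (sub_eq_zero.1 (funext fun x => le_antisymm (h x) (hw0 x)))
    have hBw := hBvpos w hw0 hwne
    set u := B.mulVec v with hu
    have hAu : ∀ x, A.mulVec u x = r * u x + B.mulVec w x := fun x => by
      have : B.mulVec w = A.mulVec u - r • u := by
        rw [hw, Matrix.mulVec_sub, Matrix.mulVec_smul, Matrix.mulVec_mulVec, hBA,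
          ← Matrix.mulVec_mulVec]
      rw [this]; simp
    obtain ⟨ε, hε, hεle⟩ : ∃ ε : ℝ, 0 < ε ∧ ∀ x, ε * u x ≤ B.mulVec w x := by
      obtain ⟨x₀, -, hx₀⟩ := Finset.exists_min_image Finset.univ
        (fun x => B.mulVec w x / u x) Finset.univ_nonempty
      refine ⟨B.mulVec w x₀ / u x₀, div_pos (hBw _) (hupos _), fun x => ?_⟩
      have := hx₀ x (Finset.mem_univ x)
      rwa [le_div_iff₀ (hupos x)] at this
    have hs : 0 < ∑ x, u x := Finset.sum_pos (fun x _ => hupos x) Finset.univ_nonempty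
    have hmem : (∑ x, u x)⁻¹ • u ∈ stdSimplex ℝ X := by
      refine ⟨fun x => mul_nonneg (inv_nonneg.2 hs.le) (hupos x).le, ?_⟩
      simp only [Pi.smul_apply, smul_eq_mul, ← Finset.mul_sum]
      exact inv_mul_cancel₀ hs.ne'
    have hle : ∀ x, (r + ε) * ((∑ x, u x)⁻¹ • u) x ≤ A.mulVec ((∑ x, u x)⁻¹ • u) x := by
      intro x
      rw [Matrix.mulVec_smul]
      simp only [Pi.smul_apply, smul_eq_mul, hAu]
      have := mul_le_mul_of_nonneg_left (hεle x) (inv_nonneg.2 hs.le)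
      nlinarith
    have := hmax (show (r + ε, (∑ x, u x)⁻¹ • u) ∈ T from
      ⟨⟨⟨by linarith, hbound _ _ hmem hle⟩, hmem⟩, hle⟩)
    simp only [Set.mem_ofPred_eq] at this
    linarith
  have hBv : B.mulVec v = (∑ j ∈ Finset.range K, r ^ j) • v := by
    rw [hB, Matrix.sum_mulVec, Finset.sum_smul]
    exact Finset.sum_congr rfl fun j _ => pow_mulVec_eq heq j
  have hs : 0 ≤ ∑ j ∈ Finset.range K, r ^ j := Finset.sum_nonneg fun j _ => pow_nonneg hr0 j
  have hvpos : ∀ x, 0 < v x := fun x => by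
    have := hupos x
    rw [hBv, Pi.smul_apply, smul_eq_mul] at this
    exact pos_of_mul_pos_right this hs
  refine ⟨r, ?_, v, hvpos, heq⟩
  obtain ⟨x⟩ := ‹Nonempty X›
  have h1 := congrFun (pow_mulVec_eq heq (k x x)) x
  have h2 : 0 < (A ^ k x x).mulVec v x := Finset.sum_pos'
    (fun j _ => mul_nonneg (pow_nonneg_of_nonneg hA _ _ _) (hvpos j).le)
    ⟨x, Finset.mem_univ x, mul_pos (hk x x) (hvpos x)⟩
  rw [h1] at h2
  have h3 := pos_of_mul_pos_left h2 (hvpos x).le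
  by_contra hr
  have : r = 0 := le_antisymm (not_lt.1 hr) hr0
  rw [this, zero_pow (by have := hk1 x x; omega)] at h3
  exact lt_irrefl _ h3

/-- Entrywise comparison of the powers of nonnegative matrices. -/
theorem pow_le_pow_of_le {A B : Matrix X X ℝ} {t : ℝ} (hA : ∀ x y, 0 ≤ A x y) (ht : 0 ≤ t)
    (h : ∀ x y, t * A x y ≤ B x y) (k : ℕ) (x y : X) : t ^ k * (A ^ k) x y ≤ (B ^ k) x y := by
  induction k generalizing x y with
  | zero => simp
  | succ k ih =>
    simp only [pow_succ _ k, Matrix.mul_apply, Finset.mul_sum]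
    refine Finset.sum_le_sum fun w _ => ?_
    calc t ^ k * t * ((A ^ k) x w * A w y) = (t ^ k * (A ^ k) x w) * (t * A w y) := by ring
      _ ≤ _ := mul_le_mul (ih x w) (h w y) (mul_nonneg ht (hA _ _))
          ((mul_nonneg (pow_nonneg ht k) (pow_nonneg_of_nonneg hA _ _ _)).trans (ih x w))

/-- A lower bound of the ratios of the tilted to the original transition probabilities. -/
def tiltRatio (K : ℝ) (N : ℕ) (δ : ℝ) : ℝ := Real.exp (-(2 * K)) * (Real.exp (-(2 * K * N)) * δ)

/-- The Perron eigenvalue `exp Λ` of the matrix `exp (c x) P(x,y)`, with its eigenvector `v`.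
Along loops at `z`, the weights `P e^{c - Λ}` are the probabilities of the tilted chain
`e^{c(x) - Λ} P(x,y) v(y) / v(x)`, because the factors `v(y) / v(x)` cancel. The tilted chain
reaches `z` uniformly, so its return time has a uniform exponential moment. -/
theorem exists_tilt {N : ℕ} (hN : 0 < N) {δ K : ℝ} (hδ : 0 < δ) (hK : 0 ≤ K) {P : Matrix X X ℝ}
    (hP : IsStochastic P) (hreach : ∀ z, Reaches N δ P z) {c : X → ℝ} (hc : ∀ x, |c x| ≤ K)
    (z : X) :
    ∃ Λ : ℝ, |Λ| ≤ K ∧ ∃ v : X → ℝ, (∀ x, 0 < v x) ∧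
      (∀ x, ∑ y, Real.exp (c x) * P x y * v y = Real.exp Λ * v x) ∧
      HasSum (fun l => loopProb z P z l *
        Real.exp (∑ i ∈ Finset.range (l.length + 1), (c (loopPath z z l i) - Λ))) 1 ∧
      ∀ s : Finset (List {y : X // y ≠ z}), ∑ l ∈ s, loopProb z P z l *
        Real.exp (∑ i ∈ Finset.range (l.length + 1), (c (loopPath z z l i) - Λ)) *
          Real.exp (tiltRatio K N δ ^ N * δ / (2 * N) * (l.length + 1))
        ≤ returnBound N (tiltRatio K N δ ^ N * δ) := by
  have : Nonempty X := ⟨z⟩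
  set A : Matrix X X ℝ := fun x y => Real.exp (c x) * P x y with hA
  have hA0 : ∀ x y, 0 ≤ A x y := fun x y => mul_nonneg (Real.exp_pos _).le (hP.nonneg x y)
  have hPA : ∀ x y, Real.exp (-K) * P x y ≤ A x y := fun x y =>
    mul_le_mul_of_nonneg_right (Real.exp_le_exp.2 (by linarith [(abs_le.1 (hc x)).1]))
      (hP.nonneg x y)
  have hAk := pow_le_pow_of_le hP.nonneg (Real.exp_pos _).le hPA
  obtain ⟨r, hr, v, hv, hAv⟩ := exists_perron hA0 fun x y => by
    obtain ⟨k, h1, -, hk⟩ := hreach y x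
    exact ⟨k, h1, lt_of_lt_of_le (mul_pos (pow_pos (Real.exp_pos _) k) (hδ.trans_le hk))
      (hAk k x y)⟩
  have hAvx : ∀ x, ∑ y, Real.exp (c x) * P x y * v y = r * v x := fun x => congrFun hAv x
  have hrK : r ≤ Real.exp K := by
    obtain ⟨x, -, hx⟩ := Finset.exists_max_image Finset.univ v Finset.univ_nonempty
    have h1 : r * v x ≤ Real.exp K * v x := by
      rw [← hAvx x]
      calc ∑ y, Real.exp (c x) * P x y * v y ≤ ∑ y, Real.exp K * P x y * v x := by
            refine Finset.sum_le_sum fun y _ => ?_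
            have h1 := hP.nonneg x y
            have h2 := hx y (Finset.mem_univ y)
            have h3 := (hv y).le
            have h4 := (abs_le.1 (hc x)).2
            gcongr
        _ = _ := by rw [← Finset.sum_mul, ← Finset.mul_sum, hP.sum_eq, mul_one]
    exact le_of_mul_le_mul_right h1 (hv x)
  have hrK' : Real.exp (-K) ≤ r := by
    obtain ⟨x, -, hx⟩ := Finset.exists_min_image Finset.univ v Finset.univ_nonempty
    have h1 : Real.exp (-K) * v x ≤ r * v x := by
      rw [← hAvx x]
      calc Real.exp (-K) * v x = ∑ y, Real.exp (-K) * P x y * v x := by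
            rw [← Finset.sum_mul, ← Finset.mul_sum, hP.sum_eq, mul_one]
        _ ≤ ∑ y, Real.exp (c x) * P x y * v y := by
            refine Finset.sum_le_sum fun y _ => ?_
            have h1 := hP.nonneg x y
            have h2 := hx y (Finset.mem_univ y)
            have h3 := (hv x).le
            have h4 := (abs_le.1 (hc x)).1
            gcongr
    exact le_of_mul_le_mul_right h1 (hv x)
  -- the eigenvector is bounded below by a fixed multiple of any of its entries
  have hharnack : ∀ x y, Real.exp (-(2 * K * N)) * δ * v y ≤ v x := by
    intro x y
    obtain ⟨k, -, hkN, hk⟩ := hreach y x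
    have h1 : Real.exp (-K) ^ k * δ * v y ≤ r ^ k * v x := by
      have h2 := congrFun (pow_mulVec_eq hAv k) x
      rw [Pi.smul_apply, smul_eq_mul] at h2
      rw [← h2]
      calc Real.exp (-K) ^ k * δ * v y ≤ (A ^ k) x y * v y := by
            have := hAk k x y
            refine mul_le_mul_of_nonneg_right (le_trans ?_ this) (hv y).le
            gcongr
        _ ≤ _ := Finset.single_le_sum (f := fun y => (A ^ k) x y * v y)
            (fun w _ => mul_nonneg (pow_nonneg_of_nonneg hA0 k x w) (hv w).le) (Finset.mem_univ y)
    have h3 : r ^ k * v x ≤ Real.exp K ^ k * v x :=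
      mul_le_mul_of_nonneg_right (pow_le_pow_left₀ hr.le hrK k) (hv x).le
    have h4 : Real.exp (-(2 * K * N)) ≤ Real.exp (-K) ^ k * Real.exp (-K) ^ k := by
      rw [← Real.exp_nat_mul, ← Real.exp_add, Real.exp_le_exp]
      have : (k : ℝ) ≤ N := by exact_mod_cast hkN
      nlinarith
    have h5 : Real.exp (-K) ^ k * Real.exp K ^ k = 1 := by
      rw [← mul_pow, ← Real.exp_add]; simp
    have := hv y
    calc Real.exp (-(2 * K * N)) * δ * v y
        ≤ Real.exp (-K) ^ k * Real.exp (-K) ^ k * δ * v y := by gcongr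
      _ = Real.exp (-K) ^ k * (Real.exp (-K) ^ k * δ * v y) := by ring
      _ ≤ Real.exp (-K) ^ k * (Real.exp K ^ k * v x) :=
          mul_le_mul_of_nonneg_left (h1.trans h3) (by positivity)
      _ = v x := by rw [← mul_assoc, h5, one_mul]
  set Λ := Real.log r with hΛ
  have hrΛ : Real.exp Λ = r := Real.exp_log hr
  have hΛK : |Λ| ≤ K := abs_le.2
    ⟨(Real.le_log_iff_exp_le hr).2 hrK', (Real.log_le_iff_le_exp hr).2 hrK⟩
  set Q : Matrix X X ℝ := fun x y => Real.exp (c x - Λ) * P x y * v y / v x with hQdef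
  have hQ : IsStochastic Q := by
    refine ⟨fun x y => div_nonneg (mul_nonneg (mul_nonneg (Real.exp_pos _).le (hP.nonneg x y))
      (hv y).le) (hv x).le, fun x => ?_⟩
    have h1 := hAvx x
    have : ∀ y, Q x y = (Real.exp (c x) * P x y * v y) / (r * v x) := fun y => by
      simp only [hQdef, Real.exp_sub, hrΛ]
      have := hv x
      field_simp
    simp only [this]
    rw [← Finset.sum_div, h1, div_self (mul_pos hr (hv x)).ne']
  set t := tiltRatio K N δ with ht
  have ht0 : 0 < t := mul_pos (Real.exp_pos _) (mul_pos (Real.exp_pos _) hδ)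
  have hPQ : ∀ x y, t * P x y ≤ Q x y := fun x y => by
    have h1 := hharnack y x
    rw [hQdef]
    simp only
    rw [le_div_iff₀ (hv x)]
    have h2 : Real.exp (-(2 * K)) ≤ Real.exp (c x - Λ) := Real.exp_le_exp.2 (by
      linarith [(abs_le.1 (hc x)).1, (abs_le.1 hΛK).2])
    have h3 := hP.nonneg x y
    calc t * P x y * v x = Real.exp (-(2 * K)) * P x y * (Real.exp (-(2 * K * N)) * δ * v x) := by
          rw [ht, tiltRatio]; ring
      _ ≤ _ := mul_le_mul (mul_le_mul_of_nonneg_right h2 h3) h1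
          (by have := hv x; positivity) (by positivity)
  have hδ1 : δ ≤ 1 := by
    obtain ⟨k, -, -, hk⟩ := hreach z z
    refine hk.trans ?_
    rw [← (hP.pow k).sum_eq z]
    exact Finset.single_le_sum (fun y _ => (hP.pow k).nonneg z y) (Finset.mem_univ z)
  have ht1 : t ≤ 1 := by
    rw [ht, tiltRatio]
    exact mul_le_one₀ (Real.exp_le_one_iff.2 (by linarith)) (by positivity)
      (mul_le_one₀ (Real.exp_le_one_iff.2 (by
        have : (0 : ℝ) ≤ N := N.cast_nonneg
        nlinarith [mul_nonneg hK this])) hδ.le hδ1)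
  have hreachQ : Reaches N (t ^ N * δ) Q z := fun x => by
    obtain ⟨k, h1, h2, hk⟩ := hreach z x
    refine ⟨k, h1, h2, le_trans ?_ (pow_le_pow_of_le hP.nonneg ht0.le hPQ k x z)⟩
    exact mul_le_mul (pow_le_pow_of_le_one ht0.le ht1 h2) hk hδ.le (pow_nonneg ht0.le _)
  have hδQ : 0 < t ^ N * δ := mul_pos (pow_pos ht0 N) hδ
  have hQx : ∀ x y, Q x y = Real.exp (c x - Λ) * P x y * v y / v x := fun _ _ => rfl
  have hloop : ∀ (l : List {y : X // y ≠ z}) (x : X), loopProb z Q x l = loopProb z P x l *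
      Real.exp (∑ i ∈ Finset.range (l.length + 1), (c (loopPath z x l i) - Λ)) * v z / v x := by
    intro l
    induction l with
    | nil => intro x; rw [loopProb_nil, loopProb_nil, hQx]; simp; ring
    | cons y l ih =>
      intro x
      have hs : ∑ i ∈ Finset.range ((y :: l).length + 1), (c (loopPath z x (y :: l) i) - Λ)
          = ∑ i ∈ Finset.range (l.length + 1), (c (loopPath z y l i) - Λ) + (c x - Λ) := by
        rw [List.length_cons, Finset.sum_range_succ']
        simp
      rw [loopProb_cons, loopProb_cons, ih, hs, Real.exp_add, hQx]
      have h1 := (hv x).ne'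
      have h2 := (hv (y : X)).ne'
      field_simp
  have hloopz : ∀ l : List {y : X // y ≠ z}, loopProb z P z l *
      Real.exp (∑ i ∈ Finset.range (l.length + 1), (c (loopPath z z l i) - Λ))
        = loopProb z Q z l := fun l => by
    rw [hloop, mul_div_cancel_right₀ _ (hv z).ne']
  refine ⟨Λ, hΛK, v, hv, fun x => by rw [hrΛ, hAvx], ?_, fun s => ?_⟩
  · simp only [hloopz]
    exact hasSum_loopProb hQ hN hδQ hreachQ z
  · simp only [hloopz]
    exact sum_loopProb_exp_le hQ hN hδQ hreachQ z s

/-- In a family of stochastic matrices whose closure consists of irreducible matrices, all states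
are reached uniformly. -/
theorem exists_uniform_reaches {Θ : Type*} {P : Θ → Matrix X X ℝ}
    (hP : ∀ θ, IsStochastic (P θ))
    (hirr : ∀ Q ∈ closure (Set.range P), Q.IsIrreducible) :
    ∃ N : ℕ, 0 < N ∧ ∃ δ : ℝ, 0 < δ ∧ ∀ θ z, Reaches N δ (P θ) z := by
  have hcomp : IsCompact (closure (Set.range P)) := by
    have hbox : IsCompact (Set.univ.pi fun _ : X => Set.univ.pi fun _ : X => Set.Icc (0 : ℝ) 1) :=
      isCompact_univ_pi fun _ => isCompact_univ_pi fun _ => isCompact_Icc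
    refine hbox.of_isClosed_subset isClosed_closure (closure_minimal ?_ hbox.isClosed)
    rintro _ ⟨θ, rfl⟩ x - y -
    refine ⟨(hP θ).nonneg x y, ?_⟩
    rw [← (hP θ).sum_eq x]
    exact Finset.single_le_sum (fun y _ => (hP θ).nonneg x y) (Finset.mem_univ y)
  -- an increasing open cover by the sets where all states are reached with given constants
  set V : ℕ → Set (Matrix X X ℝ) := fun n =>
    ⋂ x : X, ⋂ z : X, ⋃ k ∈ Set.Icc 1 n, {Q | 1 / ((n : ℝ) + 1) < (Q ^ k) x z} with hV
  have hcont : ∀ (k : ℕ) (x z : X), Continuous fun Q : Matrix X X ℝ => (Q ^ k) x z :=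
    fun k x z => by
      have : Continuous fun Q : Matrix X X ℝ => Q ^ k := continuous_pow k
      exact this.matrix_elem x z
  have hVopen : ∀ n, IsOpen (V n) := fun n =>
    isOpen_iInter_of_finite fun x => isOpen_iInter_of_finite fun z =>
      isOpen_biUnion fun k _ => isOpen_lt continuous_const (hcont k x z)
  have hVmono : Monotone V := by
    intro m n hmn Q hQ
    simp only [hV, Set.mem_iInter, Set.mem_iUnion, Set.mem_ofPred_eq, exists_prop,
      Set.mem_Icc] at hQ ⊢
    intro x z
    obtain ⟨k, ⟨h1, h2⟩, hk⟩ := hQ x z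
    refine ⟨k, ⟨h1, h2.trans hmn⟩, lt_of_le_of_lt ?_ hk⟩
    have : (m : ℝ) ≤ n := by exact_mod_cast hmn
    gcongr
  obtain ⟨N, hN⟩ := hcomp.elim_directed_cover V hVopen (fun Q hQ => by
    have h1 := hirr Q hQ
    rw [Matrix.isIrreducible_iff_exists_pow_pos h1.nonneg] at h1
    choose k hk0 hk using h1
    have h2 : ∀ x z, ∃ n : ℕ, 1 / ((n : ℝ) + 1) < (Q ^ k x z) x z := fun x z =>
      exists_nat_one_div_lt (hk x z)
    choose n hn using h2
    obtain ⟨m, hm⟩ : ∃ m, ∀ x z, k x z ≤ m ∧ n x z ≤ m := by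
      refine ⟨Finset.univ.sup fun x => Finset.univ.sup fun y => max (k x y) (n x y),
        fun x y => ?_⟩
      have h := (Finset.le_sup (f := fun y => max (k x y) (n x y)) (Finset.mem_univ y)).trans
        (Finset.le_sup (f := fun x => Finset.univ.sup fun y => max (k x y) (n x y))
          (Finset.mem_univ x))
      exact ⟨(le_max_left _ _).trans h, (le_max_right _ _).trans h⟩
    refine Set.mem_iUnion.2 ⟨m, ?_⟩
    simp only [hV, Set.mem_iInter, Set.mem_iUnion, Set.mem_ofPred_eq, exists_prop, Set.mem_Icc]
    intro x z
    refine ⟨k x z, ⟨hk0 x z, (hm x z).1⟩, lt_of_le_of_lt ?_ (hn x z)⟩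
    have : (n x z : ℝ) ≤ m := by exact_mod_cast (hm x z).2
    gcongr) hVmono.directed_le
  refine ⟨N + 1, N.succ_pos, 1 / ((N : ℝ) + 1), by positivity, fun θ z x => ?_⟩
  have := hN (subset_closure ⟨θ, rfl⟩)
  simp only [hV, Set.mem_iInter, Set.mem_iUnion, Set.mem_ofPred_eq, exists_prop,
    Set.mem_Icc] at this
  obtain ⟨k, ⟨h1, h2⟩, hk⟩ := this x z
  exact ⟨k, h1, h2.trans N.le_succ, hk.le⟩

end Perron

/-! ### Sums of exponentially controlled functions -/

theorem ExpTaylor.comp_fst {E F : Type*} [NormedAddCommGroup E] [NormedAddCommGroup F] {k : ℝ}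
    {φ : E → ℝ} {ℓ : E → E → ℝ} (h : ExpTaylor k φ ℓ) :
    ExpTaylor k (fun e : E × F => φ e.1) (fun e v => ℓ e.1 v.1) where
  rate_nonneg := h.rate_nonneg
  nonneg e := h.nonneg _
  lin e v := (h.lin e.1 v.1).trans (by
    have := h.nonneg e.1
    have := h.rate_nonneg
    gcongr
    exact norm_fst_le v)
  taylor e v := (h.taylor e.1 v.1).trans (mul_le_mul_of_nonneg_left
    (exp_sub_one_sub_mono (mul_nonneg h.rate_nonneg (norm_nonneg _))
      (mul_le_mul_of_nonneg_left (norm_fst_le v) h.rate_nonneg)) (h.nonneg e.1))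

theorem le_exp_div {κ : ℝ} (hκ : 0 < κ) (x : ℝ) : x ≤ Real.exp (κ * x) / κ := by
  rw [le_div_iff₀ hκ]
  linarith [Real.add_one_le_exp (κ * x)]

theorem summable_of_moment {ι : Type*} {f g : ι → ℝ} {C D : ℝ} (hf : ∀ i, |f i| ≤ D * g i)
    (hD : 0 ≤ D) (hC : ∀ s : Finset ι, ∑ i ∈ s, g i ≤ C) :
    Summable f ∧ |∑' i, f i| ≤ D * C := by
  have hs : ∀ s : Finset ι, ∑ i ∈ s, |f i| ≤ D * C := fun s => by
    calc ∑ i ∈ s, |f i| ≤ ∑ i ∈ s, D * g i := Finset.sum_le_sum fun i _ => hf i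
      _ = D * ∑ i ∈ s, g i := by rw [Finset.mul_sum]
      _ ≤ D * C := by gcongr; exact hC s
  have h1 : Summable fun i => |f i| := summable_of_sum_le (fun i => abs_nonneg _) hs
  refine ⟨h1.of_abs, ?_⟩
  calc |∑' i, f i| ≤ ∑' i, |f i| := by
        simpa only [Real.norm_eq_abs] using norm_tsum_le_tsum_norm (f := f) (by simpa using h1)
    _ ≤ D * C := h1.tsum_le_of_sum_le hs

/-- A family of functions with controlled Taylor expansions of rates `a * n i`, weighted with an
exponential moment in `n`, can be summed, and the expansions can be summed termwise. -/
theorem ExpTaylor.tsum {ι E : Type*} [NormedAddCommGroup E] {a κ C : ℝ} (ha : 0 < a) (hκ : 0 < κ)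
    {n : ι → ℕ} {φ : ι → E → ℝ} {ℓ : ι → E → E → ℝ}
    (h : ∀ i, ExpTaylor (a * n i) (φ i) (ℓ i)) {e : E}
    (hC : ∀ s : Finset ι, ∑ i ∈ s, φ i e * Real.exp (κ * n i) ≤ C) {v : E}
    (hv : ‖v‖ ≤ κ / (2 * a)) :
    Summable (fun i => φ i (e + v)) ∧ Summable (fun i => ℓ i e v) ∧
      |∑' i, φ i (e + v) - ∑' i, φ i e - ∑' i, ℓ i e v| ≤ 8 * a ^ 2 / κ ^ 2 * ‖v‖ ^ 2 * C := by
  have hpos : ∀ i, 0 ≤ φ i e * Real.exp (κ * n i) := fun i =>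
    mul_nonneg ((h i).nonneg e) (Real.exp_pos _).le
  have hrate : ∀ i, a * n i * ‖v‖ ≤ κ * n i / 2 := fun i => by
    have : (0 : ℝ) ≤ n i := (n i).cast_nonneg
    calc a * n i * ‖v‖ ≤ a * n i * (κ / (2 * a)) := by gcongr
      _ = _ := by field_simp
  have hn0 : ∀ i, (0 : ℝ) ≤ n i := fun i => (n i).cast_nonneg
  have s0 : Summable fun i => φ i e := (summable_of_moment (D := 1) (fun i => by
    rw [abs_of_nonneg ((h i).nonneg e), one_mul]
    exact le_mul_of_one_le_right ((h i).nonneg e)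
      (Real.one_le_exp (mul_nonneg hκ.le (hn0 i)))) zero_le_one hC).1
  have s1 : Summable fun i => φ i (e + v) := (summable_of_moment (D := 1) (fun i => by
    rw [abs_of_nonneg ((h i).nonneg _), one_mul]
    refine ((h i).le e v).trans (mul_le_mul_of_nonneg_left (Real.exp_le_exp.2 ?_)
      ((h i).nonneg e))
    have := hrate i
    have := mul_nonneg hκ.le (hn0 i)
    linarith) zero_le_one hC).1
  have s2 : Summable fun i => ℓ i e v := (summable_of_moment (D := 1) (fun i => by
    refine ((h i).lin e v).trans ?_
    rw [one_mul, mul_comm]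
    refine mul_le_mul_of_nonneg_left ?_ ((h i).nonneg e)
    have := hrate i
    have := mul_nonneg hκ.le (hn0 i)
    have := Real.add_one_le_exp (κ * n i)
    linarith) zero_le_one hC).1
  refine ⟨s1, s2, ?_⟩
  rw [← s1.tsum_sub s0, ← (s1.sub s0).tsum_sub s2]
  refine (summable_of_moment (D := 8 * a ^ 2 / κ ^ 2 * ‖v‖ ^ 2) (fun i => ?_) (by positivity) hC).2
  refine ((h i).taylor e v).trans ?_
  have hx : 0 ≤ a * n i * ‖v‖ := mul_nonneg (mul_nonneg ha.le (hn0 i)) (norm_nonneg v)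
  have h1 := exp_sub_one_sub_le hx
  have h2 : Real.exp (a * n i * ‖v‖) ≤ Real.exp (κ * n i / 2) := Real.exp_le_exp.2 (hrate i)
  have h3 : (κ * n i / 2) ^ 2 / 2 ≤ Real.exp (κ * n i / 2) := by
    have := Real.pow_div_factorial_le_exp (κ * n i / 2)
      (by have := mul_nonneg hκ.le (hn0 i); linarith) 2
    simpa using this
  have h4 : Real.exp (κ * n i) = Real.exp (κ * n i / 2) * Real.exp (κ * n i / 2) := by
    rw [← Real.exp_add]; ring_nf
  calc φ i e * (Real.exp (a * n i * ‖v‖) - 1 - a * n i * ‖v‖)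
      ≤ φ i e * ((a * n i * ‖v‖) ^ 2 * Real.exp (κ * n i / 2)) := by
        have := (h i).nonneg e
        gcongr
        exact h1.trans (mul_le_mul_of_nonneg_left h2 (sq_nonneg _))
    _ = φ i e * (8 * a ^ 2 / κ ^ 2 * ‖v‖ ^ 2 * ((κ * n i / 2) ^ 2 / 2)
          * Real.exp (κ * n i / 2)) := by
        field_simp; ring
    _ ≤ φ i e * (8 * a ^ 2 / κ ^ 2 * ‖v‖ ^ 2 * Real.exp (κ * n i / 2)
          * Real.exp (κ * n i / 2)) := by
        have := (h i).nonneg e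
        gcongr
    _ = _ := by rw [h4]; ring

/-! ### Families of loops, and the equation that defines the truncated costs -/

/-- What the analysis of the truncated costs needs to know about the loops of a parameterized
Markov chain: the loop `i` has the length `n i`, the probability `p i θ` with the logarithmic
gradient `score i θ`, and the total cost `c i θ` with the gradient `dc i θ`; `risk θ` is the
risk-sensitive cost. Both `p` and the weights `p e^{c - n risk}` are probabilities with a uniform
exponential moment of the length. The numbers `A`, `K`, `κ` and `B` are the constants in these
bounds. -/
structure LoopFamily (Θ ι : Type*) [NormedAddCommGroup Θ] [InnerProductSpace ℝ Θ] where
  n : ι → ℕ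
  p : ι → Θ → ℝ
  c : ι → Θ → ℝ
  score : ι → Θ → Θ
  dc : ι → Θ → Θ
  risk : Θ → ℝ
  A : ℝ
  K : ℝ
  κ : ℝ
  B : ℝ
  n_pos : ∀ i, 0 < n i
  one_le_A : 1 ≤ A
  K_nonneg : 0 ≤ K
  κ_pos : 0 < κ
  p_taylor : ∀ i, ExpTaylor (A * n i) (p i) fun θ v => p i θ * inner ℝ (score i θ) v
  norm_score : ∀ i θ, ‖score i θ‖ ≤ A * n i
  abs_c : ∀ i θ, |c i θ| ≤ K * n i
  c_lip : ∀ i θ v, |c i (θ + v) - c i θ| ≤ A * n i * ‖v‖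
  c_taylor : ∀ i θ v, |c i (θ + v) - c i θ - inner ℝ (dc i θ) v| ≤ A * n i * ‖v‖ ^ 2
  norm_dc : ∀ i θ, ‖dc i θ‖ ≤ A * n i
  hasSum_p : ∀ θ, HasSum (fun i => p i θ) 1
  p_moment : ∀ θ (s : Finset ι), ∑ i ∈ s, p i θ * Real.exp (κ * n i) ≤ B
  abs_risk : ∀ θ, |risk θ| ≤ K
  hasSum_risk : ∀ θ, HasSum (fun i => p i θ * Real.exp (c i θ - n i * risk θ)) 1
  risk_moment : ∀ θ (s : Finset ι),
    ∑ i ∈ s, p i θ * Real.exp (c i θ - n i * risk θ) * Real.exp (κ * n i) ≤ B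

namespace LoopFamily

variable {Θ ι : Type*} [NormedAddCommGroup Θ] [InnerProductSpace ℝ Θ] (𝓛 : LoopFamily Θ ι)

/-- The logarithm of `H(θ,Λ)` on a loop. -/
def logH (i : ι) (θ : Θ) (Λ : ℝ) : ℝ := 𝓛.c i θ - 𝓛.n i * Λ

/-- The expectation of `Γ (ln H(θ,Λ))`. -/
def g (Γ : ℝ → ℝ) (θ : Θ) (Λ : ℝ) : ℝ := ∑' i, 𝓛.p i θ * Γ (𝓛.logH i θ Λ)

/-- The value on a loop of the estimator of the gradient of `𝓛.g Γ` in `θ`. -/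
def est (Γ Γ' : ℝ → ℝ) (i : ι) (θ : Θ) (Λ : ℝ) : Θ :=
  Γ (𝓛.logH i θ Λ) • 𝓛.score i θ + Γ' (𝓛.logH i θ Λ) • 𝓛.dc i θ

/-- The gradient of `𝓛.g Γ` in `θ`. -/
def J (Γ Γ' : ℝ → ℝ) (θ : Θ) (Λ : ℝ) : Θ := ∑' i, 𝓛.p i θ • 𝓛.est Γ Γ' i θ Λ

/-- The negative of the derivative of `𝓛.g Γ` in `Λ`. -/
def slope (Γ' : ℝ → ℝ) (θ : Θ) (Λ : ℝ) : ℝ := ∑' i, 𝓛.p i θ * (𝓛.n i * Γ' (𝓛.logH i θ Λ))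

/-- A bound `C` of the exponential moment of the length of a loop, weighted with `Γ (ln H)`. -/
def Moment (Γ : ℝ → ℝ) (κ C : ℝ) (θ : Θ) (Λ : ℝ) : Prop :=
  ∀ s : Finset ι, ∑ i ∈ s, 𝓛.p i θ * Γ (𝓛.logH i θ Λ) * Real.exp (κ * 𝓛.n i) ≤ C

variable {𝓛} {Γ Γ' : ℝ → ℝ}

theorem p_nonneg (i : ι) (θ : Θ) : 0 ≤ 𝓛.p i θ := (𝓛.p_taylor i).nonneg θ

theorem one_le_n (i : ι) : (1 : ℝ) ≤ 𝓛.n i := by exact_mod_cast 𝓛.n_pos i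

theorem abs_logH_le (i : ι) (θ : Θ) {Λ b : ℝ} (hΛ : |Λ| ≤ b) :
    |𝓛.logH i θ Λ| ≤ (𝓛.K + b) * 𝓛.n i := by
  have h1 := 𝓛.abs_c i θ
  have h2 : (0 : ℝ) ≤ 𝓛.n i := (𝓛.n i).cast_nonneg
  calc |𝓛.c i θ - 𝓛.n i * Λ| ≤ |𝓛.c i θ| + |𝓛.n i * Λ| := abs_sub _ _
    _ ≤ 𝓛.K * 𝓛.n i + 𝓛.n i * b := by rw [abs_mul, abs_of_nonneg h2]; gcongr
    _ = _ := by ring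

theorem logH_anti (i : ι) (θ : Θ) {Λ Λ' : ℝ} (h : Λ ≤ Λ') : 𝓛.logH i θ Λ' ≤ 𝓛.logH i θ Λ := by
  have h2 : (0 : ℝ) ≤ 𝓛.n i := (𝓛.n i).cast_nonneg
  have := mul_le_mul_of_nonneg_left h h2
  simp only [logH]; linarith

/-- The summands of `𝓛.g Γ` have controlled Taylor expansions in `(θ, Λ)`, with rates proportional
to the lengths of the loops. -/
theorem expTaylor_term (hΓ : IsTruncation Γ Γ') (i : ι) :
    ExpTaylor (5 * 𝓛.A * 𝓛.n i) (fun e : Θ × ℝ => 𝓛.p i e.1 * Γ (𝓛.logH i e.1 e.2))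
      (fun e v => 𝓛.p i e.1 * (inner ℝ (𝓛.est Γ Γ' i e.1 e.2) v.1
        - 𝓛.n i * Γ' (𝓛.logH i e.1 e.2) * v.2)) := by
  have hA := 𝓛.one_le_A
  have hn := 𝓛.one_le_n i
  have hAn : 1 ≤ 𝓛.A * 𝓛.n i := one_le_mul_of_one_le_of_one_le hA hn
  have hcomp : ExpTaylor (4 * 𝓛.A * 𝓛.n i) (fun e : Θ × ℝ => Γ (𝓛.logH i e.1 e.2))
      (fun e v => Γ' (𝓛.logH i e.1 e.2) * (inner ℝ (𝓛.dc i e.1) v.1 - 𝓛.n i * v.2)) := by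
    have hlin : ∀ (e v : Θ × ℝ), |inner ℝ (𝓛.dc i e.1) v.1 - 𝓛.n i * v.2|
        ≤ 2 * (𝓛.A * 𝓛.n i * ‖v‖) := fun e v => by
      have h1 : |inner ℝ (𝓛.dc i e.1) v.1| ≤ 𝓛.A * 𝓛.n i * ‖v‖ :=
        (abs_real_inner_le_norm _ _).trans
          (mul_le_mul (𝓛.norm_dc i e.1) (norm_fst_le v) (norm_nonneg _) (by linarith))
      have h2 : |(𝓛.n i : ℝ) * v.2| ≤ 𝓛.A * 𝓛.n i * ‖v‖ := by
        rw [abs_mul, abs_of_nonneg (by linarith)]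
        exact mul_le_mul (by nlinarith) (norm_snd_le v) (abs_nonneg _) (by linarith)
      calc _ ≤ |inner ℝ (𝓛.dc i e.1) v.1| + |(𝓛.n i : ℝ) * v.2| := abs_sub _ _
        _ ≤ _ := by linarith
    refine ⟨by nlinarith, fun e => (hΓ.pos _).le, fun e v => ?_, fun e v => ?_⟩
    · rw [abs_mul, abs_of_pos (hΓ.deriv_pos _), mul_comm]
      have hx : 0 ≤ 𝓛.A * 𝓛.n i * ‖v‖ := mul_nonneg (by linarith) (norm_nonneg v)
      refine mul_le_mul ((hlin e v).trans (by nlinarith)) (hΓ.deriv_le _) (hΓ.deriv_pos _).le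
        (by nlinarith)
    · set x := 𝓛.A * 𝓛.n i * ‖v‖ with hx
      have hx0 : 0 ≤ x := mul_nonneg (by linarith) (norm_nonneg v)
      set s := 𝓛.logH i e.1 e.2
      obtain ⟨δ, hδ⟩ : ∃ δ, 𝓛.logH i (e + v).1 (e + v).2 = s + δ := ⟨_, (add_sub_cancel _ _).symm⟩
      have hδ' : δ = 𝓛.c i (e.1 + v.1) - 𝓛.c i e.1 - 𝓛.n i * v.2 := by
        have : δ = 𝓛.logH i (e + v).1 (e + v).2 - s := by rw [hδ]; ring
        rw [this]
        simp only [s, logH, Prod.fst_add, Prod.snd_add]; ring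
      have h2 : |(𝓛.n i : ℝ) * v.2| ≤ x := by
        rw [abs_mul, abs_of_nonneg (by linarith)]
        exact mul_le_mul (by nlinarith) (norm_snd_le v) (abs_nonneg _) (by linarith)
      have hδx : |δ| ≤ 2 * x := by
        have h1 : |𝓛.c i (e.1 + v.1) - 𝓛.c i e.1| ≤ x := (𝓛.c_lip i e.1 v.1).trans
          (mul_le_mul_of_nonneg_left (norm_fst_le v) (by linarith))
        rw [hδ']
        exact (abs_sub _ _).trans (by linarith)
      have hδl : |δ - (inner ℝ (𝓛.dc i e.1) v.1 - 𝓛.n i * v.2)| ≤ x ^ 2 := by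
        have h1 := 𝓛.c_taylor i e.1 v.1
        have h3 : 𝓛.A * 𝓛.n i * ‖v.1‖ ^ 2 ≤ x ^ 2 := by
          have h4 := norm_fst_le v
          have h5 := norm_nonneg v.1
          calc 𝓛.A * 𝓛.n i * ‖v.1‖ ^ 2 ≤ (𝓛.A * 𝓛.n i) ^ 2 * ‖v.1‖ ^ 2 := by
                gcongr; nlinarith
            _ ≤ (𝓛.A * 𝓛.n i) ^ 2 * ‖v‖ ^ 2 := by gcongr
            _ = x ^ 2 := by rw [hx]; ring
        refine le_trans (le_of_eq ?_) (h1.trans h3)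
        rw [hδ']; ring_nf
      have t1 := hΓ.taylor s δ
      have t2 := exp_sub_one_sub_mono (abs_nonneg δ) hδx
      -- the rate is doubled to absorb the Taylor remainder of the cost of the loop
      have hexp : Real.exp (2 * x) - 1 - 2 * x + x ^ 2 ≤ Real.exp (4 * x) - 1 - 4 * x := by
        have h4 : Real.exp (4 * x) = Real.exp (2 * x) * Real.exp (2 * x) := by
          rw [← Real.exp_add]; ring_nf
        have h5 := Real.add_one_le_exp (2 * x)
        rw [h4]
        nlinarith
      have e1 : Γ (s + δ) - Γ s - Γ' s * (inner ℝ (𝓛.dc i e.1) v.1 - 𝓛.n i * v.2)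
          = (Γ (s + δ) - Γ s - Γ' s * δ)
            + Γ' s * (δ - (inner ℝ (𝓛.dc i e.1) v.1 - 𝓛.n i * v.2)) := by ring
      have e2 : 4 * 𝓛.A * 𝓛.n i * ‖v‖ = 4 * x := by rw [hx]; ring
      rw [hδ, e1, e2]
      have hΓs := (hΓ.pos s).le
      calc _ ≤ |Γ (s + δ) - Γ s - Γ' s * δ|
            + |Γ' s * (δ - (inner ℝ (𝓛.dc i e.1) v.1 - 𝓛.n i * v.2))| := abs_add_le _ _
        _ ≤ Γ s * (Real.exp (2 * x) - 1 - 2 * x) + Γ s * x ^ 2 := by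
            refine add_le_add (t1.trans (mul_le_mul_of_nonneg_left t2 hΓs)) ?_
            rw [abs_mul, abs_of_pos (hΓ.deriv_pos s)]
            exact mul_le_mul (hΓ.deriv_le s) hδl (abs_nonneg _) hΓs
        _ = Γ s * (Real.exp (2 * x) - 1 - 2 * x + x ^ 2) := by ring
        _ ≤ _ := by gcongr
  have := ((𝓛.p_taylor i).comp_fst (F := ℝ)).mul hcomp
  convert this using 1
  · ring
  · funext e v
    simp only [est, inner_add_left, inner_smul_left, conj_trivial]
    ring

section Bounds

variable {κ C : ℝ} {θ : Θ} {Λ : ℝ}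

theorem Moment.summable_g (hΓ : IsTruncation Γ Γ') (hκ : 0 < κ) (h : 𝓛.Moment Γ κ C θ Λ) :
    Summable (fun i => 𝓛.p i θ * Γ (𝓛.logH i θ Λ)) ∧ |𝓛.g Γ θ Λ| ≤ C := by
  have := summable_of_moment (f := fun i => 𝓛.p i θ * Γ (𝓛.logH i θ Λ)) (D := 1) (fun i => by
    have h1 := mul_nonneg (𝓛.p_nonneg i θ) (hΓ.pos (𝓛.logH i θ Λ)).le
    rw [abs_of_nonneg h1, one_mul]
    exact le_mul_of_one_le_right h1
      (Real.one_le_exp (mul_nonneg hκ.le (𝓛.n i).cast_nonneg))) zero_le_one h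
  simpa [g] using this

theorem Moment.summable_slope (hΓ : IsTruncation Γ Γ') (hκ : 0 < κ) (h : 𝓛.Moment Γ κ C θ Λ) :
    Summable (fun i => 𝓛.p i θ * (𝓛.n i * Γ' (𝓛.logH i θ Λ))) ∧ 𝓛.slope Γ' θ Λ ≤ C / κ := by
  have := summable_of_moment (f := fun i => 𝓛.p i θ * (𝓛.n i * Γ' (𝓛.logH i θ Λ)))
    (D := 1 / κ) (fun i => by
    have h0 := 𝓛.p_nonneg i θ
    have h1 := (hΓ.deriv_pos (𝓛.logH i θ Λ)).le
    have h2 := hΓ.deriv_le (𝓛.logH i θ Λ)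
    have h3 := le_exp_div hκ (𝓛.n i)
    have h4 : (0 : ℝ) ≤ 𝓛.n i := (𝓛.n i).cast_nonneg
    rw [abs_of_nonneg (by positivity)]
    calc 𝓛.p i θ * (𝓛.n i * Γ' (𝓛.logH i θ Λ))
        ≤ 𝓛.p i θ * (Real.exp (κ * 𝓛.n i) / κ * Γ (𝓛.logH i θ Λ)) := by gcongr
      _ = _ := by ring) (by positivity) h
  refine ⟨this.1, (le_abs_self _).trans (this.2.trans (le_of_eq (by ring)))⟩

theorem norm_est_le (hΓ : IsTruncation Γ Γ') (i : ι) (θ : Θ) (Λ : ℝ) :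
    ‖𝓛.est Γ Γ' i θ Λ‖ ≤ 2 * 𝓛.A * (𝓛.n i * Γ (𝓛.logH i θ Λ)) := by
  have h1 := hΓ.pos (𝓛.logH i θ Λ)
  have h2 := hΓ.deriv_pos (𝓛.logH i θ Λ)
  have h3 := hΓ.deriv_le (𝓛.logH i θ Λ)
  refine (norm_add_le _ _).trans ?_
  rw [norm_smul, norm_smul, Real.norm_of_nonneg h1.le, Real.norm_of_nonneg h2.le]
  have h4 := 𝓛.norm_score i θ
  have h5 := 𝓛.norm_dc i θ
  have := mul_le_mul h3 h5 (norm_nonneg _) h1.le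
  have := mul_le_mul_of_nonneg_left h4 h1.le
  linarith

theorem Moment.summable_J [CompleteSpace Θ] (hΓ : IsTruncation Γ Γ') (hκ : 0 < κ)
    (h : 𝓛.Moment Γ κ C θ Λ) :
    Summable (fun i => 𝓛.p i θ • 𝓛.est Γ Γ' i θ Λ) ∧ ‖𝓛.J Γ Γ' θ Λ‖ ≤ 2 * 𝓛.A * C / κ := by
  have hA : 0 ≤ 𝓛.A := zero_le_one.trans 𝓛.one_le_A
  have h1 := summable_of_moment (f := fun i => ‖𝓛.p i θ • 𝓛.est Γ Γ' i θ Λ‖)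
    (D := 2 * 𝓛.A / κ) (fun i => by
    have h0 := 𝓛.p_nonneg i θ
    have h1 := (hΓ.pos (𝓛.logH i θ Λ)).le
    have h3 := le_exp_div hκ (𝓛.n i)
    rw [abs_of_nonneg (norm_nonneg _), norm_smul, Real.norm_of_nonneg h0]
    calc 𝓛.p i θ * ‖𝓛.est Γ Γ' i θ Λ‖
        ≤ 𝓛.p i θ * (2 * 𝓛.A * (Real.exp (κ * 𝓛.n i) / κ * Γ (𝓛.logH i θ Λ))) := by
          gcongr
          refine (norm_est_le hΓ i θ Λ).trans ?_
          gcongr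
      _ = _ := by ring) (by positivity) h
  refine ⟨h1.1.of_norm, (norm_tsum_le_tsum_norm h1.1).trans
    ((le_abs_self _).trans (h1.2.trans (le_of_eq (by ring))))⟩

/-- The first-order expansion of `𝓛.g Γ` in both arguments. -/
theorem Moment.taylor [CompleteSpace Θ] (hΓ : IsTruncation Γ Γ') (hκ : 0 < κ)
    (h : 𝓛.Moment Γ κ C θ Λ) {v : Θ} {t d : ℝ} (hv : ‖v‖ ≤ d) (ht : |t| ≤ d)
    (hd : d ≤ κ / (10 * 𝓛.A)) :
    Summable (fun i => 𝓛.p i (θ + v) * Γ (𝓛.logH i (θ + v) (Λ + t))) ∧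
    |𝓛.g Γ (θ + v) (Λ + t) - 𝓛.g Γ θ Λ - (inner ℝ (𝓛.J Γ Γ' θ Λ) v - 𝓛.slope Γ' θ Λ * t)|
      ≤ 200 * 𝓛.A ^ 2 * C / κ ^ 2 * d ^ 2 := by
  have hA : 0 < 𝓛.A := one_pos.trans_le 𝓛.one_le_A
  have hC : 0 ≤ C := by simpa using h ∅
  have hvt : ‖((v, t) : Θ × ℝ)‖ ≤ d := by
    rw [Prod.norm_def]; exact max_le hv ht
  obtain ⟨h1, -, h3⟩ := ExpTaylor.tsum (a := 5 * 𝓛.A) (by positivity) hκ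
    (fun i => 𝓛.expTaylor_term hΓ i) (e := ((θ, Λ) : Θ × ℝ)) h (v := (v, t))
    (by refine hvt.trans (hd.trans (le_of_eq ?_)); ring)
  refine ⟨h1, ?_⟩
  have hJ := (h.summable_J hΓ hκ).1
  have hs := (h.summable_slope hΓ hκ).1
  have hlin : ∑' i, 𝓛.p i θ * (inner ℝ (𝓛.est Γ Γ' i θ Λ) v - 𝓛.n i * Γ' (𝓛.logH i θ Λ) * t)
      = inner ℝ (𝓛.J Γ Γ' θ Λ) v - 𝓛.slope Γ' θ Λ * t := by
    have e1 : HasSum (fun i => inner ℝ (𝓛.p i θ • 𝓛.est Γ Γ' i θ Λ) v)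
        (inner ℝ (𝓛.J Γ Γ' θ Λ) v) := by
      have := (innerSL ℝ v).hasSum hJ.hasSum
      simpa [real_inner_comm, J, inner_smul_right] using! this
    have e2 := hs.hasSum.mul_right t
    refine ((e1.sub e2).congr_fun ?_).tsum_eq
    intro i
    rw [inner_smul_left, conj_trivial]; ring
  simp only [hlin] at h3
  refine h3.trans ?_
  have := norm_nonneg ((v, t) : Θ × ℝ)
  calc 8 * (5 * 𝓛.A) ^ 2 / κ ^ 2 * ‖((v, t) : Θ × ℝ)‖ ^ 2 * C
      ≤ 8 * (5 * 𝓛.A) ^ 2 / κ ^ 2 * d ^ 2 * C := by gcongr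
    _ = _ := by ring

end Bounds

end LoopFamily

namespace LoopFamily

variable {Θ ι : Type*} [NormedAddCommGroup Θ] [InnerProductSpace ℝ Θ] {𝓛 : LoopFamily Θ ι}
  {Γ Γ' : ℝ → ℝ}

theorem B_nonneg [Nonempty Θ] : 0 ≤ 𝓛.B := by
  obtain ⟨θ⟩ := ‹Nonempty Θ›
  simpa using 𝓛.p_moment θ ∅

variable (𝓛) in
/-- A lower bound of the rate at which `𝓛.g Γ θ` decreases at arguments that are at most
`𝓛.K + 1` in absolute value. -/
def minSlope : ℝ := Real.exp (-((2 * 𝓛.K + 1) * (𝓛.B / 𝓛.κ)))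

theorem minSlope_pos : 0 < 𝓛.minSlope := Real.exp_pos _

/-- Jensen's inequality for the length of a loop. -/
theorem minSlope_le (θ : Θ) : Summable (fun i => 𝓛.p i θ * Real.exp (-((2 * 𝓛.K + 1) * 𝓛.n i))) ∧
    𝓛.minSlope ≤ ∑' i, 𝓛.p i θ * Real.exp (-((2 * 𝓛.K + 1) * 𝓛.n i)) := by
  have hK := 𝓛.K_nonneg
  have hs : Summable (fun i => 𝓛.p i θ * Real.exp (-((2 * 𝓛.K + 1) * 𝓛.n i))) :=
    Summable.of_nonneg_of_le (fun i => mul_nonneg (𝓛.p_nonneg i θ) (Real.exp_pos _).le)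
      (fun i => mul_le_of_le_one_right (𝓛.p_nonneg i θ) (Real.exp_le_one_iff.2 (by
        have : (0 : ℝ) ≤ 𝓛.n i := (𝓛.n i).cast_nonneg
        have : 0 ≤ (2 * 𝓛.K + 1) * 𝓛.n i := by positivity
        linarith))) (𝓛.hasSum_p θ).summable
  refine ⟨hs, ?_⟩
  set L := 2 * 𝓛.K + 1 with hL
  have hL0 : 0 ≤ L := by linarith
  set m := 𝓛.B / 𝓛.κ with hm
  have hn := summable_of_moment (f := fun i => 𝓛.p i θ * 𝓛.n i) (D := 1 / 𝓛.κ) (fun i => by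
    have h0 := 𝓛.p_nonneg i θ
    have h3 := le_exp_div 𝓛.κ_pos (𝓛.n i)
    rw [abs_of_nonneg (mul_nonneg h0 (𝓛.n i).cast_nonneg)]
    calc 𝓛.p i θ * (𝓛.n i : ℝ) ≤ 𝓛.p i θ * (Real.exp (𝓛.κ * 𝓛.n i) / 𝓛.κ) := by gcongr
      _ = _ := by ring) (by have := 𝓛.κ_pos; positivity) (𝓛.p_moment θ)
  have hmean : ∑' i, 𝓛.p i θ * (𝓛.n i : ℝ) ≤ m :=
    (le_abs_self _).trans (hn.2.trans (le_of_eq (by rw [hm]; ring)))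
  have h1 : HasSum (fun i => Real.exp (-(L * m)) * (𝓛.p i θ * (1 + L * m) - L * (𝓛.p i θ * 𝓛.n i)))
      (Real.exp (-(L * m)) * (1 * (1 + L * m) - L * ∑' i, 𝓛.p i θ * (𝓛.n i : ℝ))) :=
    (((𝓛.hasSum_p θ).mul_right _).sub (hn.1.hasSum.mul_left L)).mul_left _
  have h2 : Real.exp (-(L * m)) ≤
      Real.exp (-(L * m)) * (1 * (1 + L * m) - L * ∑' i, 𝓛.p i θ * (𝓛.n i : ℝ)) := by
    refine le_mul_of_one_le_right (Real.exp_pos _).le ?_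
    have := mul_le_mul_of_nonneg_left hmean hL0
    linarith
  refine h2.trans (hasSum_le (fun i => ?_) h1 hs.hasSum)
  have h3 := Real.add_one_le_exp (L * m - L * 𝓛.n i)
  have h4 : Real.exp (-(L * 𝓛.n i)) = Real.exp (-(L * m)) * Real.exp (L * m - L * 𝓛.n i) := by
    rw [← Real.exp_add]; ring_nf
  rw [h4]
  have h0 := 𝓛.p_nonneg i θ
  calc Real.exp (-(L * m)) * (𝓛.p i θ * (1 + L * m) - L * (𝓛.p i θ * 𝓛.n i))
      = 𝓛.p i θ * (Real.exp (-(L * m)) * (L * m - L * 𝓛.n i + 1)) := by ring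
    _ ≤ _ := by gcongr

/-- The derivative of the truncation is bounded below on loops. -/
theorem exp_le_deriv (hΓ : IsTruncation Γ Γ') (i : ι) (θ : Θ) {Λ : ℝ} (hΛ : |Λ| ≤ 𝓛.K + 1) :
    Real.exp (-((2 * 𝓛.K + 1) * 𝓛.n i)) ≤ Γ' (𝓛.logH i θ Λ) := by
  have hK := 𝓛.K_nonneg
  refine le_trans (le_min (Real.exp_le_exp.2 ?_) (Real.exp_le_one_iff.2 ?_)) (hΓ.min_le_deriv _)
  · have := (abs_le.1 (𝓛.abs_logH_le i θ hΛ)).1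
    linarith
  · have : (0 : ℝ) ≤ 𝓛.n i := (𝓛.n i).cast_nonneg
    have : 0 ≤ (2 * 𝓛.K + 1) * 𝓛.n i := by positivity
    linarith

theorem minSlope_le_slope (hΓ : IsTruncation Γ Γ') {κ C : ℝ} (hκ : 0 < κ) {θ : Θ} {Λ : ℝ}
    (hΛ : |Λ| ≤ 𝓛.K + 1) (h : 𝓛.Moment Γ κ C θ Λ) : 𝓛.minSlope ≤ 𝓛.slope Γ' θ Λ := by
  refine (minSlope_le θ).2.trans ((minSlope_le θ).1.tsum_le_tsum (fun i => ?_)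
    (h.summable_slope hΓ hκ).1)
  have h1 := exp_le_deriv hΓ i θ hΛ
  have h2 := 𝓛.one_le_n i
  have h3 := (hΓ.deriv_pos (𝓛.logH i θ Λ)).le
  exact mul_le_mul_of_nonneg_left (h1.trans (le_mul_of_one_le_left h3 h2)) (𝓛.p_nonneg i θ)

theorem logH_add (i : ι) (θ : Θ) (Λ z : ℝ) : 𝓛.logH i θ (Λ + z) = 𝓛.logH i θ Λ - 𝓛.n i * z := by
  simp only [logH]; ring

/-- Decrease of `𝓛.g Γ θ` by at least `minSlope * z` on an interval of length `z`. -/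
theorem g_add_le (hΓ : IsTruncation Γ Γ') {θ : Θ} {Λ z : ℝ} (hz : 0 ≤ z)
    (hΛz : |Λ + z| ≤ 𝓛.K + 1) (h : Summable fun i => 𝓛.p i θ * Γ (𝓛.logH i θ Λ)) :
    𝓛.g Γ θ (Λ + z) + 𝓛.minSlope * z ≤ 𝓛.g Γ θ Λ := by
  have h' : Summable fun i => 𝓛.p i θ * Γ (𝓛.logH i θ (Λ + z)) :=
    Summable.of_nonneg_of_le (fun i => mul_nonneg (𝓛.p_nonneg i θ) (hΓ.pos _).le)
      (fun i => mul_le_mul_of_nonneg_left (hΓ.mono (logH_anti i θ (by linarith)))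
        (𝓛.p_nonneg i θ)) h
  obtain ⟨hs, hle⟩ := 𝓛.minSlope_le θ
  have hs' := hs.hasSum.mul_right z
  calc 𝓛.g Γ θ (Λ + z) + 𝓛.minSlope * z
      ≤ 𝓛.g Γ θ (Λ + z) + (∑' i, 𝓛.p i θ * Real.exp (-((2 * 𝓛.K + 1) * 𝓛.n i))) * z := by gcongr
    _ ≤ _ := hasSum_le (fun i => ?_) (h'.hasSum.add hs') h.hasSum
  have h1 := exp_le_deriv hΓ i θ hΛz
  have h2 := hΓ.tangent_le (𝓛.logH i θ (Λ + z)) (𝓛.n i * z)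
  rw [show 𝓛.logH i θ (Λ + z) + 𝓛.n i * z = 𝓛.logH i θ Λ by rw [logH_add]; ring] at h2
  have h3 : z ≤ 𝓛.n i * z := le_mul_of_one_le_left hz (𝓛.one_le_n i)
  have h4 := mul_le_mul h1 h3 hz (hΓ.deriv_pos _).le
  have h5 := mul_le_mul_of_nonneg_left (add_le_add_right h4 (Γ (𝓛.logH i θ (Λ + z))) |>.trans h2)
    (𝓛.p_nonneg i θ)
  linarith

/-- Above the root, `𝓛.g Γ θ` falls below `1` linearly, up to distance one. -/
theorem g_above (hΓ : IsTruncation Γ Γ') {θ : Θ} {h : ℝ} (hh : |h| ≤ 𝓛.K)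
    (hs : Summable fun i => 𝓛.p i θ * Γ (𝓛.logH i θ h)) (h1 : 𝓛.g Γ θ h = 1) {z : ℝ} (hz : 0 ≤ z) :
    𝓛.g Γ θ (h + z) ≤ 1 - 𝓛.minSlope * min z 1 := by
  have hm : 0 ≤ min z 1 := le_min hz zero_le_one
  have hb : |h + min z 1| ≤ 𝓛.K + 1 :=
    (abs_add_le _ _).trans (add_le_add hh (by rw [abs_of_nonneg hm]; exact min_le_right _ _))
  have h' : ∀ {y}, 0 ≤ y → Summable fun i => 𝓛.p i θ * Γ (𝓛.logH i θ (h + y)) := fun hy =>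
    Summable.of_nonneg_of_le (fun i => mul_nonneg (𝓛.p_nonneg i θ) (hΓ.pos _).le)
      (fun i => mul_le_mul_of_nonneg_left (hΓ.mono (logH_anti i θ (by linarith)))
        (𝓛.p_nonneg i θ)) hs
  have h2 := g_add_le hΓ hm hb hs
  have h3 : 𝓛.g Γ θ (h + z) ≤ 𝓛.g Γ θ (h + min z 1) :=
    (h' hz).tsum_le_tsum (fun i => mul_le_mul_of_nonneg_left
      (hΓ.mono (logH_anti i θ (by linarith [min_le_left z 1]))) (𝓛.p_nonneg i θ)) (h' hm)
  linarith

/-- Below the root, `𝓛.g Γ θ` rises linearly, by convexity at any distance. -/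
theorem g_below (hΓ : IsTruncation Γ Γ') {θ : Θ} {h : ℝ} (hh : |h| ≤ 𝓛.K) (h1 : 𝓛.g Γ θ h = 1)
    {z : ℝ} (hz : 0 ≤ z) (hs : Summable fun i => 𝓛.p i θ * Γ (𝓛.logH i θ (h - z))) :
    1 + 𝓛.minSlope * z ≤ 𝓛.g Γ θ (h - z) := by
  have hb : |h - z + z| ≤ 𝓛.K + 1 := by rw [sub_add_cancel]; linarith
  have := g_add_le hΓ hz hb hs
  rw [sub_add_cancel, h1] at this
  exact this

end LoopFamily

/-! ### Truncated costs as implicit functions -/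

/-- Regularity of the solution `h θ` of the equation `g θ Λ = 1` with gradient `dh`: a global
second-order bound of the Taylor remainder of `h`, and the relation of `dh` to the gradient `J` of
`g` in `θ` near the solution. -/
structure LevelCore {Θ : Type*} [NormedAddCommGroup Θ] [InnerProductSpace ℝ Θ] (K C c ε : ℝ)
    (g : Θ → ℝ → ℝ) (J : Θ → ℝ → Θ) (h : Θ → ℝ) (dh : Θ → Θ) : Prop where
  abs_le : ∀ θ, |h θ| ≤ K
  taylor : ∀ θ v, |h (θ + v) - h θ - inner ℝ (dh θ) v| ≤ C * ‖v‖ ^ 2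
  norm_dh : ∀ θ, ‖dh θ‖ ≤ C
  norm_J : ∀ θ Λ, h θ - ε ≤ Λ → ‖J θ Λ‖ ≤ C
  abs_g : ∀ θ Λ, h θ - ε ≤ Λ → |g θ Λ| ≤ C
  g_above : ∀ θ z, 0 ≤ z → g θ (h θ + z) ≤ 1 - c * min z 1
  J_near : ∀ θ, ∃ a, c ≤ a ∧ a ≤ C ∧ ∀ Λ, |Λ - h θ| ≤ ε → ‖J θ Λ - a • dh θ‖ ≤ C * |Λ - h θ|

theorem norm_le_of_inner_le {Θ : Type*} [NormedAddCommGroup Θ] [InnerProductSpace ℝ Θ] {w : Θ}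
    {r b : ℝ} (hr : 0 < r) (hb : 0 ≤ b) (h : ∀ v : Θ, ‖v‖ = r → inner ℝ w v ≤ b * r) :
    ‖w‖ ≤ b := by
  rcases eq_or_ne w 0 with rfl | hw
  · simpa using hb
  · have hw' : 0 < ‖w‖ := norm_pos_iff.2 hw
    have h1 := h ((r / ‖w‖) • w) (by
      rw [norm_smul, Real.norm_of_nonneg (by positivity)]
      field_simp)
    rw [inner_smul_right, real_inner_self_eq_norm_sq] at h1
    have : r / ‖w‖ * ‖w‖ ^ 2 = r * ‖w‖ := by field_simp
    rw [this] at h1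
    nlinarith

namespace LoopFamily

variable {Θ ι : Type*} [NormedAddCommGroup Θ] [InnerProductSpace ℝ Θ] [CompleteSpace Θ]
  {𝓛 : LoopFamily Θ ι} {Γ Γ' : ℝ → ℝ}

variable (𝓛) in
/-- The gradient of the solution `h` of `𝓛.g Γ θ (h θ) = 1`. -/
def gradRoot (Γ Γ' : ℝ → ℝ) (h : Θ → ℝ) (θ : Θ) : Θ :=
  (𝓛.slope Γ' θ (h θ))⁻¹ • 𝓛.J Γ Γ' θ (h θ)

/-- The gradient of `𝓛.g Γ` in `θ` is Lipschitz in `Λ`: compare the expansions of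
`𝓛.g Γ (θ + v) Λ` at `(θ, Λ)` and at `(θ, Λ₀)`. -/
theorem Moment.norm_J_sub_le (hΓ : IsTruncation Γ Γ') {κ C : ℝ} (hκ : 0 < κ) {θ : Θ} {Λ₀ Λ : ℝ}
    (h₀ : 𝓛.Moment Γ κ C θ Λ₀) (h : 𝓛.Moment Γ κ C θ Λ) (hr : |Λ - Λ₀| ≤ κ / (10 * 𝓛.A)) :
    ‖𝓛.J Γ Γ' θ Λ - 𝓛.J Γ Γ' θ Λ₀‖ ≤ 3 * (200 * 𝓛.A ^ 2 * C / κ ^ 2) * |Λ - Λ₀| := by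
  have hC : 0 ≤ C := by simpa using h ∅
  obtain ⟨z, rfl⟩ : ∃ z, Λ = Λ₀ + z := ⟨Λ - Λ₀, by ring⟩
  rw [add_sub_cancel_left] at hr ⊢
  rcases eq_or_ne z 0 with rfl | hz0
  · simp
  have hzp : 0 < |z| := abs_pos.2 hz0
  refine norm_le_of_inner_le hzp (by positivity) fun v hv => ?_
  have t1 := (h.taylor hΓ hκ (v := v) (t := 0) (d := |z|) hv.le (by simp) hr).2
  have t2 := (h₀.taylor hΓ hκ (v := v) (t := z) (d := |z|) hv.le le_rfl hr).2
  have t3 := (h₀.taylor hΓ hκ (v := 0) (t := z) (d := |z|) (by simp) le_rfl hr).2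
  rw [add_zero, mul_zero, sub_zero] at t1
  rw [add_zero, inner_zero_right] at t3
  have e1 := (abs_le.1 t1).1
  have e2 := (abs_le.1 t2).2
  have e3 := (abs_le.1 t3).1
  rw [inner_sub_left]
  have e4 : ∀ x : ℝ, 3 * x * |z| * |z| = x * |z| ^ 2 + x * |z| ^ 2 + x * |z| ^ 2 := fun x => by ring
  rw [e4]
  linarith

set_option maxHeartbeats 1000000 in
/-- A quantitative implicit function theorem for `𝓛.g Γ θ Λ = 1`, with constants that depend on
`Γ` only through the exponential moment. -/
theorem exists_levelCore {κ ε C : ℝ} (hκ : 0 < κ) (hε : 0 < ε) :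
    ∃ C' ε', 0 < ε' ∧ ε' ≤ ε ∧ ∀ Γ Γ' : ℝ → ℝ, IsTruncation Γ Γ' → ∀ h : Θ → ℝ,
      (∀ θ, |h θ| ≤ 𝓛.K) → (∀ θ, 𝓛.g Γ θ (h θ) = 1) →
      (∀ θ Λ, h θ - ε ≤ Λ → 𝓛.Moment Γ κ C θ Λ) →
      LevelCore 𝓛.K C' 𝓛.minSlope ε' (𝓛.g Γ) (𝓛.J Γ Γ') h (𝓛.gradRoot Γ Γ' h) := by
  have hA : 0 < 𝓛.A := one_pos.trans_le 𝓛.one_le_A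
  have hK := 𝓛.K_nonneg
  have hc := 𝓛.minSlope_pos
  set c := 𝓛.minSlope
  -- the constants are named after the estimates in which they first appear
  obtain ⟨C₀, hC₀, hC₀'⟩ : ∃ C₀, 0 ≤ C₀ ∧ C ≤ C₀ := ⟨max C 0, le_max_right _ _, le_max_left _ _⟩
  set r := κ / (10 * 𝓛.A) with hr
  have hr0 : 0 < r := by positivity
  set CJ := 2 * 𝓛.A * C₀ / κ with hCJ
  have hCJ0 : 0 ≤ CJ := by positivity
  set C₂ := 200 * 𝓛.A ^ 2 * C₀ / κ ^ 2 with hC₂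
  have hC₂0 : 0 ≤ C₂ := by positivity
  set L₀ := CJ + C₂ * r with hL₀
  have hL₀0 : 0 ≤ L₀ := by positivity
  set L₁ := 1 + L₀ / c with hL₁
  have hL₁1 : 1 ≤ L₁ := by rw [hL₁]; linarith [show 0 ≤ L₀ / c by positivity]
  set r₁ := min (r / L₁) (c / (2 * (L₀ + 1))) with hr₁
  have hr₁0 : 0 < r₁ := lt_min (by positivity) (by positivity)
  set D := C₂ * L₁ ^ 2 / c + (2 * 𝓛.K / r₁ ^ 2 + CJ / c / r₁) with hD
  set ε' := min ε r with hε'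
  refine ⟨C₀ + CJ + CJ / c + D + C₀ / κ + 3 * C₂, ε', lt_min hε hr0, min_le_left _ _, ?_⟩
  intro Γ Γ' hΓ h hhK hroot hmom'
  have hmom : ∀ θ Λ, h θ - ε ≤ Λ → 𝓛.Moment Γ κ C₀ θ Λ := fun θ Λ hΛ s =>
    (hmom' θ Λ hΛ s).trans hC₀'
  have hmomh : ∀ θ, 𝓛.Moment Γ κ C₀ θ (h θ) := fun θ => hmom θ _ (by linarith)
  have hslope : ∀ θ, c ≤ 𝓛.slope Γ' θ (h θ) := fun θ =>
    minSlope_le_slope hΓ hκ ((hhK θ).trans (by linarith)) (hmomh θ)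
  have hJ : ∀ θ, ‖𝓛.J Γ Γ' θ (h θ)‖ ≤ CJ := fun θ => ((hmomh θ).summable_J hΓ hκ).2
  have hdh : ∀ θ, ‖𝓛.gradRoot Γ Γ' h θ‖ ≤ CJ / c := fun θ => by
    have h0 := hslope θ
    rw [gradRoot, norm_smul, norm_inv, Real.norm_of_nonneg (hc.le.trans h0), inv_mul_eq_div]
    exact div_le_div₀ hCJ0 (hJ θ) hc h0
  have hC₀κ : 0 ≤ C₀ / κ := by positivity
  have hDnn : 0 ≤ D := by positivity
  have hCJc : 0 ≤ CJ / c := by positivity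
  have habove : ∀ θ z, 0 ≤ z → 𝓛.g Γ θ (h θ + z) ≤ 1 - c * min z 1 := fun θ z hz =>
    g_above hΓ (hhK θ) ((hmomh θ).summable_g hΓ hκ).1 (hroot θ) hz
  -- `𝓛.g Γ (θ + v) (h θ)` differs from `1` by at most `L₀ ‖v‖`, which has to be compensated by a
  -- change of `Λ` at a rate of at least `c`
  have hlip : ∀ θ v, ‖v‖ ≤ r₁ → |h (θ + v) - h θ| ≤ L₁ * ‖v‖ := by
    intro θ v hv
    have hvr : ‖v‖ ≤ r := hv.trans ((min_le_left _ _).trans (div_le_self hr0.le hL₁1))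
    obtain ⟨hs, ht⟩ := (hmomh θ).taylor (Γ := Γ) (Γ' := Γ') hΓ hκ (v := v) (t := 0) le_rfl
      (by simp) hvr
    rw [add_zero] at hs
    rw [add_zero, hroot, mul_zero, sub_zero] at ht
    have hin : |inner ℝ (𝓛.J Γ Γ' θ (h θ)) v| ≤ CJ * ‖v‖ :=
      (abs_real_inner_le_norm _ _).trans (mul_le_mul_of_nonneg_right (hJ θ) (norm_nonneg v))
    have hg : |𝓛.g Γ (θ + v) (h θ) - 1| ≤ L₀ * ‖v‖ := by
      have e : 𝓛.g Γ (θ + v) (h θ) - 1 = (𝓛.g Γ (θ + v) (h θ) - 1 - inner ℝ (𝓛.J Γ Γ' θ (h θ)) v)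
          + inner ℝ (𝓛.J Γ Γ' θ (h θ)) v := by ring
      rw [e]
      refine (abs_add_le _ _).trans ((add_le_add ht hin).trans ?_)
      have : C₂ * ‖v‖ ^ 2 ≤ C₂ * r * ‖v‖ := by
        rw [sq, mul_assoc]
        exact mul_le_mul_of_nonneg_left (mul_le_mul_of_nonneg_right hvr (norm_nonneg v)) hC₂0
      rw [hL₀]
      linarith
    have hL₁' : L₀ * ‖v‖ / c ≤ L₁ * ‖v‖ := by
      rw [hL₁]
      have : L₀ * ‖v‖ / c = L₀ / c * ‖v‖ := by ring
      rw [this]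
      nlinarith [norm_nonneg v]
    refine le_trans ?_ hL₁'
    rw [le_div_iff₀ hc]
    rcases le_total (h (θ + v)) (h θ) with hle | hle
    · have h2 := habove (θ + v) (h θ - h (θ + v)) (by linarith)
      rw [add_sub_cancel] at h2
      have h3 : c * min (h θ - h (θ + v)) 1 ≤ L₀ * ‖v‖ := by
        linarith [(abs_le.1 hg).1]
      have h4 : L₀ * ‖v‖ < c := by
        have h5 : ‖v‖ ≤ c / (2 * (L₀ + 1)) := hv.trans (min_le_right _ _)
        rw [le_div_iff₀ (by positivity)] at h5
        nlinarith [norm_nonneg v]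
      have h6 : h θ - h (θ + v) ≤ 1 := by
        by_contra hcon
        rw [min_eq_right (not_le.1 hcon).le, mul_one] at h3
        linarith
      rw [min_eq_left h6] at h3
      rw [abs_sub_comm, abs_of_nonneg (by linarith)]
      linarith
    · have h2 := g_below hΓ (hhK (θ + v)) (hroot (θ + v)) (z := h (θ + v) - h θ) (by linarith)
        (by simpa using hs)
      rw [sub_sub_cancel] at h2
      rw [abs_of_nonneg (by linarith)]
      linarith [(abs_le.1 hg).2]
  refine ⟨hhK, fun θ v => ?_, fun θ => (hdh θ).trans (by linarith), fun θ Λ hΛ => ?_,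
    fun θ Λ hΛ => ?_, habove, fun θ => ?_⟩
  · have hlarge : D ≤ C₀ + CJ + CJ / c + D + C₀ / κ + 3 * C₂ := by linarith
    refine le_trans ?_ (mul_le_mul_of_nonneg_right hlarge (sq_nonneg _))
    -- near `θ`, expand the equation `g = 1`; farther away the boundedness of `h` is enough
    rcases le_or_gt ‖v‖ r₁ with hv | hv
    · have hvr : L₁ * ‖v‖ ≤ r := by
        have h5 : ‖v‖ ≤ r / L₁ := hv.trans (min_le_left _ _)
        rw [le_div_iff₀ (by linarith)] at h5
        linarith
      obtain ⟨-, ht⟩ := (hmomh θ).taylor (Γ := Γ) (Γ' := Γ') hΓ hκ (v := v)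
        (t := h (θ + v) - h θ) (d := L₁ * ‖v‖)
        (le_mul_of_one_le_left (norm_nonneg v) hL₁1) (hlip θ v hv) hvr
      rw [add_sub_cancel, hroot, hroot, sub_self, zero_sub, abs_neg] at ht
      set a := 𝓛.slope Γ' θ (h θ) with ha
      have ha0 : 0 < a := hc.trans_le (hslope θ)
      have e : h (θ + v) - h θ - inner ℝ (𝓛.gradRoot Γ Γ' h θ) v
          = -(inner ℝ (𝓛.J Γ Γ' θ (h θ)) v - a * (h (θ + v) - h θ)) / a := by
        rw [gradRoot, inner_smul_left, conj_trivial, ← ha]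
        field_simp
        ring
      rw [e, abs_div, abs_neg, abs_of_pos ha0, div_le_iff₀ ha0]
      refine ht.trans ?_
      have h6 : C₂ * L₁ ^ 2 / c * c ≤ D * a := by
        refine mul_le_mul ?_ (hslope θ) hc.le hDnn
        rw [hD]
        have : 0 ≤ 2 * 𝓛.K / r₁ ^ 2 + CJ / c / r₁ := by positivity
        linarith
      rw [div_mul_cancel₀ _ hc.ne'] at h6
      have h7 := mul_le_mul_of_nonneg_right h6 (sq_nonneg ‖v‖)
      calc C₂ * (L₁ * ‖v‖) ^ 2 = C₂ * L₁ ^ 2 * ‖v‖ ^ 2 := by ring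
        _ ≤ _ := h7.trans (le_of_eq (by ring))
    · have h1 : |h (θ + v) - h θ| ≤ 2 * 𝓛.K :=
        (abs_sub _ _).trans (by linarith [hhK θ, hhK (θ + v)])
      have h2 : |inner ℝ (𝓛.gradRoot Γ Γ' h θ) v| ≤ CJ / c * ‖v‖ :=
        (abs_real_inner_le_norm _ _).trans (mul_le_mul_of_nonneg_right (hdh θ) (norm_nonneg v))
      have h3 : 2 * 𝓛.K ≤ 2 * 𝓛.K / r₁ ^ 2 * ‖v‖ ^ 2 := by
        rw [div_mul_eq_mul_div, le_div_iff₀ (by positivity)]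
        gcongr
      have h4 : CJ / c * ‖v‖ ≤ CJ / c / r₁ * ‖v‖ ^ 2 := by
        rw [div_mul_eq_mul_div (CJ / c) r₁, le_div_iff₀ hr₁0, sq, ← mul_assoc]
        gcongr
      have h5 : 0 ≤ C₂ * L₁ ^ 2 / c * ‖v‖ ^ 2 := by positivity
      calc _ ≤ |h (θ + v) - h θ| + |inner ℝ (𝓛.gradRoot Γ Γ' h θ) v| := abs_sub _ _
        _ ≤ D * ‖v‖ ^ 2 := by rw [hD, add_mul, add_mul]; linarith
  · exact (((hmom θ Λ (by linarith [min_le_left ε r])).summable_J hΓ hκ).2).trans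
      (by linarith)
  · exact (((hmom θ Λ (by linarith [min_le_left ε r])).summable_g hΓ hκ).2).trans
      (by linarith)
  -- at the solution, `J` is the gradient of `h` times the slope
  · refine ⟨𝓛.slope Γ' θ (h θ), hslope θ,
      ((hmomh θ).summable_slope hΓ hκ).2.trans (by linarith), fun Λ hΛ => ?_⟩
    have ha0 : 0 < 𝓛.slope Γ' θ (h θ) := hc.trans_le (hslope θ)
    have e : 𝓛.slope Γ' θ (h θ) • 𝓛.gradRoot Γ Γ' h θ = 𝓛.J Γ Γ' θ (h θ) := by
      rw [gradRoot, smul_smul, mul_inv_cancel₀ ha0.ne', one_smul]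
    rw [e]
    have hzr : |Λ - h θ| ≤ r := hΛ.trans (min_le_right _ _)
    refine ((hmomh θ).norm_J_sub_le hΓ hκ (hmom θ Λ ?_) hzr).trans
      (mul_le_mul_of_nonneg_right ?_ (abs_nonneg _))
    · linarith [(abs_le.1 hΛ).1, min_le_left ε r]
    · have : 3 * (200 * 𝓛.A ^ 2 * C₀ / κ ^ 2) = 3 * C₂ := rfl
      linarith

end LoopFamily

theorem IsTruncation.le_mul_exp {Γ Γ' : ℝ → ℝ} (hΓ : IsTruncation Γ Γ') (s δ : ℝ) :
    Γ (s + δ) ≤ Γ s * Real.exp |δ| := by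
  have h1 := (abs_le.1 (hΓ.taylor s δ)).2
  have h2 : Γ' s * δ ≤ Γ s * |δ| :=
    (mul_le_mul_of_nonneg_left (le_abs_self δ) (hΓ.deriv_pos s).le).trans
      (mul_le_mul_of_nonneg_right (hΓ.deriv_le s) (abs_nonneg δ))
  nlinarith

/-- Truncations at higher levels are larger: raising the level means shifting the argument to the
left and multiplying by the exponential of the shift, and a truncation grows at most as fast as
`exp`. -/
theorem truncExp_mono {M M' : ℝ} (hM : 1 < M) (hMM' : M ≤ M') (s : ℝ) :
    truncExp M s ≤ truncExp M' s := by
  have hM0 : 0 < M := one_pos.trans hM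
  have hM'0 : 0 < M' := hM0.trans_le hMM'
  have hd : 0 ≤ Real.log M' - Real.log M := sub_nonneg.2 (Real.log_le_log hM0 hMM')
  have h := (isTruncation_truncExp hM).le_mul_exp (s - (Real.log M' - Real.log M))
    (Real.log M' - Real.log M)
  rw [sub_add_cancel, abs_of_nonneg hd, Real.exp_sub, Real.exp_log hM0, Real.exp_log hM'0] at h
  refine h.trans (le_of_eq ?_)
  have e : s - (Real.log M' - Real.log M) - Real.log M = s - Real.log M' := by ring
  simp only [truncExp, e]
  field_simp

/-- Polynomials are dominated by exponentials, in the form used for powers of loop lengths. -/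
theorem pow_le_exp {κ x : ℝ} (hκ : 0 < κ) (hx : 0 ≤ x) (k : ℕ) :
    x ^ k ≤ k.factorial / κ ^ k * Real.exp (κ * x) := by
  have := Real.pow_div_factorial_le_exp (κ * x) (mul_nonneg hκ.le hx) k
  rw [div_le_iff₀ (by positivity)] at this
  rw [div_mul_eq_mul_div, le_div_iff₀ (by positivity), ← mul_pow, mul_comm x κ]
  linarith

namespace LoopFamily

variable {Θ ι : Type*} [NormedAddCommGroup Θ] [InnerProductSpace ℝ Θ] {𝓛 : LoopFamily Θ ι}

theorem truncExp_logH_le {M b : ℝ} (hM : 1 < M) (hb : 0 ≤ b) (i : ι) (θ : Θ) {Λ : ℝ}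
    (hΛ : -b ≤ Λ) :
    truncExp M (𝓛.logH i θ Λ) ≤ M * ((1 + 𝓛.K + b) * 𝓛.n i) ^ 4 := by
  have hM0 : 0 < M := one_pos.trans hM
  have hK := 𝓛.K_nonneg
  have hn := 𝓛.one_le_n i
  refine (truncExp_le hM _).trans ?_
  gcongr
  have h1 : 𝓛.logH i θ Λ ≤ (𝓛.K + b) * 𝓛.n i :=
    (logH_anti i θ hΛ).trans ((le_abs_self _).trans
      (𝓛.abs_logH_le i θ (by rw [abs_neg, abs_of_nonneg hb])))
  have h2 : max (𝓛.logH i θ Λ) 0 ≤ (𝓛.K + b) * 𝓛.n i := max_le h1 (by positivity)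
  nlinarith

theorem moment_truncExp {M b : ℝ} (hM : 1 < M) (hb : 0 ≤ b) (θ : Θ) {Λ : ℝ} (hΛ : -b ≤ Λ) :
    𝓛.Moment (truncExp M) (𝓛.κ / 2)
      (M * ((1 + 𝓛.K + b) ^ 4 * (Nat.factorial 4 / (𝓛.κ / 2) ^ 4)) * 𝓛.B) θ Λ := by
  intro s
  have hκ := 𝓛.κ_pos
  have hK := 𝓛.K_nonneg
  have hM0 : 0 < M := one_pos.trans hM
  refine le_trans ?_ (mul_le_mul_of_nonneg_left (𝓛.p_moment θ s) (by positivity))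
  rw [Finset.mul_sum]
  refine Finset.sum_le_sum fun i _ => ?_
  have h0 := 𝓛.p_nonneg i θ
  have h1 := 𝓛.truncExp_logH_le hM hb i θ hΛ
  have h2 := pow_le_exp (half_pos hκ) (𝓛.n i).cast_nonneg 4
  have h3 : Real.exp (𝓛.κ * 𝓛.n i) = Real.exp (𝓛.κ / 2 * 𝓛.n i) * Real.exp (𝓛.κ / 2 * 𝓛.n i) := by
    rw [← Real.exp_add]; ring_nf
  calc 𝓛.p i θ * truncExp M (𝓛.logH i θ Λ) * Real.exp (𝓛.κ / 2 * 𝓛.n i)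
      ≤ 𝓛.p i θ * (M * ((1 + 𝓛.K + b) * 𝓛.n i) ^ 4) * Real.exp (𝓛.κ / 2 * 𝓛.n i) := by gcongr
    _ = M * (1 + 𝓛.K + b) ^ 4 * 𝓛.p i θ * (𝓛.n i : ℝ) ^ 4 * Real.exp (𝓛.κ / 2 * 𝓛.n i) := by ring
    _ ≤ M * (1 + 𝓛.K + b) ^ 4 * 𝓛.p i θ * (Nat.factorial 4 / (𝓛.κ / 2) ^ 4
          * Real.exp (𝓛.κ / 2 * 𝓛.n i)) * Real.exp (𝓛.κ / 2 * 𝓛.n i) := by gcongr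
    _ = _ := by rw [h3]; ring

/-- The second moments of the truncated functional are of the order of the square of the
truncation level, where `Λ` is bounded below. -/
theorem sum_sq_truncExp_le {b : ℝ} (hb : 0 ≤ b) : ∃ C, 0 ≤ C ∧ ∀ M, 1 < M → ∀ (θ : Θ) (Λ : ℝ),
    -b ≤ Λ → ∀ s : Finset ι,
      ∑ i ∈ s, 𝓛.p i θ * (𝓛.n i * truncExp M (𝓛.logH i θ Λ)) ^ 2 ≤ C * M ^ 2 := by
  have hκ := 𝓛.κ_pos
  have hK := 𝓛.K_nonneg
  rcases isEmpty_or_nonempty Θ with hΘ | hΘ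
  · exact ⟨0, le_rfl, fun M _ θ => (hΘ.false θ).elim⟩
  have hB := 𝓛.B_nonneg
  refine ⟨(1 + 𝓛.K + b) ^ 8 * (Nat.factorial 10 / 𝓛.κ ^ 10) * 𝓛.B, by positivity,
    fun M hM θ Λ hΛ s => ?_⟩
  have hM0 : 0 < M := one_pos.trans hM
  calc ∑ i ∈ s, 𝓛.p i θ * (𝓛.n i * truncExp M (𝓛.logH i θ Λ)) ^ 2
      ≤ ∑ i ∈ s, M ^ 2 * ((1 + 𝓛.K + b) ^ 8 * (Nat.factorial 10 / 𝓛.κ ^ 10))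
          * (𝓛.p i θ * Real.exp (𝓛.κ * 𝓛.n i)) := by
        refine Finset.sum_le_sum fun i _ => ?_
        have h0 := 𝓛.p_nonneg i θ
        have h1 := 𝓛.truncExp_logH_le hM hb i θ hΛ
        have h2 := pow_le_exp hκ (𝓛.n i).cast_nonneg 10
        have h3 := ((isTruncation_truncExp hM).pos (𝓛.logH i θ Λ)).le
        calc 𝓛.p i θ * (𝓛.n i * truncExp M (𝓛.logH i θ Λ)) ^ 2
            ≤ 𝓛.p i θ * (𝓛.n i * (M * ((1 + 𝓛.K + b) * 𝓛.n i) ^ 4)) ^ 2 := by gcongr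
          _ = M ^ 2 * (1 + 𝓛.K + b) ^ 8 * 𝓛.p i θ * (𝓛.n i : ℝ) ^ 10 := by ring
          _ ≤ M ^ 2 * (1 + 𝓛.K + b) ^ 8 * 𝓛.p i θ * (Nat.factorial 10 / 𝓛.κ ^ 10
                * Real.exp (𝓛.κ * 𝓛.n i)) := by gcongr
          _ = _ := by ring
    _ = M ^ 2 * ((1 + 𝓛.K + b) ^ 8 * (Nat.factorial 10 / 𝓛.κ ^ 10))
          * ∑ i ∈ s, 𝓛.p i θ * Real.exp (𝓛.κ * 𝓛.n i) := by rw [Finset.mul_sum]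
    _ ≤ M ^ 2 * ((1 + 𝓛.K + b) ^ 8 * (Nat.factorial 10 / 𝓛.κ ^ 10)) * 𝓛.B := by
        gcongr
        exact 𝓛.p_moment θ s
    _ = _ := by ring

theorem summable_truncExp {M : ℝ} (hM : 1 < M) (θ : Θ) (Λ : ℝ) :
    Summable fun i => 𝓛.p i θ * truncExp M (𝓛.logH i θ Λ) :=
  ((moment_truncExp hM (abs_nonneg Λ) θ (neg_abs_le Λ)).summable_g (isTruncation_truncExp hM)
    (half_pos 𝓛.κ_pos)).1

/-- Near the risk-sensitive cost, the exponential moments are those of the tilted chain. -/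
theorem moment_exp (θ : Θ) {Λ : ℝ} (hΛ : 𝓛.risk θ - 𝓛.κ / 2 ≤ Λ) :
    𝓛.Moment Real.exp (𝓛.κ / 2) 𝓛.B θ Λ := by
  intro s
  refine le_trans (Finset.sum_le_sum fun i _ => ?_) (𝓛.risk_moment θ s)
  rw [mul_assoc, mul_assoc, ← Real.exp_add, ← Real.exp_add]
  have hn : (0 : ℝ) ≤ 𝓛.n i := (𝓛.n i).cast_nonneg
  refine mul_le_mul_of_nonneg_left (Real.exp_le_exp.2 ?_) (𝓛.p_nonneg i θ)
  have := mul_le_mul_of_nonneg_left hΛ hn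
  simp only [logH]
  nlinarith

theorem g_exp_risk (θ : Θ) : 𝓛.g Real.exp θ (𝓛.risk θ) = 1 := (𝓛.hasSum_risk θ).tsum_eq

theorem moment_truncExp_of_exp {M : ℝ} (hM : 1 < M) {κ C : ℝ} {θ : Θ} {Λ : ℝ}
    (h : 𝓛.Moment Real.exp κ C θ Λ) : 𝓛.Moment (truncExp M) κ C θ Λ := fun s =>
  (Finset.sum_le_sum fun i _ => mul_le_mul_of_nonneg_right (mul_le_mul_of_nonneg_left
    ((isTruncation_truncExp hM).le_exp _) (𝓛.p_nonneg i θ)) (Real.exp_pos _).le).trans (h s)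

theorem g_truncExp_K_le {M : ℝ} (hM : 1 < M) (θ : Θ) : 𝓛.g (truncExp M) θ 𝓛.K ≤ 1 := by
  refine hasSum_le (fun i => mul_le_of_le_one_right (𝓛.p_nonneg i θ)
    ((isTruncation_truncExp hM).le_one ?_)) (summable_truncExp hM θ _).hasSum (𝓛.hasSum_p θ)
  have := (abs_le.1 (𝓛.abs_c i θ)).2
  simp only [logH]; linarith

theorem one_le_g_truncExp {M : ℝ} (hM : 1 < M) (θ : Θ) {Λ : ℝ} (hΛ : Λ ≤ -𝓛.K) :
    1 ≤ 𝓛.g (truncExp M) θ Λ := by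
  refine hasSum_le (fun i => le_mul_of_one_le_right (𝓛.p_nonneg i θ)
    ((isTruncation_truncExp hM).one_le ?_)) (𝓛.hasSum_p θ) (summable_truncExp hM θ _).hasSum
  have h := (abs_le.1 (𝓛.abs_c i θ)).1
  have hn : (0 : ℝ) ≤ 𝓛.n i := (𝓛.n i).cast_nonneg
  have := mul_le_mul_of_nonneg_left hΛ hn
  simp only [logH]; linarith

/-- Existence by the intermediate value theorem between `-𝓛.K` and `𝓛.K`, where the signs of the
logarithms of `H` are known; uniqueness by strict monotonicity. -/
theorem existsUnique_root [CompleteSpace Θ] {M : ℝ} (hM : 1 < M) (θ : Θ) :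
    (∃! Λ, 𝓛.g (truncExp M) θ Λ = 1) ∧ ∀ Λ, 𝓛.g (truncExp M) θ Λ = 1 → |Λ| ≤ 𝓛.K := by
  have hΓ := isTruncation_truncExp hM
  have hA : 0 < 𝓛.A := one_pos.trans_le 𝓛.one_le_A
  have hκ := 𝓛.κ_pos
  have hcont : Continuous (𝓛.g (truncExp M) θ) := by
    rw [continuous_iff_continuousAt]
    intro Λ
    have hm := moment_truncExp (𝓛 := 𝓛) hM (abs_nonneg Λ) θ (neg_abs_le Λ)
    have h1 : HasDerivAt (𝓛.g (truncExp M) θ) (-𝓛.slope (truncExpDeriv M) θ Λ) Λ := by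
      rw [hasDerivAt_iff_isLittleO_nhds_zero]
      refine Asymptotics.IsBigO.trans_isLittleO (g := fun t : ℝ => t ^ 2) ?_ ?_
      · refine Asymptotics.IsBigO.of_bound (200 * 𝓛.A ^ 2 * (M * ((1 + 𝓛.K + |Λ|) ^ 4
            * (Nat.factorial 4 / (𝓛.κ / 2) ^ 4)) * 𝓛.B) / (𝓛.κ / 2) ^ 2) ?_
        have hr : 0 < 𝓛.κ / 2 / (10 * 𝓛.A) := by positivity
        filter_upwards [Metric.closedBall_mem_nhds (0 : ℝ) hr] with t ht
        rw [mem_closedBall_zero_iff] at ht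
        have := (hm.taylor hΓ (half_pos hκ) (v := 0) (t := t) (d := |t|) (by simp) le_rfl ht).2
        rw [add_zero, inner_zero_right, zero_sub] at this
        rw [Real.norm_eq_abs, Real.norm_eq_abs, abs_of_nonneg (sq_nonneg t), ← sq_abs t]
        refine le_trans (le_of_eq ?_) this
        congr 1
        simp only [smul_eq_mul]
        ring
      · exact Asymptotics.isLittleO_pow_id one_lt_two
    exact h1.continuousAt
  obtain ⟨Λ₀, hΛ₀, hroot⟩ := intermediate_value_Icc' (by linarith [𝓛.K_nonneg] : -𝓛.K ≤ 𝓛.K)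
    hcont.continuousOn ⟨g_truncExp_K_le hM θ, one_le_g_truncExp hM θ le_rfl⟩
  have hK : |Λ₀| ≤ 𝓛.K := abs_le.2 hΛ₀
  have huniq : ∀ Λ, 𝓛.g (truncExp M) θ Λ = 1 → Λ = Λ₀ := by
    intro Λ hΛ
    have hc := 𝓛.minSlope_pos
    rcases lt_trichotomy Λ Λ₀ with h | h | h
    · have := g_below hΓ hK hroot (z := Λ₀ - Λ) (by linarith) (summable_truncExp hM θ _)
      rw [sub_sub_cancel, hΛ] at this
      nlinarith
    · exact h
    · have := g_above hΓ hK (summable_truncExp hM θ _) hroot (z := Λ - Λ₀) (by linarith)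
      rw [add_sub_cancel, hΛ] at this
      have hm : 0 < min (Λ - Λ₀) 1 := lt_min (by linarith) one_pos
      nlinarith
  exact ⟨⟨Λ₀, hroot, huniq⟩, fun Λ hΛ => by rw [huniq Λ hΛ]; exact hK⟩

/-- If `𝓛.g Γ θ Λ ≥ 1` then the root of `𝓛.g Γ θ` is at least `Λ`. -/
theorem le_root {Γ Γ' : ℝ → ℝ} (hΓ : IsTruncation Γ Γ') {θ : Θ} {x Λ : ℝ} (hx : |x| ≤ 𝓛.K)
    (hs : Summable fun i => 𝓛.p i θ * Γ (𝓛.logH i θ x)) (h1 : 𝓛.g Γ θ x = 1)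
    (hΛ : 1 ≤ 𝓛.g Γ θ Λ) : Λ ≤ x := by
  by_contra! h
  have := g_above hΓ hx hs h1 (z := Λ - x) (by linarith)
  rw [add_sub_cancel] at this
  have hm : 0 < min (Λ - x) 1 := lt_min (by linarith) one_pos
  have := mul_pos 𝓛.minSlope_pos hm
  linarith

theorem root_mono [CompleteSpace Θ] {M M' : ℝ} (hM : 1 < M) (hMM' : M ≤ M') {θ : Θ} {x y : ℝ}
    (hx : 𝓛.g (truncExp M) θ x = 1) (hy : 𝓛.g (truncExp M') θ y = 1) : x ≤ y := by
  have hM' := hM.trans_le hMM'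
  refine le_root (isTruncation_truncExp hM') ((existsUnique_root hM' θ).2 y hy)
    (summable_truncExp hM' θ _) hy ?_
  rw [← hx]
  exact (summable_truncExp hM θ x).tsum_le_tsum (fun i => mul_le_mul_of_nonneg_left
    (truncExp_mono hM hMM' _) (𝓛.p_nonneg i θ)) (summable_truncExp hM' θ x)

theorem root_le_risk {M : ℝ} (hM : 1 < M) {θ : Θ} {x : ℝ}
    (hx : 𝓛.g (truncExp M) θ x = 1) : x ≤ 𝓛.risk θ := by
  by_contra! h
  have hs := (𝓛.hasSum_risk θ).summable
  have h1 := g_above isTruncation_exp (𝓛.abs_risk θ) hs (g_exp_risk θ) (z := x - 𝓛.risk θ)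
    (by linarith)
  rw [add_sub_cancel] at h1
  have hm : 0 < min (x - 𝓛.risk θ) 1 := lt_min (by linarith) one_pos
  have h2 := mul_pos 𝓛.minSlope_pos hm
  have hmom := moment_exp (𝓛 := 𝓛) θ (Λ := x) (by linarith [𝓛.κ_pos])
  have h3 : 𝓛.g (truncExp M) θ x ≤ 𝓛.g Real.exp θ x :=
    (summable_truncExp hM θ x).tsum_le_tsum (fun i => mul_le_mul_of_nonneg_left
      ((isTruncation_truncExp hM).le_exp _) (𝓛.p_nonneg i θ))
      (hmom.summable_g isTruncation_exp (half_pos 𝓛.κ_pos)).1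
  linarith

/-- The truncated costs converge to the risk-sensitive cost uniformly in the parameter. -/
theorem exists_risk_sub_le_root [CompleteSpace Θ] {ε : ℝ} (hε : 0 < ε) (hεκ : ε ≤ 𝓛.κ / 4) :
    ∃ M₀, 1 < M₀ ∧ ∀ M, M₀ ≤ M → ∀ (θ : Θ) (x : ℝ), 𝓛.g (truncExp M) θ x = 1 →
      𝓛.risk θ - ε ≤ x := by
  have hκ := 𝓛.κ_pos
  have hK := 𝓛.K_nonneg
  rcases isEmpty_or_nonempty Θ with hΘ | hΘ
  · exact ⟨2, one_lt_two, fun M _ θ => (hΘ.false θ).elim⟩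
  have hB := 𝓛.B_nonneg
  set L := 𝓛.K + (𝓛.K + 𝓛.κ) with hL
  have hL0 : 0 < L := by linarith
  have hlim : Tendsto (fun M => Real.exp (-(𝓛.κ / (4 * L)) * Real.log M) * 𝓛.B) atTop (𝓝 0) := by
    have h1 : Tendsto (fun M => -(𝓛.κ / (4 * L)) * Real.log M) atTop atBot :=
      Real.tendsto_log_atTop.const_mul_atTop_of_neg (by
        have : 0 < 𝓛.κ / (4 * L) := by positivity
        linarith)
    simpa using (Real.tendsto_exp_atBot.comp h1).mul_const 𝓛.B
  have hev := (hlim.eventually (gt_mem_nhds (mul_pos 𝓛.minSlope_pos hε))).and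
    (eventually_gt_atTop 1)
  obtain ⟨M₀, hM₀⟩ := eventually_atTop.1 hev
  refine ⟨M₀, (hM₀ M₀ le_rfl).2, fun M hM θ x hx => ?_⟩
  obtain ⟨hsmall, hM1⟩ := hM₀ M hM
  have hM0 : 0 < M := one_pos.trans hM1
  have hΓ := isTruncation_truncExp hM1
  refine le_root hΓ ((existsUnique_root hM1 θ).2 x hx) (summable_truncExp hM1 θ _) hx ?_
  set Λ := 𝓛.risk θ - ε with hΛ
  have hsΛ := ((moment_exp (𝓛 := 𝓛) θ (Λ := Λ) (by linarith)).summable_g isTruncation_exp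
    (half_pos hκ)).1
  have h1 := g_below isTruncation_exp (𝓛.abs_risk θ) (g_exp_risk θ) hε.le hsΛ
  set q := Real.exp (-(𝓛.κ / (4 * L)) * Real.log M) with hq
  have htail := summable_of_moment (f := fun i => 𝓛.p i θ * Real.exp (𝓛.logH i θ Λ)
      * Real.exp (𝓛.κ / 4 * 𝓛.n i)) (D := 1) (fun i => by
    rw [one_mul, abs_of_nonneg (by have := 𝓛.p_nonneg i θ; positivity), mul_assoc, mul_assoc,
      ← Real.exp_add, ← Real.exp_add]
    refine mul_le_mul_of_nonneg_left (Real.exp_le_exp.2 ?_) (𝓛.p_nonneg i θ)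
    have hn : (0 : ℝ) ≤ 𝓛.n i := (𝓛.n i).cast_nonneg
    have : 𝓛.logH i θ Λ ≤ 𝓛.c i θ - 𝓛.n i * 𝓛.risk θ + 𝓛.κ / 4 * 𝓛.n i := by
      simp only [logH, hΛ]; nlinarith
    linarith [mul_nonneg hκ.le hn]) zero_le_one (𝓛.risk_moment θ)
  -- where the truncation is active, the loop is long, so the moment bound makes up for it
  have hterm : ∀ i, 𝓛.p i θ * Real.exp (𝓛.logH i θ Λ) - q * (𝓛.p i θ * Real.exp (𝓛.logH i θ Λ)
      * Real.exp (𝓛.κ / 4 * 𝓛.n i)) ≤ 𝓛.p i θ * truncExp M (𝓛.logH i θ Λ) := by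
    intro i
    have h0 := 𝓛.p_nonneg i θ
    rcases le_or_gt (𝓛.logH i θ Λ) (Real.log M) with hs | hs
    · have : truncExp M (𝓛.logH i θ Λ) = Real.exp (𝓛.logH i θ Λ) := by
        rw [truncExp, taylorExp_of_nonpos _ (by linarith), Real.exp_sub, Real.exp_log hM0,
          mul_div_cancel₀ _ hM0.ne']
      rw [this]
      have : 0 ≤ q * (𝓛.p i θ * Real.exp (𝓛.logH i θ Λ) * Real.exp (𝓛.κ / 4 * 𝓛.n i)) := by
        positivity
      linarith
    · have h2 : 𝓛.logH i θ Λ ≤ L * 𝓛.n i := (le_abs_self _).trans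
        (𝓛.abs_logH_le i θ (abs_le.2 ⟨by linarith [(abs_le.1 (𝓛.abs_risk θ)).1],
          by linarith [(abs_le.1 (𝓛.abs_risk θ)).2]⟩))
      have h3 : 1 ≤ q * Real.exp (𝓛.κ / 4 * 𝓛.n i) := by
        rw [hq, ← Real.exp_add]
        refine Real.one_le_exp ?_
        have h4 : Real.log M ≤ L * 𝓛.n i := hs.le.trans h2
        have h5 := mul_le_mul_of_nonneg_left h4 (by positivity : 0 ≤ 𝓛.κ / (4 * L))
        have h6 : 𝓛.κ / (4 * L) * (L * 𝓛.n i) = 𝓛.κ / 4 * 𝓛.n i := by field_simp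
        linarith
      have h4 : 0 ≤ 𝓛.p i θ * Real.exp (𝓛.logH i θ Λ) := by positivity
      have h5 := mul_le_mul_of_nonneg_left h3 h4
      have h6 := mul_nonneg h0 (hΓ.pos (𝓛.logH i θ Λ)).le
      linarith
  have h2 := hasSum_le hterm (hsΛ.hasSum.sub (htail.1.hasSum.mul_left q))
    (summable_truncExp hM1 θ Λ).hasSum
  have h3 : q * ∑' i, 𝓛.p i θ * Real.exp (𝓛.logH i θ Λ) * Real.exp (𝓛.κ / 4 * 𝓛.n i)
      ≤ q * 𝓛.B := by
    have := (le_abs_self _).trans htail.2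
    rw [one_mul] at this
    gcongr
  change 𝓛.g Real.exp θ Λ - _ ≤ 𝓛.g (truncExp M) θ Λ at h2
  linarith

/-- Close to the truncated cost, the exponential moments are bounded uniformly in the truncation
level and in the parameter. -/
theorem exists_moment_root [CompleteSpace Θ] : ∃ C, ∀ M, 1 < M → ∀ (θ : Θ) (x : ℝ),
    𝓛.g (truncExp M) θ x = 1 → ∀ Λ, x - 𝓛.κ / 4 ≤ Λ →
      𝓛.Moment (truncExp M) (𝓛.κ / 2) C θ Λ := by
  have hκ := 𝓛.κ_pos
  have hK := 𝓛.K_nonneg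
  rcases isEmpty_or_nonempty Θ with hΘ | hΘ
  · exact ⟨0, fun M _ θ => (hΘ.false θ).elim⟩
  have hB := 𝓛.B_nonneg
  obtain ⟨M₀, hM₀, hroot⟩ := exists_risk_sub_le_root (𝓛 := 𝓛) (ε := 𝓛.κ / 4) (by linarith) le_rfl
  set D := (1 + 𝓛.K + (𝓛.K + 𝓛.κ / 4)) ^ 4 * (Nat.factorial 4 / (𝓛.κ / 2) ^ 4) with hD
  refine ⟨max 𝓛.B (M₀ * D * 𝓛.B), fun M hM θ x hx Λ hΛ => ?_⟩
  rcases le_total M₀ M with h | h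
  · have h1 := hroot M h θ x hx
    exact fun s => (moment_truncExp_of_exp hM (moment_exp θ (by linarith)) s).trans
      (le_max_left _ _)
  · have h1 := (abs_le.1 ((existsUnique_root hM θ).2 x hx)).1
    refine fun s => (moment_truncExp hM (b := 𝓛.K + 𝓛.κ / 4) (by positivity) θ
      (by linarith) s).trans (le_trans ?_ (le_max_right _ _))
    gcongr

end LoopFamily

/-- Regularity of a truncated cost, with the lower bound of `g` below it. -/
structure GoodLevel {Θ : Type*} [NormedAddCommGroup Θ] [InnerProductSpace ℝ Θ] (K C c ε : ℝ)
    (g : Θ → ℝ → ℝ) (J : Θ → ℝ → Θ) (h : Θ → ℝ) (dh : Θ → Θ) : Prop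
    extends LevelCore K C c ε g J h dh where
  g_below : ∀ θ z, 0 ≤ z → 1 + c * min z 1 ≤ g θ (h θ - z)

theorem LevelCore.mono {Θ : Type*} [NormedAddCommGroup Θ] [InnerProductSpace ℝ Θ]
    {K C C' c ε ε' : ℝ} {g : Θ → ℝ → ℝ} {J : Θ → ℝ → Θ} {h : Θ → ℝ} {dh : Θ → Θ}
    (H : LevelCore K C c ε g J h dh) (hC : C ≤ C') (hε : ε' ≤ ε) :
    LevelCore K C' c ε' g J h dh where
  abs_le := H.abs_le
  taylor θ v := (H.taylor θ v).trans (by gcongr)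
  norm_dh θ := (H.norm_dh θ).trans hC
  norm_J θ Λ hΛ := (H.norm_J θ Λ (by linarith)).trans hC
  abs_g θ Λ hΛ := (H.abs_g θ Λ (by linarith)).trans hC
  g_above := H.g_above
  J_near θ := by
    obtain ⟨a, h1, h2, h3⟩ := H.J_near θ
    exact ⟨a, h1, h2.trans hC, fun Λ hΛ => (h3 Λ (hΛ.trans hε)).trans (by gcongr)⟩

theorem LoopFamily.exists_goodLevel {Θ ι : Type*} [NormedAddCommGroup Θ] [InnerProductSpace ℝ Θ]
    [CompleteSpace Θ] (𝓛 : LoopFamily Θ ι) : ∃ C ε, 0 < ε ∧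
      (∀ M, 1 < M → ∀ h : Θ → ℝ, (∀ θ, 𝓛.g (truncExp M) θ (h θ) = 1) →
        GoodLevel 𝓛.K C 𝓛.minSlope ε (𝓛.g (truncExp M)) (𝓛.J (truncExp M) (truncExpDeriv M)) h
          (𝓛.gradRoot (truncExp M) (truncExpDeriv M) h)) ∧
      LevelCore 𝓛.K C 𝓛.minSlope ε (𝓛.g Real.exp) (𝓛.J Real.exp Real.exp) 𝓛.risk
        (𝓛.gradRoot Real.exp Real.exp 𝓛.risk) := by
  have hκ := 𝓛.κ_pos
  obtain ⟨C₀, hC₀⟩ := 𝓛.exists_moment_root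
  obtain ⟨C₁, ε₁, hε₁, -, h₁⟩ := LoopFamily.exists_levelCore (𝓛 := 𝓛) (C := C₀) (half_pos hκ)
    (by linarith : 0 < 𝓛.κ / 4)
  obtain ⟨C₂, ε₂, hε₂, -, h₂⟩ := LoopFamily.exists_levelCore (𝓛 := 𝓛) (C := 𝓛.B) (half_pos hκ)
    (half_pos hκ)
  refine ⟨max C₁ C₂, min ε₁ ε₂, lt_min hε₁ hε₂, fun M hM h hh => ?_, ?_⟩
  · have hΓ := isTruncation_truncExp hM
    have hhK : ∀ θ, |h θ| ≤ 𝓛.K := fun θ => (existsUnique_root hM θ).2 _ (hh θ)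
    refine ⟨(h₁ _ _ hΓ h hhK hh fun θ Λ hΛ => hC₀ M hM θ _ (hh θ) Λ hΛ).mono
      (le_max_left _ _) (min_le_left _ _), fun θ z hz => ?_⟩
    refine le_trans ?_ (g_below hΓ (hhK θ) (hh θ) hz (summable_truncExp hM θ _))
    have := 𝓛.minSlope_pos
    gcongr
    exact min_le_left _ _
  · exact (h₂ _ _ isTruncation_exp 𝓛.risk 𝓛.abs_risk g_exp_risk
      fun θ Λ hΛ => moment_exp θ hΛ).mono (le_max_right _ _) (min_le_right _ _)

section Gradients

variable {Θ : Type*} [NormedAddCommGroup Θ] [InnerProductSpace ℝ Θ] {C : ℝ}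
  {h h' : Θ → ℝ} {dh dh' : Θ → Θ}

theorem hasGradientAt_of_taylor [CompleteSpace Θ]
    (H : ∀ θ v, |h (θ + v) - h θ - inner ℝ (dh θ) v| ≤ C * ‖v‖ ^ 2) (θ : Θ) :
    HasGradientAt h (dh θ) θ := by
  rw [hasGradientAt_iff_isLittleO_nhds_zero]
  refine Asymptotics.IsBigO.trans_isLittleO (g := fun v : Θ => ‖v‖ ^ 2) ?_ ?_
  · refine Asymptotics.IsBigO.of_bound C (Eventually.of_forall fun v => ?_)
    rw [Real.norm_eq_abs, Real.norm_of_nonneg (sq_nonneg _)]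
    exact H θ v
  · exact Asymptotics.isLittleO_norm_pow_id one_lt_two

/-- Uniform Taylor bounds turn closeness of functions into closeness of their gradients. -/
theorem norm_grad_sub_le
    (H : ∀ θ v, |h (θ + v) - h θ - inner ℝ (dh θ) v| ≤ C * ‖v‖ ^ 2)
    (H' : ∀ θ v, |h' (θ + v) - h' θ - inner ℝ (dh' θ) v| ≤ C * ‖v‖ ^ 2) (hC : 0 ≤ C)
    {δ r : ℝ} (hr : 0 < r) (hδ : ∀ θ, |h θ - h' θ| ≤ δ) (θ : Θ) :
    ‖dh θ - dh' θ‖ ≤ 2 * δ / r + 2 * C * r := by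
  have hδ0 : 0 ≤ δ := (abs_nonneg _).trans (hδ θ)
  refine norm_le_of_inner_le hr (by positivity) fun v hv => ?_
  have h1 := (abs_le.1 (H θ v)).1
  have h2 := (abs_le.1 (H' θ v)).2
  have h3 := (abs_le.1 (hδ θ)).1
  have h4 := (abs_le.1 (hδ (θ + v))).2
  have e : (2 * δ / r + 2 * C * r) * r = 2 * δ + 2 * (C * ‖v‖ ^ 2) := by
    rw [hv]; field_simp
  rw [e, inner_sub_left]
  linarith

/-- A uniform Taylor bound makes the gradient Lipschitz continuous. -/
theorem norm_grad_sub_le_lipschitz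
    (H : ∀ θ v, |h (θ + v) - h θ - inner ℝ (dh θ) v| ≤ C * ‖v‖ ^ 2) (hC : 0 ≤ C) (θ θ' : Θ) :
    ‖dh θ' - dh θ‖ ≤ 6 * C * ‖θ' - θ‖ := by
  rcases eq_or_ne θ' θ with rfl | hne
  · simp
  have hr : 0 < ‖θ' - θ‖ := norm_pos_iff.2 (sub_ne_zero.2 hne)
  refine norm_le_of_inner_le hr (by positivity) fun v hv => ?_
  set w := θ' - θ with hw
  have h1 := (abs_le.1 (H θ' v)).1
  have h2 := (abs_le.1 (H θ (w + v))).2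
  have h3 := (abs_le.1 (H θ w)).1
  have e1 : θ + w = θ' := by rw [hw]; abel
  have e2 : θ + (w + v) = θ' + v := by rw [← add_assoc, e1]
  rw [e2, inner_add_right] at h2
  rw [e1] at h3
  have h4 : C * ‖w + v‖ ^ 2 ≤ C * (2 * ‖w‖) ^ 2 := by
    gcongr
    exact (norm_add_le _ _).trans (by rw [hv]; linarith)
  have e3 : 6 * C * ‖w‖ * ‖w‖ = C * ‖w‖ ^ 2 + C * (2 * ‖w‖) ^ 2 + C * ‖w‖ ^ 2 := by ring
  rw [e3, inner_sub_left]
  rw [hv] at h1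
  linarith

end Gradients

/-! ### Convergent series and deterministic recursions -/

/-- Convergence of the series with the terms `f i`, in the order of summation. -/
def SeriesConverges {E : Type*} [AddCommMonoid E] [TopologicalSpace E] (f : ℕ → E) : Prop :=
  ∃ L, Tendsto (fun n => ∑ i ∈ Finset.range n, f i) atTop (𝓝 L)

namespace SeriesConverges

variable {E : Type*} [NormedAddCommGroup E] {f g : ℕ → E}

theorem add (hf : SeriesConverges f) (hg : SeriesConverges g) :
    SeriesConverges fun i => f i + g i := by
  obtain ⟨L, hL⟩ := hf
  obtain ⟨L', hL'⟩ := hg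
  exact ⟨L + L', by simpa only [Finset.sum_add_distrib] using hL.add hL'⟩

theorem neg (hf : SeriesConverges f) : SeriesConverges fun i => -f i := by
  obtain ⟨L, hL⟩ := hf
  exact ⟨-L, by simpa only [Finset.sum_neg_distrib] using hL.neg⟩

theorem sub (hf : SeriesConverges f) (hg : SeriesConverges g) :
    SeriesConverges fun i => f i - g i := by
  simpa only [sub_eq_add_neg] using hf.add hg.neg

theorem of_summable (hf : Summable f) : SeriesConverges f := ⟨_, hf.hasSum.tendsto_sum_nat⟩

theorem of_abs_le {f g : ℕ → ℝ} (hg : Summable g) (h : ∀ i, |f i| ≤ g i) : SeriesConverges f :=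
  of_summable (hg.of_norm_bounded h)

end SeriesConverges

/-- A nonnegative drift with a convergent perturbation: both the sequence and the accumulated
drift converge. -/
theorem tendsto_of_descent {V d e : ℕ → ℝ} {b : ℝ} (m₀ : ℕ) (hd : ∀ m ≥ m₀, 0 ≤ d m)
    (h : ∀ m ≥ m₀, V (m + 1) ≤ V m - d m + e m) (he : SeriesConverges e) (hV : ∀ m, b ≤ V m) :
    (∃ L, Tendsto V atTop (𝓝 L)) ∧ Summable fun m => d (m + m₀) := by
  obtain ⟨Le, hLe⟩ := he
  set E : ℕ → ℝ := fun n => ∑ i ∈ Finset.range n, e i with hE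
  have hES : ∀ n, E (n + 1) = E n + e n := fun n => Finset.sum_range_succ _ _
  set T : ℕ → ℝ := fun n => V (n + m₀) - E (n + m₀) with hT
  have hstep : ∀ n, T (n + 1) ≤ T n - d (n + m₀) := fun n => by
    have h1 := h (n + m₀) (Nat.le_add_left _ _)
    have h2 := hES (n + m₀)
    simp only [hT, show n + 1 + m₀ = n + m₀ + 1 by ring]
    linarith
  have hanti : Antitone T := antitone_nat_of_succ_le fun n =>
    (hstep n).trans (by linarith [hd (n + m₀) (Nat.le_add_left _ _)])
  obtain ⟨B, hB⟩ := hLe.bddAbove_range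
  have hTb : ∀ n, b - B ≤ T n := fun n =>
    sub_le_sub (hV _) (hB ⟨n + m₀, rfl⟩)
  have hTlim := tendsto_atTop_ciInf hanti ⟨b - B, by rintro _ ⟨n, rfl⟩; exact hTb n⟩
  refine ⟨⟨(⨅ i, T i) + Le, (tendsto_add_atTop_iff_nat m₀).1 ?_⟩, ?_⟩
  · have := hTlim.add ((tendsto_add_atTop_iff_nat m₀).2 hLe)
    simpa [hT] using this
  · refine summable_of_sum_range_le (c := T 0 - (b - B))
      (fun n => hd _ (Nat.le_add_left _ _)) fun n => ?_
    have : ∑ i ∈ Finset.range n, d (i + m₀) ≤ T 0 - T n := by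
      induction n with
      | zero => simp
      | succ n ih => rw [Finset.sum_range_succ]; linarith [hstep n]
    linarith [hTb n]

/-- A quantity that is summable along the step sizes and changes at most as fast as a path of
bounded speed with convergent perturbations tends to zero. -/
theorem tendsto_zero_of_summable_sq {E : Type*} [NormedAddCommGroup E] [NormedSpace ℝ E]
    {γ q ε : ℕ → ℝ} {x b e : ℕ → E} {B L : ℝ} (hγ : ∀ m, 0 < γ m)
    (hγs : Tendsto (fun n => ∑ m ∈ Finset.range n, γ m) atTop atTop)
    (hx : ∀ m, x (m + 1) = x m + γ m • b m + e m) (m₀ : ℕ) (hb : ∀ m ≥ m₀, ‖b m‖ ≤ B)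
    (he : SeriesConverges e) (hq : ∀ m, 0 ≤ q m) (hs : Summable fun m => γ m * q m ^ 2)
    (hL : 0 ≤ L) (hB : 0 ≤ B) (hε : Tendsto ε atTop (𝓝 0))
    (hlip : ∀ n m, n ≤ m → |q m - q n| ≤ L * ‖x m - x n‖ + ε n) :
    Tendsto q atTop (𝓝 0) := by
  obtain ⟨Le, hLe⟩ := he
  set S : ℕ → E := fun n => ∑ i ∈ Finset.range n, e i with hS
  rw [Metric.tendsto_atTop]
  intro δ' hδ'
  set δ := δ' / 4 with hδ
  have hδ0 : 0 < δ := by positivity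
  set T := δ / ((L + 1) * (B + 1)) with hT
  have hT0 : 0 < T := by positivity
  have hcauchy := Metric.cauchySeq_iff.1 hLe.cauchySeq (δ / (L + 1)) (by positivity)
  obtain ⟨N₁, hN₁⟩ := hcauchy
  obtain ⟨N₂, hN₂⟩ := Metric.tendsto_atTop.1 hε δ hδ0
  obtain ⟨N₃, hN₃⟩ := Metric.cauchySeq_iff.1 hs.hasSum.tendsto_sum_nat.cauchySeq (δ ^ 2 * T)
    (by positivity)
  refine ⟨max (max N₁ N₂) (max N₃ m₀), fun m hm => ?_⟩
  have hm1 : N₁ ≤ m := (le_max_left _ _).trans ((le_max_left _ _).trans hm)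
  have hm2 : N₂ ≤ m := (le_max_right _ _).trans ((le_max_left _ _).trans hm)
  have hm3 : N₃ ≤ m := (le_max_left _ _).trans ((le_max_right _ _).trans hm)
  have hm4 : m₀ ≤ m := (le_max_right _ _).trans ((le_max_right _ _).trans hm)
  rw [Real.dist_eq, sub_zero, abs_of_nonneg (hq m)]
  by_contra! hcon
  -- starting at `m`, the quantity stays above `δ` until the step sizes have accumulated to `T`
  have hpath : ∀ j, ‖x (m + j) - x m‖ ≤ B * (∑ i ∈ Finset.range j, γ (m + i)) + δ / (L + 1) := by
    intro j
    have h1 : x (m + j) - x m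
        = ∑ i ∈ Finset.range j, γ (m + i) • b (m + i) + (S (m + j) - S m) := by
      have h2 : S (m + j) - S m = ∑ i ∈ Finset.range j, e (m + i) := by
        simp only [hS, Finset.sum_range_add, add_sub_cancel_left]
      rw [h2, ← Finset.sum_add_distrib]
      induction j with
      | zero => simp
      | succ j ih =>
        rw [Finset.sum_range_succ, ← ih (by
          simp only [hS, Finset.sum_range_add, add_sub_cancel_left]), ← add_assoc m j 1, hx (m + j)]
        abel
    rw [h1]
    refine (norm_add_le _ _).trans (add_le_add ?_ ?_)
    · refine (norm_sum_le _ _).trans ?_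
      rw [Finset.mul_sum]
      refine Finset.sum_le_sum fun i _ => ?_
      rw [norm_smul, Real.norm_of_nonneg (hγ _).le, mul_comm]
      exact mul_le_mul_of_nonneg_right (hb _ (by omega)) (hγ _).le
    · rw [← dist_eq_norm]
      exact (hN₁ _ (by omega) _ hm1).le
  have hstay : ∀ j, ∑ i ∈ Finset.range j, γ (m + i) ≤ T → δ ≤ q (m + j) := by
    intro j hj
    have h1 := hlip m (m + j) (Nat.le_add_right _ _)
    have h2 := hN₂ m hm2
    rw [Real.dist_eq, sub_zero] at h2
    have h3 : L * ‖x (m + j) - x m‖ ≤ 2 * δ := by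
      have h4 : ‖x (m + j) - x m‖ ≤ B * T + δ / (L + 1) := (hpath j).trans (by gcongr)
      have h5 : B * T ≤ δ / (L + 1) := by
        rw [hT, le_div_iff₀ (by positivity)]
        have : B * (δ / ((L + 1) * (B + 1))) * (L + 1) = δ * (B / (B + 1)) := by field_simp
        rw [this]
        exact mul_le_of_le_one_right hδ0.le (div_le_one_of_le₀ (by linarith) (by linarith))
      calc L * ‖x (m + j) - x m‖ ≤ (L + 1) * (δ / (L + 1) + δ / (L + 1)) := by
            apply mul_le_mul (by linarith) (by linarith) (norm_nonneg _) (by linarith)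
        _ = 2 * δ := by field_simp; ring
    have h6 := (abs_le.1 h1).1
    have h7 := (abs_lt.1 h2).2
    linarith
  have hex : ∃ j, T < ∑ i ∈ Finset.range j, γ (m + i) := by
    obtain ⟨n, hn⟩ := (hγs.eventually (eventually_gt_atTop
      (T + ∑ i ∈ Finset.range m, γ i))).exists_forall_of_atTop
    refine ⟨n, ?_⟩
    have := hn (m + n) (Nat.le_add_left _ _)
    rw [Finset.sum_range_add] at this
    linarith
  classical
  have hj := Nat.find_spec hex
  set j := Nat.find hex
  have hbelow : ∀ i < j, δ ≤ q (m + i) := fun i hi =>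
    hstay i (not_lt.1 (Nat.find_min hex hi))
  have h1 : δ ^ 2 * T < ∑ i ∈ Finset.range j, γ (m + i) * q (m + i) ^ 2 := by
    calc δ ^ 2 * T < δ ^ 2 * ∑ i ∈ Finset.range j, γ (m + i) := by gcongr
      _ = ∑ i ∈ Finset.range j, γ (m + i) * δ ^ 2 := by
          rw [Finset.mul_sum]; exact Finset.sum_congr rfl fun i _ => mul_comm _ _
      _ ≤ _ := Finset.sum_le_sum fun i hi => by
          have := hbelow i (Finset.mem_range.1 hi)
          have := (hγ (m + i)).le
          gcongr
  have h2 := hN₃ (m + j) (by omega) m hm3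
  rw [Real.dist_eq, Finset.sum_range_add, add_sub_cancel_left] at h2
  exact absurd ((le_abs_self _).trans_lt h2) (not_lt.2 h1.le)

/-- The Taylor remainder of an antiderivative of a Lipschitz function. -/
theorem abs_integral_sub_le {ψ : ℝ → ℝ} {D : ℝ} (hψ : ∀ x y, |ψ x - ψ y| ≤ D * |x - y|)
    (hcont : Continuous ψ) (hD : 0 ≤ D) (x y : ℝ) :
    |(∫ t in (0 : ℝ)..y, ψ t) - (∫ t in (0 : ℝ)..x, ψ t) - ψ x * (y - x)| ≤ D * (y - x) ^ 2 := by
  have hi : ∀ a b, IntervalIntegrable ψ volume a b := fun a b => hcont.intervalIntegrable a b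
  rw [intervalIntegral.integral_interval_sub_left (hi 0 y) (hi 0 x)]
  have : ψ x * (y - x) = ∫ _ in x..y, ψ x := by
    rw [intervalIntegral.integral_const, smul_eq_mul, mul_comm]
  rw [this, ← intervalIntegral.integral_sub (hi x y) (by simp)]
  have h := intervalIntegral.norm_integral_le_of_norm_le_const (a := x) (b := y)
    (f := fun t => ψ t - ψ x) (C := D * |y - x|) (fun t ht => by
      refine (hψ t x).trans (mul_le_mul_of_nonneg_left ?_ hD)
      rcases Set.mem_uIoc.1 ht with ⟨h1, h2⟩ | ⟨h1, h2⟩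
      · rw [abs_of_pos (by linarith), abs_of_nonneg (by linarith)]; linarith
      · rw [abs_of_nonpos (by linarith), abs_of_nonpos (by linarith)]; linarith)
  rw [Real.norm_eq_abs] at h
  refine h.trans (le_of_eq ?_)
  rw [mul_assoc, ← sq, sq_abs]

/-! ### The Lyapunov functions of the two-dimensional recursion -/

/-- The derivative of the Lyapunov function that keeps `z` from becoming negative: a tent on
`[-ε, 0]`. -/
def tent (ε t : ℝ) : ℝ := max 0 (min (-t) (t + ε))

/-- The derivative of the correction of the Lyapunov function: `D t`, truncated to `[-1, 1]`. -/
def ramp (D t : ℝ) : ℝ := max (-1) (min 1 (D * t))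

theorem abs_max_sub_max_le' (a b c : ℝ) : |max a b - max a c| ≤ |b - c| := by
  simpa using abs_max_sub_max_le_max a b a c

theorem tent_lipschitz (ε x y : ℝ) : |tent ε x - tent ε y| ≤ 1 * |x - y| := by
  unfold tent
  refine (abs_max_sub_max_le' _ _ _).trans ((abs_min_sub_min_le_max _ _ _ _).trans ?_)
  rw [one_mul]
  refine max_le (le_of_eq ?_) (le_of_eq ?_)
  · rw [show -x - -y = -(x - y) by ring, abs_neg]
  · congr 1; ring

theorem ramp_lipschitz {D : ℝ} (hD : 0 ≤ D) (x y : ℝ) : |ramp D x - ramp D y| ≤ D * |x - y| := by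
  unfold ramp
  refine (abs_max_sub_max_le' _ _ _).trans ((abs_min_sub_min_le_max _ _ _ _).trans ?_)
  rw [sub_self, abs_zero, ← mul_sub, abs_mul, abs_of_nonneg hD]
  exact max_le (by positivity) le_rfl

theorem continuous_tent (ε : ℝ) : Continuous (tent ε) := by unfold tent; fun_prop

theorem continuous_ramp (D : ℝ) : Continuous (ramp D) := by unfold ramp; fun_prop

theorem abs_tent_le {ε : ℝ} (hε : ε ≤ 1) (t : ℝ) : |tent ε t| ≤ 1 := by
  rw [tent, abs_of_nonneg (le_max_left _ _)]
  refine max_le zero_le_one ?_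
  rcases le_total (-1) t with h | h
  · exact (min_le_left _ _).trans (by linarith)
  · exact (min_le_right _ _).trans (by linarith)

theorem abs_ramp_le (D t : ℝ) : |ramp D t| ≤ 1 :=
  abs_le.2 ⟨le_max_left _ _, max_le (by norm_num) (min_le_left _ _)⟩

theorem tent_nonneg (ε t : ℝ) : 0 ≤ tent ε t := le_max_left _ _

theorem tent_of_nonneg {ε t : ℝ} (ht : 0 ≤ t) : tent ε t = 0 :=
  max_eq_left ((min_le_left _ _).trans (by linarith))

theorem tent_of_le {ε t : ℝ} (ht : t ≤ -ε) : tent ε t = 0 :=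
  max_eq_left ((min_le_right _ _).trans (by linarith))

theorem tent_pos {ε t : ℝ} (h : -ε < t) (ht : t < 0) : 0 < tent ε t :=
  lt_max_of_lt_right (lt_min (by linarith) (by linarith))

theorem ramp_of_le {D t : ℝ} (h : |D * t| ≤ 1) : ramp D t = D * t := by
  rw [abs_le] at h
  rw [ramp, min_eq_right h.2, max_eq_right h.1]

theorem ramp_of_ge {D t : ℝ} (h : 1 ≤ D * t) : ramp D t = 1 := by
  rw [ramp, min_eq_left h, max_eq_right (by norm_num)]

/-- The antiderivative of the ramp is nonnegative. -/
theorem integral_ramp_nonneg {D : ℝ} (hD : 0 ≤ D) (z : ℝ) : 0 ≤ ∫ t in (0 : ℝ)..z, ramp D t := by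
  rcases le_total 0 z with h | h
  · refine intervalIntegral.integral_nonneg h fun t ht => ?_
    have : 0 ≤ D * t := mul_nonneg hD ht.1
    exact le_max_of_le_right (le_min zero_le_one this)
  · rw [intervalIntegral.integral_symm, ← intervalIntegral.integral_neg]
    refine intervalIntegral.integral_nonneg h fun t ht => ?_
    have : D * t ≤ 0 := mul_nonpos_of_nonneg_of_nonpos hD ht.2
    have : ramp D t ≤ 0 := max_le (by norm_num) ((min_le_right _ _).trans this)
    linarith

theorem abs_integral_le_abs {ψ : ℝ → ℝ} (h : ∀ t, |ψ t| ≤ 1) (z : ℝ) :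
    |∫ t in (0 : ℝ)..z, ψ t| ≤ |z| := by
  have := intervalIntegral.norm_integral_le_of_norm_le_const (a := 0) (b := z) (f := ψ) (C := 1)
    fun t _ => h t
  simpa using this

/-- The depth of `z` below zero, as measured by the tent function. -/
def depth (ε z : ℝ) : ℝ := ∫ t in z..0, tent ε t

theorem depth_eq (ε z : ℝ) : depth ε z = -∫ t in (0 : ℝ)..z, tent ε t :=
  intervalIntegral.integral_symm _ _

theorem depth_le_of_le {ε z w : ℝ} (h : z ≤ w) : depth ε w ≤ depth ε z := by
  have := intervalIntegral.integral_add_adjacent_intervals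
    ((continuous_tent ε).intervalIntegrable (μ := volume) z w)
    ((continuous_tent ε).intervalIntegrable (μ := volume) w 0)
  have h2 := intervalIntegral.integral_nonneg (μ := volume) h fun t _ => tent_nonneg ε t
  unfold depth
  linarith

theorem depth_zero (ε : ℝ) : depth ε 0 = 0 := intervalIntegral.integral_same

theorem depth_of_nonneg {ε z : ℝ} (hz : 0 ≤ z) : depth ε z = 0 := by
  rw [depth_eq, intervalIntegral.integral_congr (g := fun _ => (0 : ℝ)) fun t ht => by
    rw [Set.uIcc_of_le hz] at ht
    exact tent_of_nonneg ht.1]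
  simp

theorem depth_nonneg (ε z : ℝ) : 0 ≤ depth ε z := by
  rcases le_total z 0 with h | h
  · exact depth_zero ε ▸ depth_le_of_le h
  · exact (depth_of_nonneg h).ge

theorem depth_pos {ε δ : ℝ} (hδ : 0 < δ) (hδε : δ ≤ ε) : 0 < depth ε (-δ) :=
  intervalIntegral.intervalIntegral_pos_of_pos_on ((continuous_tent ε).intervalIntegrable _ _)
    (fun _ ht => tent_pos (by linarith [ht.1]) ht.2) (by linarith)

set_option maxHeartbeats 1000000 in
/-- Stochastic approximation in the two scalar quantities `Y` (the cost of the current parameter)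
and `z` (the error of the estimate of that cost). The drifts are `-k` for `Y` and `η u + k` for
`z`, the noises are `a` and `ζ - a`, and `r` is a summable remainder. Here `k` is the inner product
of the gradient of the cost with the direction of descent, `p` is the norm of that gradient, and
`u` is the mean of the increments of the estimate. The drift `η u` is restoring; `k` is at least
proportional to `p²`, up to an error of order `z²`. The tent function shows that `z` is
asymptotically nonnegative, and then `Y` corrected by an antiderivative of the ramp is a Lyapunov
function. -/
theorem scalar_converges {γ Y z k u a ζ r p : ℕ → ℝ} {c η C' ε ε' K K₁ C₄ : ℝ}
    (hγ : ∀ m, 0 < γ m) (hγs : Tendsto (fun n => ∑ m ∈ Finset.range n, γ m) atTop atTop)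
    (hc : 0 < c) (hη : 0 < η) (hC' : 0 ≤ C') (hε' : 0 < ε') (hε'ε : ε' ≤ ε) (hε'1 : ε' ≤ 1)
    (hε'c : ε' * C' ≤ η * c) (hK₁ε : 1 ≤ K₁ * ε) (hK₁ : 1 ≤ K₁) (hK₁c : 4 * C' + 1 ≤ K₁ * (η * c))
    (hC₄ : 0 ≤ C₄)
    (hY : ∀ m, Y (m + 1) = Y m - γ m * k m + a m + r m)
    (hz : ∀ m, z (m + 1) = z m + γ m * (η * u m + k m) + (ζ m - a m) - r m)
    (hk : ∀ m, |z m| ≤ ε → c / 2 * p m ^ 2 - C' * z m ^ 2 ≤ k m)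
    (hu : ∀ m, 0 ≤ z m → u m ≤ -(c * min (z m) 1))
    (hu' : ∀ m, z m ≤ 0 → c * min (-z m) 1 ≤ u m)
    (hb : ∀ m, -ε ≤ z m → |η * u m + k m| ≤ C₄) (hYK : ∀ m, |Y m| ≤ K)
    (ha : SeriesConverges a) (hζ : SeriesConverges ζ)
    (ht : SeriesConverges fun m => tent ε' (z m) * (ζ m - a m))
    (hr' : SeriesConverges fun m => ramp K₁ (z m) * (ζ m - a m))
    (hr : Summable fun m => |r m|) (hΔ : Summable fun m => (z (m + 1) - z m) ^ 2) :
    Tendsto z atTop (𝓝 0) ∧ (∃ L, Tendsto Y atTop (𝓝 L)) ∧ Summable fun m => γ m * p m ^ 2 := by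
  have hK₁0 : 0 < K₁ := by linarith
  have hηc : 0 < η * c := by positivity
  -- the depth of `z` below zero converges
  obtain ⟨⟨L, hL⟩, -⟩ := tendsto_of_descent (V := fun m => depth ε' (z m))
    (d := fun m => γ m * (tent ε' (z m) * (η * u m + k m)))
    (e := fun m => -(tent ε' (z m) * (ζ m - a m)) + (|r m| + 1 * (z (m + 1) - z m) ^ 2)) (b := 0) 0
    (fun m _ => by
      refine mul_nonneg (hγ m).le ?_
      by_cases h0 : 0 ≤ z m
      · rw [tent_of_nonneg h0, zero_mul]
      by_cases h1 : z m ≤ -ε'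
      · rw [tent_of_le h1, zero_mul]
      push Not at h0 h1
      refine mul_nonneg (tent_nonneg _ _) ?_
      have h2 := hk m (abs_le.2 ⟨by linarith, by linarith⟩)
      have h3 := hu' m h0.le
      rw [min_eq_left (by linarith)] at h3
      have h4 : C' * z m ^ 2 ≤ (η * c) * (-z m) := by
        have : C' * z m ^ 2 ≤ (ε' * C') * (-z m) := by
          have : z m ^ 2 ≤ ε' * (-z m) := by nlinarith
          calc _ ≤ C' * (ε' * (-z m)) := by gcongr
            _ = _ := by ring
        exact this.trans (mul_le_mul_of_nonneg_right hε'c (by linarith))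
      have h5 : η * (c * (-z m)) ≤ η * u m := by gcongr
      have h6 : 0 ≤ c / 2 * p m ^ 2 := by positivity
      linarith)
    (fun m _ => by
      have h1 := (abs_le.1 (abs_integral_sub_le (tent_lipschitz ε') (continuous_tent ε')
        zero_le_one (z m) (z (m + 1)))).1
      have h2 : tent ε' (z m) * r m ≤ |r m| := by
        refine (le_abs_self _).trans ?_
        rw [abs_mul]
        exact mul_le_of_le_one_left (abs_nonneg _) (abs_tent_le hε'1 _)
      have h3 : tent ε' (z m) * (z (m + 1) - z m) = γ m * (tent ε' (z m) * (η * u m + k m))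
          + tent ε' (z m) * (ζ m - a m) - tent ε' (z m) * r m := by rw [hz m]; ring
      simp only [depth_eq]
      rw [h3] at h1
      linarith)
    (ht.neg.add (SeriesConverges.of_summable (hr.add (hΔ.mul_left 1))))
    (fun m => depth_nonneg _ _)
  have hL0 : 0 ≤ L := ge_of_tendsto' hL fun m => depth_nonneg _ _
  -- a positive limit would push the estimate to infinity
  have hL' : L = 0 := by
    by_contra hne
    have hLp : 0 < L := lt_of_le_of_ne hL0 (Ne.symm hne)
    obtain ⟨m₀, hm₀⟩ := eventually_atTop.1 (hL.eventually (lt_mem_nhds (half_lt_self hLp)))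
    have hzneg : ∀ m ≥ m₀, z m ≤ -(L / 2) := fun m hm => by
      have h1 := hm₀ m hm
      have h2 : z m < 0 := by
        by_contra! h
        rw [depth_of_nonneg h] at h1
        linarith
      have h3 := abs_integral_le_abs (abs_tent_le (ε := ε') hε'1) (z m)
      have h4 := neg_abs_le (∫ t in (0 : ℝ)..z m, tent ε' t)
      rw [depth_eq] at h1
      rw [abs_of_neg h2] at h3
      linarith
    set δ := η * (c * min (L / 2) 1) with hδ
    have hδ0 : 0 < δ := by positivity
    have hup : ∀ n, Y (m₀ + n) + z (m₀ + n) ≥ Y m₀ + z m₀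
        + δ * ∑ i ∈ Finset.range n, γ (m₀ + i) + ∑ i ∈ Finset.range n, ζ (m₀ + i) := by
      intro n
      induction n with
      | zero => simp
      | succ n ih =>
        have h1 := hzneg (m₀ + n) (Nat.le_add_right _ _)
        have h2 := hu' (m₀ + n) (by linarith)
        have h3 : min (L / 2) 1 ≤ min (-z (m₀ + n)) 1 := min_le_min_right _ (by linarith)
        have h4 : δ ≤ η * u (m₀ + n) := by
          rw [hδ]; gcongr; exact (mul_le_mul_of_nonneg_left h3 hc.le).trans h2
        have h5 := mul_le_mul_of_nonneg_left h4 (hγ (m₀ + n)).le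
        rw [← add_assoc, hY, hz, Finset.sum_range_succ, Finset.sum_range_succ]
        linarith
    obtain ⟨Z, hZ⟩ := hζ
    obtain ⟨b, hb'⟩ := hZ.bddBelow_range
    set b' := b - ∑ i ∈ Finset.range m₀, ζ i with hb''
    have hlow : ∀ n, b' ≤ ∑ i ∈ Finset.range n, ζ (m₀ + i) := fun n => by
      have := hb' ⟨m₀ + n, rfl⟩
      simp only [Finset.sum_range_add] at this
      rw [hb'']; linarith
    obtain ⟨n, hn⟩ := eventually_atTop.1 (hγs.eventually (eventually_ge_atTop
      ((K - Y m₀ - z m₀ - b') / δ + ∑ i ∈ Finset.range m₀, γ i)))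
    have h1 := hn (m₀ + n) (Nat.le_add_left _ _)
    rw [Finset.sum_range_add] at h1
    have h2 : (K - Y m₀ - z m₀ - b') / δ ≤ ∑ i ∈ Finset.range n, γ (m₀ + i) := by linarith
    rw [div_le_iff₀' hδ0] at h2
    have h3 := hup n
    have h4 := hlow n
    have h5 := hzneg (m₀ + n) (Nat.le_add_right _ _)
    have h6 := (abs_le.1 (hYK (m₀ + n))).2
    linarith
  subst hL'
  set δ := min ε' (1 / K₁) with hδ
  have hδ0 : 0 < δ := lt_min hε' (by positivity)
  have hev : ∀ᶠ m in atTop, -δ ≤ z m := by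
    filter_upwards [hL.eventually (gt_mem_nhds (depth_pos hδ0 (min_le_left _ _)))] with m hm
    by_contra! h
    exact absurd (depth_le_of_le (ε := ε') h.le) (not_le.2 hm)
  obtain ⟨m₀, hm₀⟩ := eventually_atTop.1 hev
  -- the drift of the corrected cost
  set D : ℕ → ℝ := fun m => (1 - ramp K₁ (z m)) * k m - ramp K₁ (z m) * (η * u m) with hD
  set c₁ := min (η * c) 1 with hc₁
  have hc₁0 : 0 < c₁ := lt_min hηc one_pos
  have hKε : 1 / K₁ ≤ ε := by rw [div_le_iff₀' hK₁0]; exact hK₁ε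
  have hK1 : 1 / K₁ ≤ 1 := by rw [div_le_iff₀' hK₁0]; linarith
  -- the slope `K₁` of the ramp is so large that the restoring drift dominates the error `C' z²`;
  -- for negative `z` the ramp has the sign that adds to the descent of `Y`
  have hDD : ∀ m ≥ m₀, c₁ * min |z m| 1 ^ 2 ≤ D m ∧
      (|z m| ≤ 1 / (2 * K₁) → c / 4 * p m ^ 2 ≤ D m) := by
    intro m hm
    have hlow : -(1 / K₁) ≤ z m := (neg_le_neg (min_le_right _ _)).trans (hm₀ m hm)
    have hhalf : 1 / (2 * K₁) < 1 / K₁ := by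
      apply one_div_lt_one_div_of_lt hK₁0; linarith
    rcases le_total (z m) 0 with h0 | h0
    · have habs : |z m| = -z m := abs_of_nonpos h0
      have h1 : |K₁ * z m| ≤ 1 := by
        rw [abs_mul, abs_of_pos hK₁0, habs]
        have : -z m ≤ 1 / K₁ := by linarith
        rwa [le_div_iff₀' hK₁0] at this
      have h2 := hk m (by rw [habs]; linarith)
      have h3 := hu' m h0
      rw [min_eq_left (by linarith : -z m ≤ 1)] at h3
      rw [abs_mul, abs_of_pos hK₁0, habs] at h1
      have hDm : D m = (1 + K₁ * -z m) * k m + (K₁ * -z m) * (η * u m) := by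
        simp only [hD]
        rw [ramp_of_le (by rw [abs_mul, abs_of_pos hK₁0, habs]; exact h1)]; ring
      set w := -z m with hw
      have hw0 : 0 ≤ w := by linarith
      have hzw : z m ^ 2 = w ^ 2 := by rw [hw]; ring
      rw [hzw] at h2
      have hs : 0 ≤ K₁ * w := by positivity
      have e1 : (1 + K₁ * w) * (c / 2 * p m ^ 2 - C' * w ^ 2) ≤ (1 + K₁ * w) * k m := by gcongr
      have e2 : K₁ * w * (η * (c * w)) ≤ K₁ * w * (η * u m) := by gcongr
      have e3 : (4 * C' + 1) * w ^ 2 ≤ K₁ * w * (η * (c * w)) := by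
        calc _ ≤ K₁ * (η * c) * w ^ 2 := by gcongr
          _ = _ := by ring
      have e4 : c / 2 * p m ^ 2 ≤ (1 + K₁ * w) * (c / 2 * p m ^ 2) :=
        le_mul_of_one_le_left (by positivity) (by linarith)
      have e5 : (1 + K₁ * w) * (C' * w ^ 2) ≤ 2 * (C' * w ^ 2) := by gcongr; linarith
      have e6 : 0 ≤ C' * w ^ 2 := by positivity
      have hmain : c / 2 * p m ^ 2 + w ^ 2 ≤ D m := by rw [hDm]; linarith
      have hp0 : 0 ≤ c / 4 * p m ^ 2 := by positivity
      refine ⟨?_, fun _ => by linarith [sq_nonneg w]⟩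
      rw [habs, min_eq_left (by linarith)]
      have : c₁ * w ^ 2 ≤ 1 * w ^ 2 := by gcongr; exact min_le_right _ _
      linarith
    · have habs : |z m| = z m := abs_of_nonneg h0
      have h3 := hu m h0
      rcases le_total (1 / K₁) (z m) with h1 | h1
      · have h1' : 1 ≤ K₁ * z m := by rwa [div_le_iff₀' hK₁0] at h1
        have hDm : D m = -(η * u m) := by simp only [hD]; rw [ramp_of_ge h1']; ring
        refine ⟨?_, fun h => absurd (h.trans_lt hhalf) (not_lt.2 (by rw [habs]; exact h1))⟩
        rw [hDm, habs]
        set w := min (z m) 1 with hw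
        have hw0 : 0 ≤ w := le_min h0 zero_le_one
        have hw1 : w ≤ 1 := min_le_right _ _
        have e1 : η * u m ≤ η * -(c * w) := by gcongr
        have e2 : c₁ * w ^ 2 ≤ (η * c) * w := by
          have : w ^ 2 ≤ w := by nlinarith
          gcongr
          exact min_le_left _ _
        linarith
      · have h1' : K₁ * z m ≤ 1 := by rwa [le_div_iff₀' hK₁0] at h1
        have h2 := hk m (by rw [habs]; linarith)
        rw [min_eq_left (by linarith : z m ≤ 1)] at h3
        have hDm : D m = (1 - K₁ * z m) * k m - (K₁ * z m) * (η * u m) := by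
          simp only [hD]
          rw [ramp_of_le (by rw [abs_mul, abs_of_pos hK₁0, habs]; exact h1')]
        set w := z m with hw
        have hs : 0 ≤ K₁ * w := by positivity
        have hs' : 0 ≤ 1 - K₁ * w := by linarith
        have e1 : (1 - K₁ * w) * (c / 2 * p m ^ 2 - C' * w ^ 2) ≤ (1 - K₁ * w) * k m := by gcongr
        have e2 : K₁ * w * (η * u m) ≤ K₁ * w * (η * -(c * w)) := by gcongr
        have e3 : (4 * C' + 1) * w ^ 2 ≤ K₁ * w * (η * (c * w)) := by
          calc _ ≤ K₁ * (η * c) * w ^ 2 := by gcongr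
            _ = _ := by ring
        have e5 : (1 - K₁ * w) * (C' * w ^ 2) ≤ 1 * (C' * w ^ 2) := by gcongr; linarith
        have e6 : 0 ≤ C' * w ^ 2 := by positivity
        have hmain : (1 - K₁ * w) * (c / 2 * p m ^ 2) + w ^ 2 ≤ D m := by rw [hDm]; linarith
        have e7 : 0 ≤ (1 - K₁ * w) * (c / 2 * p m ^ 2) := mul_nonneg hs' (by positivity)
        refine ⟨?_, fun h => ?_⟩
        · rw [habs, min_eq_left (by linarith)]
          have : c₁ * w ^ 2 ≤ 1 * w ^ 2 := by gcongr; exact min_le_right _ _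
          linarith
        · rw [habs, le_div_iff₀' (by positivity)] at h
          have : 1 / 2 * (c / 2 * p m ^ 2) ≤ (1 - K₁ * w) * (c / 2 * p m ^ 2) := by
            gcongr; linarith
          linarith [sq_nonneg w]
  have hD0 : ∀ m ≥ m₀, 0 ≤ γ m * D m := fun m hm =>
    mul_nonneg (hγ m).le ((by positivity : 0 ≤ c₁ * min |z m| 1 ^ 2).trans (hDD m hm).1)
  obtain ⟨⟨V, hV⟩, hsD⟩ := tendsto_of_descent
    (V := fun m => Y m + ∫ t in (0 : ℝ)..z m, ramp K₁ t) (d := fun m => γ m * D m)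
    (e := fun m => (a m + ramp K₁ (z m) * (ζ m - a m)) + (2 * |r m| + K₁ * (z (m + 1) - z m) ^ 2))
    (b := -K) m₀ hD0
    (fun m _ => by
      have h1 := (abs_le.1 (abs_integral_sub_le (ramp_lipschitz hK₁0.le) (continuous_ramp K₁)
        hK₁0.le (z m) (z (m + 1)))).2
      have h2 : (1 - ramp K₁ (z m)) * r m ≤ 2 * |r m| := by
        refine (le_abs_self _).trans ?_
        rw [abs_mul]
        gcongr
        have := abs_le.1 (abs_ramp_le K₁ (z m))
        exact abs_le.2 ⟨by linarith, by linarith⟩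
      have h3 : ramp K₁ (z m) * (z (m + 1) - z m) = γ m * (ramp K₁ (z m) * (η * u m + k m))
          + ramp K₁ (z m) * (ζ m - a m) - ramp K₁ (z m) * r m := by rw [hz m]; ring
      rw [h3] at h1
      rw [hY m]
      simp only [hD]
      linarith)
    ((ha.add hr').add (SeriesConverges.of_summable ((hr.mul_left 2).add (hΔ.mul_left K₁))))
    (fun m => by
      have := (abs_le.1 (hYK m)).1
      have := integral_ramp_nonneg hK₁0.le (z m)
      linarith)
  have hq : Tendsto (fun m => min |z m| 1) atTop (𝓝 0) := by
    refine tendsto_zero_of_summable_sq (x := z) (b := fun m => η * u m + k m)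
      (e := fun m => (ζ m - a m) - r m) (B := C₄) (L := 1) (ε := fun _ => 0) hγ hγs
      (fun m => by rw [hz m, smul_eq_mul]; ring) m₀ (fun m hm => hb m ?_)
      ((hζ.sub ha).sub (SeriesConverges.of_summable hr.of_abs)) (fun m => by positivity) ?_
      zero_le_one hC₄ tendsto_const_nhds fun n m _ => ?_
    · exact (neg_le_neg ((min_le_left _ _).trans hε'ε)).trans (hm₀ m hm)
    · refine (summable_nat_add_iff m₀).1 (Summable.of_nonneg_of_le (fun m => ?_) (fun m => ?_)
        (hsD.mul_left c₁⁻¹))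
      · have := (hγ (m + m₀)).le
        positivity
      · rw [inv_mul_eq_div, le_div_iff₀ hc₁0, mul_assoc]
        refine mul_le_mul_of_nonneg_left ?_ (hγ _).le
        rw [mul_comm]
        exact (hDD _ (Nat.le_add_left _ _)).1
    · rw [one_mul, add_zero]
      refine (abs_min_sub_min_le_max _ _ _ _).trans (max_le ?_ (by simp))
      exact abs_abs_sub_abs_le_abs_sub _ _
  have hz0 : Tendsto z atTop (𝓝 0) := by
    refine (tendsto_zero_iff_abs_tendsto_zero _).2 (hq.congr' ?_)
    filter_upwards [hq.eventually (gt_mem_nhds one_pos)] with m hm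
    rcases min_lt_iff.1 hm with h | h
    · exact min_eq_left h.le
    · exact absurd h (lt_irrefl _)
  refine ⟨hz0, ⟨V, ?_⟩, ?_⟩
  · have h1 : Tendsto (fun m => ∫ t in (0 : ℝ)..z m, ramp K₁ t) atTop (𝓝 0) := by
      refine squeeze_zero_norm (fun m => abs_integral_le_abs (abs_ramp_le K₁) (z m)) ?_
      exact (tendsto_zero_iff_abs_tendsto_zero _).1 hz0
    simpa using hV.sub h1
  · obtain ⟨m₁, hm₁⟩ := eventually_atTop.1 ((tendsto_zero_iff_abs_tendsto_zero _).1 hz0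
      |>.eventually (ge_mem_nhds (by positivity : 0 < 1 / (2 * K₁))))
    have hsD' : Summable fun m => γ m * D m := (summable_nat_add_iff m₀).1 hsD
    refine (summable_nat_add_iff (m₀ + m₁)).1 (Summable.of_nonneg_of_le (fun m => ?_) (fun m => ?_)
      (((summable_nat_add_iff (m₀ + m₁)).2 hsD').mul_left (4 / c)))
    · have := (hγ (m + (m₀ + m₁))).le
      positivity
    · have h := (hDD (m + (m₀ + m₁)) (by omega)).2 (hm₁ _ (by omega))
      have h2 := mul_le_mul_of_nonneg_left h (hγ (m + (m₀ + m₁))).le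
      calc _ = 4 / c * (γ (m + (m₀ + m₁)) * (c / 4 * p (m + (m₀ + m₁)) ^ 2)) := by field_simp
        _ ≤ _ := by gcongr

section Pathwise

variable {Θ : Type*} [NormedAddCommGroup Θ] [InnerProductSpace ℝ Θ] {K C c ε : ℝ}

theorem LevelCore.abs_sub_le {g : Θ → ℝ → ℝ} {J : Θ → ℝ → Θ} {h : Θ → ℝ} {dh : Θ → Θ}
    (H : LevelCore K C c ε g J h dh) (θ v : Θ) :
    |h (θ + v) - h θ| ≤ (2 * C + 2 * K) * ‖v‖ := by
  have hC : 0 ≤ C := (norm_nonneg _).trans (H.norm_dh θ)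
  have hK : 0 ≤ K := (abs_nonneg _).trans (H.abs_le θ)
  rcases le_total ‖v‖ 1 with hv | hv
  · have h1 := H.taylor θ v
    have h2 : |inner ℝ (dh θ) v| ≤ C * ‖v‖ :=
      (abs_real_inner_le_norm _ _).trans (by gcongr; exact H.norm_dh θ)
    have h3 : C * ‖v‖ ^ 2 ≤ C * ‖v‖ := by
      gcongr; rw [sq]; exact mul_le_of_le_one_left (norm_nonneg _) hv
    have h4 : 0 ≤ K * ‖v‖ := by positivity
    have h5 := _root_.abs_le.1 h1
    have h6 := _root_.abs_le.1 h2
    exact _root_.abs_le.2 ⟨by linarith, by linarith⟩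
  · have h1 := _root_.abs_le.1 (H.abs_le θ)
    have h2 := _root_.abs_le.1 (H.abs_le (θ + v))
    have h3 : K ≤ K * ‖v‖ := le_mul_of_one_le_right hK hv
    have h4 : 0 ≤ C * ‖v‖ := by positivity
    exact _root_.abs_le.2 ⟨by linarith, by linarith⟩

/-- The cost moves down along the negative drift, up to the squared error of the estimate. -/
theorem LevelCore.le_inner {g : Θ → ℝ → ℝ} {J : Θ → ℝ → Θ} {h : Θ → ℝ} {dh : Θ → Θ}
    (H : LevelCore K C c ε g J h dh) (hc : 0 < c) (θ : Θ) (Λ : ℝ) (hΛ : |Λ - h θ| ≤ ε) :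
    c / 2 * ‖dh θ‖ ^ 2 - C ^ 2 / (2 * c) * (Λ - h θ) ^ 2 ≤ inner ℝ (dh θ) (J θ Λ) := by
  obtain ⟨a, ha, -, hJ⟩ := H.J_near θ
  have h1 : inner ℝ (dh θ) (J θ Λ) = a * ‖dh θ‖ ^ 2 + inner ℝ (dh θ) (J θ Λ - a • dh θ) := by
    rw [inner_sub_right, inner_smul_right, real_inner_self_eq_norm_sq]; ring
  have h2 : |inner ℝ (dh θ) (J θ Λ - a • dh θ)| ≤ ‖dh θ‖ * (C * |Λ - h θ|) :=
    (abs_real_inner_le_norm _ _).trans (by gcongr; exact hJ Λ hΛ)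
  have h3 := (_root_.abs_le.1 h2).1
  have h4 : c * ‖dh θ‖ ^ 2 ≤ a * ‖dh θ‖ ^ 2 := by gcongr
  have h5 : ‖dh θ‖ * (C * |Λ - h θ|) ≤ c / 2 * ‖dh θ‖ ^ 2 + C ^ 2 / (2 * c) * (Λ - h θ) ^ 2 := by
    rw [← sq_abs (Λ - h θ)]
    have : c / 2 * ‖dh θ‖ ^ 2 + C ^ 2 / (2 * c) * |Λ - h θ| ^ 2 - ‖dh θ‖ * (C * |Λ - h θ|)
        = (c * ‖dh θ‖ - C * |Λ - h θ|) ^ 2 / (2 * c) := by field_simp; ring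
    have h6 : 0 ≤ (c * ‖dh θ‖ - C * |Λ - h θ|) ^ 2 / (2 * c) := by positivity
    linarith
  rw [h1]
  linarith

/-- Deterministic core of the convergence theorem: along a path of the recursion with noise
`(ξ, ζ)`, convergence of finitely many noise series yields convergence of the costs and vanishing
gradients. The functions `ψ₁`, `ψ₂` are the derivatives of the Lyapunov functions and
depend only on the constants. -/
theorem exists_lyapunov_tests (hc : 0 < c) (hε : 0 < ε) {η : ℝ} (hη : 0 < η) :
    ∃ ψ₁ ψ₂ : ℝ → ℝ, (∀ t, |ψ₁ t| ≤ 1) ∧ (∀ t, |ψ₂ t| ≤ 1) ∧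
      ∀ (γ : ℕ → ℝ) (g : ℕ → Θ → ℝ → ℝ) (J : ℕ → Θ → ℝ → Θ) (h : ℕ → Θ → ℝ) (dh : ℕ → Θ → Θ)
        (θ ξ : ℕ → Θ) (Λ ζ ρ : ℕ → ℝ),
        (∀ m, 0 < γ m) → Tendsto (fun n => ∑ m ∈ Finset.range n, γ m) atTop atTop →
        (∀ m, GoodLevel K C c ε (g m) (J m) (h m) (dh m)) →
        (∀ m ϑ, |h (m + 1) ϑ - h m ϑ| ≤ ρ m) → Summable ρ →
        (∀ m, θ (m + 1) = θ m - γ m • J m (θ m) (Λ m) + ξ m) →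
        (∀ m, Λ (m + 1) = Λ m + η * γ m * (g m (θ m) (Λ m) - 1) + ζ m) →
        SeriesConverges ξ → SeriesConverges ζ →
        SeriesConverges (fun m => inner ℝ (dh m (θ m)) (ξ m)) →
        SeriesConverges (fun m =>
          ψ₁ (Λ m - h m (θ m)) * (ζ m - inner ℝ (dh m (θ m)) (ξ m))) →
        SeriesConverges (fun m =>
          ψ₂ (Λ m - h m (θ m)) * (ζ m - inner ℝ (dh m (θ m)) (ξ m))) →
        Summable (fun m => ‖θ (m + 1) - θ m‖ ^ 2) → Summable (fun m => (Λ (m + 1) - Λ m) ^ 2) →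
        (∃ L, Tendsto (fun m => h m (θ m)) atTop (𝓝 L)) ∧
          Tendsto (fun m => dh m (θ m)) atTop (𝓝 0) := by
  set C' := C ^ 2 / (2 * c) with hC'
  have hC'0 : 0 ≤ C' := by positivity
  have hηc : 0 < η * c := by positivity
  set ε' := min (min ε 1) (η * c / (C' + 1)) with hε'
  set K₁ := max (1 / ε) (max 1 ((4 * C' + 1) / (η * c))) with hK₁
  have hε'0 : 0 < ε' := lt_min (lt_min hε one_pos) (by positivity)
  have hε'1 : ε' ≤ 1 := (min_le_left _ _).trans (min_le_right _ _)
  refine ⟨tent ε', ramp K₁, abs_tent_le hε'1, abs_ramp_le K₁, ?_⟩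
  intro γ g J h dh θ ξ Λ ζ ρ hγ hγs H hρ hρs hθ hΛ sξ sζ sa s₁ s₂ qθ qΛ
  have hC : 0 ≤ C := (norm_nonneg _).trans ((H 0).norm_dh (θ 0))
  have hK : 0 ≤ K := (abs_nonneg _).trans ((H 0).abs_le (θ 0))
  have hρ0 : ∀ m, 0 ≤ ρ m := fun m => (abs_nonneg _).trans (hρ m (θ m))
  have hdY : ∀ m, h (m + 1) (θ (m + 1)) - h m (θ m)
      = (h (m + 1) (θ (m + 1)) - h m (θ (m + 1))) + (h m (θ m + (θ (m + 1) - θ m)) - h m (θ m)) :=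
    fun m => by rw [add_sub_cancel]; ring
  set k : ℕ → ℝ := fun m => inner ℝ (dh m (θ m)) (J m (θ m) (Λ m)) with hk
  -- the noise of the cost, and the second-order remainder together with the change of level
  set a : ℕ → ℝ := fun m => inner ℝ (dh m (θ m)) (ξ m) with ha
  set r : ℕ → ℝ := fun m => h (m + 1) (θ (m + 1)) - h m (θ m) + γ m * k m - a m with hr
  have hrb : ∀ m, |r m| ≤ ρ m + C * ‖θ (m + 1) - θ m‖ ^ 2 := fun m => by
    have h1 := hρ m (θ (m + 1))
    have h2 := (H m).taylor (θ m) (θ (m + 1) - θ m)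
    have h3 : inner ℝ (dh m (θ m)) (θ (m + 1) - θ m) = a m - γ m * k m := by
      rw [show θ (m + 1) - θ m = ξ m - γ m • J m (θ m) (Λ m) by rw [hθ m]; abel,
        inner_sub_right, inner_smul_right]
    rw [h3] at h2
    simp only [hr]
    rw [hdY m]
    have := abs_le.1 h1
    have := abs_le.1 h2
    exact abs_le.2 ⟨by linarith, by linarith⟩
  have hrs : Summable fun m => |r m| :=
    Summable.of_nonneg_of_le (fun _ => abs_nonneg _) hrb (hρs.add (qθ.mul_left C))
  have hρ2 : Summable fun m => ρ m ^ 2 := by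
    obtain ⟨b, hb⟩ := hρs.tendsto_atTop_zero.bddAbove_range
    refine Summable.of_nonneg_of_le (fun _ => sq_nonneg _) (fun m => ?_) (hρs.mul_left b)
    rw [sq]
    exact mul_le_mul_of_nonneg_right (hb ⟨m, rfl⟩) (hρ0 m)
  set D := 2 * C + 2 * K with hD
  have hΔ : Summable fun m =>
      ((Λ (m + 1) - h (m + 1) (θ (m + 1))) - (Λ m - h m (θ m))) ^ 2 := by
    refine Summable.of_nonneg_of_le (fun _ => sq_nonneg _) (fun m => ?_)
      ((qΛ.mul_left 3).add ((hρ2.mul_left 3).add (qθ.mul_left (3 * D ^ 2))))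
    have h1 : (h (m + 1) (θ (m + 1)) - h m (θ (m + 1))) ^ 2 ≤ ρ m ^ 2 := by
      rw [← sq_abs]; exact pow_le_pow_left₀ (abs_nonneg _) (hρ m _) 2
    have h2 : (h m (θ m + (θ (m + 1) - θ m)) - h m (θ m)) ^ 2
        ≤ D ^ 2 * ‖θ (m + 1) - θ m‖ ^ 2 := by
      rw [← sq_abs, ← mul_pow]
      exact pow_le_pow_left₀ (abs_nonneg _) ((H m).abs_sub_le _ _) 2
    rw [show (Λ (m + 1) - h (m + 1) (θ (m + 1))) - (Λ m - h m (θ m))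
      = (Λ (m + 1) - Λ m) - (h (m + 1) (θ (m + 1)) - h m (θ m)) by ring, hdY m]
    have h3 : ∀ x y w : ℝ, (x - (y + w)) ^ 2 ≤ 3 * x ^ 2 + (3 * y ^ 2 + 3 * w ^ 2) :=
      fun x y w => by
      nlinarith [sq_nonneg (x + y), sq_nonneg (x + w), sq_nonneg (y - w)]
    refine (h3 _ _ _).trans ?_
    linarith
  obtain ⟨hz0, hY, hp⟩ := scalar_converges (γ := γ) (Y := fun m => h m (θ m))
    (z := fun m => Λ m - h m (θ m)) (k := k) (u := fun m => g m (θ m) (Λ m) - 1) (a := a) (ζ := ζ)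
    (r := r) (p := fun m => ‖dh m (θ m)‖) (c := c) (η := η) (C' := C') (ε := ε) (ε' := ε') (K := K)
    (K₁ := K₁) (C₄ := η * (C + 1) + C * C) hγ hγs hc hη hC'0 hε'0
    ((min_le_left _ _).trans (min_le_left _ _)) hε'1
    (by
      have : ε' * (C' + 1) ≤ η * c := by
        rw [← le_div_iff₀ (by positivity)]; exact min_le_right _ _
      linarith)
    (by rw [← div_le_iff₀ hε]; exact le_max_left _ _)
    ((le_max_left _ _).trans (le_max_right _ _))
    (by rw [← div_le_iff₀ hηc]; exact (le_max_right _ _).trans (le_max_right _ _))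
    (by positivity)
    (fun m => by simp only [hr]; ring) (fun m => by simp only [hr]; rw [hΛ m]; ring)
    (fun m hm => (H m).le_inner hc _ _ hm)
    (fun m hm => by
      have := (H m).g_above (θ m) _ hm
      rw [add_sub_cancel] at this
      linarith)
    (fun m hm => by
      have := (H m).g_below (θ m) (-(Λ m - h m (θ m))) (by linarith)
      rw [sub_neg_eq_add, add_sub_cancel] at this
      linarith)
    (fun m hm => by
      have h1 := (H m).abs_g (θ m) (Λ m) (by linarith)
      have h2 : |k m| ≤ C * C := (abs_real_inner_le_norm _ _).trans
        (mul_le_mul ((H m).norm_dh _) ((H m).norm_J _ _ (by linarith)) (norm_nonneg _) hC)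
      refine (abs_add_le _ _).trans (add_le_add ?_ h2)
      rw [abs_mul, abs_of_pos hη]
      gcongr
      refine (abs_sub _ _).trans ?_
      rw [abs_one]; linarith)
    (fun m => (H m).abs_le _) sa sζ s₁ s₂ hrs hΔ
  refine ⟨hY, tendsto_zero_iff_norm_tendsto_zero.2 ?_⟩
  obtain ⟨m₀, hm₀⟩ := eventually_atTop.1 (hz0.eventually (le_mem_nhds (neg_lt_zero.2 hε)))
  -- uniform closeness of the later levels, hence of their gradients
  set R : ℕ → ℝ := fun n => ∑' i, ρ (i + n) with hR
  have hR0 : ∀ n, 0 ≤ R n := fun n => tsum_nonneg fun i => hρ0 _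
  have hRlim : Tendsto R atTop (𝓝 0) := tendsto_sum_nat_add ρ
  have hRle : ∀ n m, n ≤ m → ∀ ϑ, |h m ϑ - h n ϑ| ≤ R n := by
    intro n m hnm ϑ
    obtain ⟨j, rfl⟩ := Nat.exists_eq_add_of_le hnm
    have h1 : |h (n + j) ϑ - h n ϑ| ≤ ∑ i ∈ Finset.range j, ρ (i + n) := by
      induction j with
      | zero => simp
      | succ j ih =>
        rw [Finset.sum_range_succ, ← add_assoc]
        have h2 := hρ (n + j) ϑ
        rw [add_comm n j] at h2 ih ⊢
        refine (abs_sub_le _ (h (j + n) ϑ) _).trans ?_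
        linarith [ih (by omega)]
    exact h1.trans (((summable_nat_add_iff n).2 hρs).sum_le_tsum _ fun i _ => hρ0 _)
  -- a radius that balances the two terms of `norm_grad_sub_le`, kept positive if `R n = 0`
  set rr : ℕ → ℝ := fun n => √(R n) + 1 / ((n : ℝ) + 1) with hrr
  have hrr0 : ∀ n, 0 < rr n := fun n => by positivity
  have hsq : Tendsto (fun n => √(R n)) atTop (𝓝 0) := by
    simpa using hRlim.sqrt
  have hrrlim : Tendsto rr atTop (𝓝 0) := by
    simpa [hrr] using hsq.add tendsto_one_div_add_atTop_nhds_zero_nat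
  refine tendsto_zero_of_summable_sq (x := θ) (b := fun m => -J m (θ m) (Λ m)) (e := ξ) (B := C)
    (L := 6 * C) (ε := fun n => 2 * √(R n) + 2 * C * rr n) hγ hγs
    (fun m => by rw [hθ m, smul_neg]; abel) m₀ (fun m hm => ?_) sξ (fun m => norm_nonneg _) hp
    (by positivity) hC (by simpa using (hsq.const_mul 2).add (hrrlim.const_mul (2 * C)))
    fun n m hnm => ?_
  · rw [norm_neg]
    exact (H m).norm_J _ _ (by linarith [hm₀ m hm])
  · refine (abs_norm_sub_norm_le _ _).trans ?_
    have h1 := norm_grad_sub_le_lipschitz (H m).taylor hC (θ n) (θ m)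
    have h2 := norm_grad_sub_le (H m).taylor (H n).taylor hC (hrr0 n) (hRle n m hnm) (θ n)
    have h3 : 2 * R n / rr n ≤ 2 * √(R n) := by
      rw [div_le_iff₀ (hrr0 n), mul_assoc]
      have : R n ≤ √(R n) * rr n := by
        nth_rewrite 1 [← Real.mul_self_sqrt (hR0 n)]
        gcongr
        simp only [hrr]
        have : 0 ≤ 1 / ((n : ℝ) + 1) := by positivity
        linarith
      linarith
    calc ‖dh m (θ m) - dh n (θ n)‖
        ≤ ‖dh m (θ m) - dh m (θ n)‖ + ‖dh m (θ n) - dh n (θ n)‖ :=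
          norm_sub_le_norm_sub_add_norm_sub _ _ _
      _ ≤ _ := by linarith

end Pathwise

/-! ### Loops of a path -/

section Paths

variable {X : Type*}

/-- The paths that agree with `ρ` up to time `n`. -/
def prefixSet (ρ : ℕ → X) (n : ℕ) : Set (ℕ → X) := {ω | ∀ i ≤ n, ω i = ρ i}

theorem mem_prefixSet {ρ ω : ℕ → X} {n : ℕ} : ω ∈ prefixSet ρ n ↔ ∀ i ≤ n, ω i = ρ i := Iff.rfl

theorem prefixSet_succ (ρ : ℕ → X) (n : ℕ) :
    prefixSet ρ (n + 1) = prefixSet ρ n ∩ {ω | ω (n + 1) = ρ (n + 1)} := by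
  ext ω
  simp only [Set.mem_inter_iff, mem_prefixSet, Set.mem_ofPred_eq, Nat.le_succ_iff]
  constructor
  · exact fun h => ⟨fun i hi => h i (Or.inl hi), h _ (Or.inr rfl)⟩
  · rintro ⟨h1, h2⟩ i (hi | rfl)
    exacts [h1 i hi, h2]

theorem measurableSet_prefixSet [MeasurableSpace X] [MeasurableSingletonClass X] (ρ : ℕ → X)
    (n : ℕ) : MeasurableSet (prefixSet ρ n) := by
  have : prefixSet ρ n = ⋂ i ∈ Finset.Iic n, (fun ω : ℕ → X => ω i) ⁻¹' {ρ i} := by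
    ext ω; simp [mem_prefixSet]
  rw [this]
  exact Finset.measurableSet_biInter _ fun i _ => measurable_pi_apply i (measurableSet_singleton _)

/-- The path visits the states of `l` at the times `1, 2, …` and then returns to `z`. -/
def IsLoop (z : X) (l : List {y : X // y ≠ z}) (ω : ℕ → X) : Prop :=
  ∀ i ≤ l.length + 1, ω i = loopPath z (ω 0) l i

theorem isLoop_cons {z : X} {y : {y : X // y ≠ z}} {l : List {y : X // y ≠ z}} {ω : ℕ → X}
    (h : IsLoop z (y :: l) ω) : ω 1 = y ∧ IsLoop z l fun i => ω (i + 1) := by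
  have h1 : ω 1 = y := by simpa using h 1 (by simp)
  refine ⟨h1, fun i hi => ?_⟩
  have := h (i + 1) (by simpa using hi)
  simpa [h1] using this

theorem IsLoop.unique {z : X} {l l' : List {y : X // y ≠ z}} {ω : ℕ → X} (h : IsLoop z l ω)
    (h' : IsLoop z l' ω) : l = l' := by
  have hnil : ∀ {ω : ℕ → X}, IsLoop z [] ω → ω 1 = z := fun h => by simpa using h 1 le_rfl
  induction l generalizing l' ω with
  | nil =>
    cases l' with
    | nil => rfl
    | cons y l' => exact absurd ((isLoop_cons h').1.symm.trans (hnil h)) y.2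
  | cons y l ih =>
    cases l' with
    | nil => exact absurd ((isLoop_cons h).1.symm.trans (hnil h')) y.2
    | cons y' l' =>
      have h1 : y = y' := Subtype.ext ((isLoop_cons h).1.symm.trans (isLoop_cons h').1)
      rw [h1, ih (isLoop_cons h).2 (isLoop_cons h').2]

theorem IsLoop.end {z : X} {l : List {y : X // y ≠ z}} {ω : ℕ → X} (h : IsLoop z l ω) :
    ω (l.length + 1) = z := by
  rw [h _ le_rfl, loopPath_eq_of_length_lt _ _ _ _ (Nat.lt_succ_self _)]

theorem IsLoop.ne {z : X} {l : List {y : X // y ≠ z}} {ω : ℕ → X} (h : IsLoop z l ω) {i : ℕ}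
    (h0 : 0 < i) (hi : i ≤ l.length) : ω i ≠ z := by
  rw [h i (by omega)]
  exact loopPath_ne _ _ _ _ h0 hi

theorem measurableSet_isLoop [Countable X] [MeasurableSpace X] [DiscreteMeasurableSpace X] (z : X)
    (l : List {y : X // y ≠ z}) (t : ℕ) :
    MeasurableSet {ω : ℕ → X | IsLoop z l fun i => ω (t + i)} := by
  have : {ω : ℕ → X | IsLoop z l fun i => ω (t + i)} = ⋂ i ∈ Finset.Iic (l.length + 1),
      (fun ω : ℕ → X => (ω (t + i), ω t)) ⁻¹' {q | q.1 = loopPath z q.2 l i} := by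
    ext ω; simp [IsLoop]
  rw [this]
  exact Finset.measurableSet_biInter _ fun i _ =>
    ((measurable_pi_apply _).prodMk (measurable_pi_apply _)) (.of_discrete)

/-- If, given the event `A`, the loops that start at time `t` have a probability mass function,
then almost surely on `A` the path performs a loop. -/
theorem ae_exists_isLoop [Countable X] [MeasurableSpace X] [DiscreteMeasurableSpace X] {z : X}
    {ν : Measure (ℕ → X)} [IsFiniteMeasure ν] {A : Set (ℕ → X)} (hA : MeasurableSet A) {t : ℕ}
    {q : List {y : X // y ≠ z} → ℝ}
    (h : ∀ l, ν.real (A ∩ {ω | IsLoop z l fun i => ω (t + i)}) = ν.real A * q l)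
    (hq : HasSum q 1) : ∀ᵐ ω ∂ν, ω ∈ A → ∃ l, IsLoop z l fun i => ω (t + i) := by
  have hm := fun l => hA.inter (measurableSet_isLoop (X := X) z l t)
  have hd : Pairwise (Function.onFun Disjoint
      fun l => A ∩ {ω : ℕ → X | IsLoop z l fun i => ω (t + i)}) := fun l l' hl => by
    refine Set.disjoint_left.2 fun ω h1 h2 => hl (h1.2.unique h2.2)
  have h1 : ν.real (⋃ l, A ∩ {ω : ℕ → X | IsLoop z l fun i => ω (t + i)}) = ν.real A := by
    rw [measureReal_def, measure_iUnion hd hm, ENNReal.tsum_toReal_eq fun l => measure_ne_top _ _]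
    simp only [← measureReal_def, h]
    rw [tsum_mul_left, hq.tsum_eq, mul_one]
  have h2 : ν (A \ ⋃ l, A ∩ {ω : ℕ → X | IsLoop z l fun i => ω (t + i)}) = 0 := by
    have hsub : (⋃ l, A ∩ {ω : ℕ → X | IsLoop z l fun i => ω (t + i)}) ⊆ A :=
      Set.iUnion_subset fun l => Set.inter_subset_left
    have := measureReal_sdiff (μ := ν) hsub (MeasurableSet.iUnion hm)
    rw [h1, sub_self] at this
    exact (measureReal_eq_zero_iff (measure_ne_top _ _)).1 this
  filter_upwards [measure_eq_zero_iff_ae_notMem.1 h2] with ω hω hωA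
  by_contra! hcon
  exact hω ⟨hωA, fun hmem => by
    obtain ⟨l, hl⟩ := Set.mem_iUnion.1 hmem
    exact hcon l hl.2⟩

/-- Chaining the one-step probabilities along a path. -/
theorem measureReal_prefixSet_add [MeasurableSpace X] {ν : Measure (ℕ → X)}
    {Q : Matrix X X ℝ} {ρ : ℕ → X} {t k : ℕ}
    (h : ∀ i < k, ν.real (prefixSet ρ (t + i + 1))
      = ν.real (prefixSet ρ (t + i)) * Q (ρ (t + i)) (ρ (t + i + 1))) :
    ν.real (prefixSet ρ (t + k))
      = ν.real (prefixSet ρ t) * ∏ i ∈ Finset.range k, Q (ρ (t + i)) (ρ (t + i + 1)) := by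
  induction k with
  | zero => simp
  | succ k ih =>
    rw [Finset.prod_range_succ, ← mul_assoc, ← ih fun i hi => h i (by omega), ← add_assoc,
      h k (Nat.lt_succ_self k)]

end Paths

/-! ### The law of the chain -/

section Law

variable {l : ℕ} {X : Type*} [Fintype X] (S : Model l X)

theorem Model.isStochastic (θ : Param l) : IsStochastic (S.P θ) := ⟨S.P_nonneg θ, S.P_sum θ⟩

variable [MeasurableSpace X] [DiscreteMeasurableSpace X]

instance (θ : Param l) (x : X) : IsProbabilityMeasure (S.law θ x) := by
  unfold Model.law
  infer_instance

/-- The Markov property at time `n`. -/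
theorem integral_law_succ (θ : Param l) (x : X) (n : ℕ)
    (f : (Π _ : Finset.Iic n, X) → X → ℝ) :
    ∫ ω, f (Preorder.frestrictLe n ω) (ω (n + 1)) ∂S.law θ x
      = ∫ ω, ∑ y, S.P θ (ω n) y * f (Preorder.frestrictLe n ω) y ∂S.law θ x := by
  classical
  have h := Kernel.partialTraj_compProd_eq_map_traj (X := fun _ => X) (κ := S.step θ)
    (Nat.zero_le n) (x₀ := fun _ => x)
  have h0 := Kernel.traj_map_frestrictLe_apply (X := fun _ => X) (κ := S.step θ) 0 n fun _ => x
  have hm : Measurable (Function.uncurry f) := .of_discrete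
  have hm2 : Measurable fun ω : ℕ → X =>
      (Preorder.frestrictLe (π := fun _ => X) n ω, ω (n + 1)) := by
    fun_prop
  have h1 : ∫ ω, f (Preorder.frestrictLe n ω) (ω (n + 1)) ∂S.law θ x
      = ∫ q, Function.uncurry f q ∂((S.law θ x).map
        fun ω => (Preorder.frestrictLe (π := fun _ => X) n ω, ω (n + 1))) := by
    rw [integral_map hm2.aemeasurable hm.aestronglyMeasurable]
    rfl
  rw [h1, Model.law, ← h, Measure.integral_compProd .of_finite, ← h0, integral_map
    (by fun_prop) (Measurable.of_discrete.aestronglyMeasurable)]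
  refine integral_congr_ae (ae_of_all _ fun ω => ?_)
  change ∫ y, f (Preorder.frestrictLe n ω) y ∂(S.row θ (ω n)).toMeasure = _
  rw [PMF.integral_eq_sum]
  refine Finset.sum_congr rfl fun y _ => ?_
  rw [Model.row, PMF.ofFintype_apply, ENNReal.toReal_ofReal (S.P_nonneg θ _ _), smul_eq_mul]

theorem ae_law_zero (θ : Param l) (x : X) : ∀ᵐ ω ∂S.law θ x, ω 0 = x := by
  have h0 := Kernel.traj_map_frestrictLe_apply (X := fun _ => X) (κ := S.step θ) 0 0 fun _ => x
  rw [Kernel.partialTraj_self, Kernel.id_apply] at h0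
  have h1 : ∀ᵐ u ∂((S.law θ x).map (Preorder.frestrictLe (π := fun _ => X) 0)),
      u = fun _ => x := by
    rw [Model.law, h0]
    exact (ae_dirac_iff (Set.Finite.measurableSet (Set.toFinite _))).2 rfl
  filter_upwards [ae_of_ae_map (by fun_prop) h1] with ω hω
  exact congrFun hω ⟨0, by simp⟩

theorem law_prefixSet_succ (θ : Param l) (x : X) (ρ : ℕ → X) (n : ℕ) :
    (S.law θ x).real (prefixSet ρ (n + 1))
      = (S.law θ x).real (prefixSet ρ n) * S.P θ (ρ n) (ρ (n + 1)) := by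
  classical
  have h := integral_law_succ S θ x n fun u y =>
    (if u = Preorder.frestrictLe (π := fun _ => X) n ρ then 1 else 0)
      * (if y = ρ (n + 1) then 1 else 0)
  have hiff : ∀ ω : ℕ → X, Preorder.frestrictLe (π := fun _ => X) n ω
      = Preorder.frestrictLe (π := fun _ => X) n ρ ↔ ω ∈ prefixSet ρ n := fun ω => by
    constructor
    · intro h i hi
      exact congrFun h ⟨i, Finset.mem_Iic.2 hi⟩
    · intro h
      funext i
      exact h i (Finset.mem_Iic.1 i.2)
  have e1 : ∀ ω : ℕ → X, (if Preorder.frestrictLe (π := fun _ => X) n ω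
      = Preorder.frestrictLe (π := fun _ => X) n ρ then (1 : ℝ) else 0)
      * (if ω (n + 1) = ρ (n + 1) then 1 else 0)
      = (prefixSet ρ (n + 1)).indicator (fun _ => 1) ω := fun ω => by
    rw [prefixSet_succ, ← Set.indicator_indicator]
    by_cases h1 : ω ∈ prefixSet ρ n
    · simp [hiff, h1, Set.indicator]
    · simp [hiff, h1]
  have e2 : ∀ ω : ℕ → X, (∑ y, S.P θ (ω n) y * ((if Preorder.frestrictLe (π := fun _ => X) n ω
      = Preorder.frestrictLe (π := fun _ => X) n ρ then (1 : ℝ) else 0)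
      * (if y = ρ (n + 1) then 1 else 0)))
      = (prefixSet ρ n).indicator (fun _ => S.P θ (ρ n) (ρ (n + 1))) ω := fun ω => by
    by_cases h1 : ω ∈ prefixSet ρ n
    · simp [hiff, h1, h1 n le_rfl]
    · simp [hiff, h1]
  simp only [e1, e2] at h
  rw [integral_indicator_const _ (measurableSet_prefixSet _ _),
    integral_indicator_const _ (measurableSet_prefixSet _ _)] at h
  simpa using h

theorem law_isLoop [DecidableEq X] (θ : Param l) (x z : X) (w : List {y : X // y ≠ z}) :
    (S.law θ x).real {ω | IsLoop z w ω} = loopProb z (S.P θ) x w := by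
  have h := measureReal_prefixSet_add (ν := S.law θ x) (Q := S.P θ) (ρ := loopPath z x w) (t := 0)
    (k := w.length + 1) fun i _ => law_prefixSet_succ S θ x _ _
  have h0 : (S.law θ x).real (prefixSet (loopPath z x w) 0) = 1 := by
    rw [← probReal_univ (μ := S.law θ x)]
    refine measureReal_congr ?_
    filter_upwards [ae_law_zero S θ x] with ω hω
    refine propext ⟨fun _ => trivial, fun _ i hi => ?_⟩
    obtain rfl : i = 0 := by omega
    simpa using hω
  rw [h0, one_mul] at h
  simp only [zero_add] at h
  rw [loopProb, ← h]
  refine measureReal_congr ?_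
  filter_upwards [ae_law_zero S θ x] with ω hω
  refine propext ?_
  change IsLoop z w ω ↔ ω ∈ prefixSet _ _
  rw [IsLoop, hω]
  rfl

/-- Expectation of a functional that is a function of the first loop. -/
theorem integral_law_loop [DecidableEq X] (θ : Param l) {z : X} (x : X)
    (hsum : HasSum (loopProb z (S.P θ) x) 1) {f : (ℕ → X) → ℝ} {φ : List {y : X // y ≠ z} → ℝ}
    (hf : ∀ ω w, ω 0 = x → IsLoop z w ω → f ω = φ w)
    (hφ : Summable fun w => loopProb z (S.P θ) x w * |φ w|) :
    ∫ ω, f ω ∂S.law θ x = ∑' w, loopProb z (S.P θ) x w * φ w := by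
  have hae : ∀ᵐ ω ∂S.law θ x, ∃ w, IsLoop z w ω := by
    have := ae_exists_isLoop (ν := S.law θ x) (A := Set.univ) (t := 0) (z := z)
      (q := loopProb z (S.P θ) x) .univ (fun w => by simpa using law_isLoop S θ x z w) hsum
    filter_upwards [this] with ω hω
    simpa using hω trivial
  have hm : ∀ w, MeasurableSet {ω : ℕ → X | IsLoop z w ω} := fun w => by
    simpa using measurableSet_isLoop (X := X) z w 0
  have hd : Pairwise (Function.onFun Disjoint fun w => {ω : ℕ → X | IsLoop z w ω}) :=
    fun l l' hl => Set.disjoint_left.2 fun ω h1 h2 => hl (h1.unique h2)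
  have hconst : ∀ w, Set.EqOn f (fun _ => φ w) ({ω : ℕ → X | IsLoop z w ω} ∩ {ω | ω 0 = x}) :=
    fun w ω hω => hf ω w hω.2 hω.1
  have hint : ∀ w, f =ᵐ[(S.law θ x).restrict {ω : ℕ → X | IsLoop z w ω}] fun _ => φ w := fun w => by
    filter_upwards [ae_restrict_mem (hm w), ae_restrict_of_ae (ae_law_zero S θ x)] with ω h1 h2
    exact hf ω w h2 h1
  have hU : (⋃ w, {ω : ℕ → X | IsLoop z w ω}) =ᵐ[S.law θ x] Set.univ := by
    filter_upwards [hae] with ω hω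
    exact propext ⟨fun _ => trivial, fun _ => Set.mem_iUnion.2 hω⟩
  have hval : ∀ w, ∫ ω in {ω : ℕ → X | IsLoop z w ω}, f ω ∂S.law θ x
      = loopProb z (S.P θ) x w * φ w := fun w => by
    rw [integral_congr_ae (hint w), integral_const, measureReal_restrict_apply_univ, law_isLoop,
      smul_eq_mul]
  have hi : IntegrableOn f (⋃ w, {ω : ℕ → X | IsLoop z w ω}) (S.law θ x) := by
    refine integrableOn_iUnion_of_summable_integral_norm
      (fun w => (integrableOn_const (measure_ne_top _ _)).congr (hint w).symm) ?_
    refine hφ.congr fun w => ?_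
    have : (fun ω => ‖f ω‖) =ᵐ[(S.law θ x).restrict {ω : ℕ → X | IsLoop z w ω}]
        fun _ => |φ w| := by
      filter_upwards [hint w] with ω hω
      rw [hω]; rfl
    rw [integral_congr_ae this, integral_const, measureReal_restrict_apply_univ, law_isLoop,
      smul_eq_mul]
  rw [← setIntegral_univ, ← setIntegral_congr_set hU, integral_iUnion hm hd hi]
  exact tsum_congr hval

/-- The exponential growth rate of multiplicative functionals is the logarithm of the Perron
eigenvalue. -/
theorem tendsto_finiteCost (θ : Param l) (x : X) {Λ : ℝ} {v : X → ℝ} (hv : ∀ x, 0 < v x)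
    (heig : ∀ x, ∑ y, Real.exp (S.α * S.C θ x) * S.P θ x y * v y = Real.exp Λ * v x) :
    Tendsto (S.finiteCost θ x) atTop (𝓝 Λ) := by
  classical
  set e : ℕ → (ℕ → X) → ℝ := fun n ω => Real.exp (S.α * ∑ i ∈ Finset.range n, S.C θ (ω i)) with he
  have hem : ∀ n, Measurable (e n) := fun n => by
    have : ∀ i, Measurable fun ω : ℕ → X => S.C θ (ω i) := fun i =>
      (Measurable.of_discrete (f := S.C θ)).comp (measurable_pi_apply i)
    simp only [he]
    fun_prop
  obtain ⟨K, hK⟩ : ∃ K, ∀ x, |S.C θ x| ≤ K := by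
    obtain ⟨K, hK⟩ := (Set.finite_range fun x => |S.C θ x|).bddAbove
    exact ⟨K, fun x => hK ⟨x, rfl⟩⟩
  have heb : ∀ n ω, e n ω ≤ Real.exp (S.α * (n * K)) := fun n ω => by
    refine Real.exp_le_exp.2 (mul_le_mul_of_nonneg_left ?_ S.α_pos.le)
    refine (Finset.sum_le_sum fun i _ => (le_abs_self _).trans (hK (ω i))).trans ?_
    simp
  obtain ⟨a, ha, hav⟩ : ∃ a, 0 < a ∧ ∀ x, a ≤ v x := by
    have : Nonempty X := ⟨x⟩
    obtain ⟨y, hy⟩ := Finite.exists_min v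
    exact ⟨v y, hv y, hy⟩
  obtain ⟨b, hb⟩ : ∃ b, ∀ x, v x ≤ b := by
    obtain ⟨b, hb⟩ := (Set.finite_range v).bddAbove
    exact ⟨b, fun x => hb ⟨x, rfl⟩⟩
  have hb0 : 0 < b := (hv x).trans_le (hb x)
  have hei : ∀ n, Integrable (e n) (S.law θ x) := fun n =>
    Integrable.of_bound (hem n).aestronglyMeasurable (Real.exp (S.α * (n * K)))
      (ae_of_all _ fun ω => by
        rw [Real.norm_of_nonneg (Real.exp_pos _).le]; exact heb n ω)
  have hevm : ∀ n, Measurable fun ω : ℕ → X => v (ω n) := fun n =>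
    (Measurable.of_discrete (f := v)).comp (measurable_pi_apply n)
  have hevi : ∀ n, Integrable (fun ω => e n ω * v (ω n)) (S.law θ x) := fun n =>
    (hei n).mul_bdd (c := b) (hevm n).aestronglyMeasurable
      (ae_of_all _ fun ω => by rw [Real.norm_of_nonneg (hv _).le]; exact hb _)
  -- the eigenvector turns the functional into an exponential
  have hI : ∀ n, ∫ ω, e n ω * v (ω n) ∂S.law θ x = Real.exp (n * Λ) * v x := by
    intro n
    induction n with
    | zero =>
      have : (fun ω => e 0 ω * v (ω 0)) =ᵐ[S.law θ x] fun _ => v x := by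
        filter_upwards [ae_law_zero S θ x] with ω hω
        simp [he, hω]
      rw [integral_congr_ae this]
      simp
    | succ n ih =>
      have h := integral_law_succ S θ x n fun u y =>
        Real.exp (S.α * ∑ i ∈ (Finset.range (n + 1)).attach, S.C θ (u ⟨i.1, Finset.mem_Iic.2
          (Nat.lt_succ_iff.1 (Finset.mem_range.1 i.2))⟩)) * v y
      have e1 : ∀ ω : ℕ → X, ∑ i ∈ (Finset.range (n + 1)).attach,
          S.C θ (Preorder.frestrictLe (π := fun _ => X) n ω ⟨i.1, Finset.mem_Iic.2
          (Nat.lt_succ_iff.1 (Finset.mem_range.1 i.2))⟩)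
          = ∑ i ∈ Finset.range (n + 1), S.C θ (ω i) := fun ω =>
        Finset.sum_attach (Finset.range (n + 1)) fun i => S.C θ (ω i)
      simp only [e1] at h
      change ∫ ω, e (n + 1) ω * v (ω (n + 1)) ∂S.law θ x = _ at h
      rw [h]
      have e2 : ∀ ω : ℕ → X, ∑ y, S.P θ (ω n) y *
          (Real.exp (S.α * ∑ i ∈ Finset.range (n + 1), S.C θ (ω i)) * v y)
          = Real.exp Λ * (e n ω * v (ω n)) := fun ω => by
        have e3 : Real.exp (S.α * ∑ i ∈ Finset.range (n + 1), S.C θ (ω i))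
            = e n ω * Real.exp (S.α * S.C θ (ω n)) := by
          rw [Finset.sum_range_succ, mul_add, Real.exp_add]
        rw [e3]
        have := heig (ω n)
        calc _ = e n ω * ∑ y, Real.exp (S.α * S.C θ (ω n)) * S.P θ (ω n) y * v y := by
              rw [Finset.mul_sum]
              exact Finset.sum_congr rfl fun y _ => by ring
          _ = _ := by rw [this]; ring
      simp only [e2]
      rw [integral_const_mul, ih, ← mul_assoc, ← Real.exp_add]
      congr 2
      push_cast; ring
  have hlow : ∀ n : ℕ, Real.exp (n * Λ) * (v x / b) ≤ ∫ ω, e n ω ∂S.law θ x := fun n => by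
    rw [← mul_div_assoc, div_le_iff₀ hb0, ← hI n, ← integral_mul_const]
    exact integral_mono (hevi n) ((hei n).mul_const b) fun ω =>
      mul_le_mul_of_nonneg_left (hb _) (Real.exp_pos _).le
  have hup : ∀ n : ℕ, ∫ ω, e n ω ∂S.law θ x ≤ Real.exp (n * Λ) * (v x / a) := fun n => by
    rw [← mul_div_assoc, le_div_iff₀ ha, ← hI n, ← integral_mul_const]
    exact integral_mono ((hei n).mul_const a) (hevi n) fun ω =>
      mul_le_mul_of_nonneg_left (hav _) (Real.exp_pos _).le
  have hvb : 0 < v x / b := div_pos (hv x) hb0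
  have hva : 0 < v x / a := div_pos (hv x) ha
  have hlim : ∀ s : ℝ, Tendsto (fun n : ℕ => Λ + s * (1 / (n : ℝ))) atTop (𝓝 Λ) := fun s => by
    simpa using (tendsto_one_div_atTop_nhds_zero_nat.const_mul s).const_add Λ
  refine tendsto_of_tendsto_of_tendsto_of_le_of_le' (hlim (Real.log (v x / b)))
    (hlim (Real.log (v x / a))) ?_ ?_
  · filter_upwards [eventually_gt_atTop 0] with n hn
    have hn' : (0 : ℝ) < n := by exact_mod_cast hn
    have h1 := Real.log_le_log (by positivity) (hlow n)
    rw [Real.log_mul (Real.exp_pos _).ne' hvb.ne', Real.log_exp] at h1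
    unfold Model.finiteCost
    calc _ = 1 / (n : ℝ) * (n * Λ + Real.log (v x / b)) := by field_simp
      _ ≤ _ := mul_le_mul_of_nonneg_left h1 (by positivity)
  · filter_upwards [eventually_gt_atTop 0] with n hn
    have hn' : (0 : ℝ) < n := by exact_mod_cast hn
    have h0 : 0 < ∫ ω, e n ω ∂S.law θ x :=
      (mul_pos (Real.exp_pos _) hvb).trans_le (hlow n)
    have h1 := Real.log_le_log h0 (hup n)
    rw [Real.log_mul (Real.exp_pos _).ne' hva.ne', Real.log_exp] at h1
    unfold Model.finiteCost
    calc _ ≤ 1 / (n : ℝ) * (n * Λ + Real.log (v x / a)) :=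
          mul_le_mul_of_nonneg_left h1 (by positivity)
      _ = _ := by field_simp

end Law

/-! ### The loops of the model -/

/-- Finitely many properties that hold from some constant on hold with a common constant. -/
theorem exists_forall_bound {ι : Type*} [Finite ι] {p : ι → ℝ → Prop}
    (hmono : ∀ i a b, a ≤ b → p i a → p i b) (h : ∀ i, ∃ a, p i a) :
    ∃ a, 1 ≤ a ∧ ∀ i, p i a := by
  choose a ha using h
  obtain ⟨b, hb⟩ := (Set.finite_range a).bddAbove
  exact ⟨max 1 b, le_max_left _ _, fun i =>
    hmono i _ _ ((hb ⟨i, rfl⟩).trans (le_max_right _ _)) (ha i)⟩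

section Smooth

variable {l : ℕ}

theorem Model.BoundedC2.exists_taylor {u : Param l → ℝ} (hu : Model.BoundedC2 u) :
    ∃ B, ∀ θ v, |u θ| ≤ B ∧ ‖gradient u θ‖ ≤ B ∧ |u (θ + v) - u θ| ≤ B * ‖v‖ ∧
      |u (θ + v) - u θ - inner ℝ (gradient u θ) v| ≤ B * ‖v‖ ^ 2 := by
  obtain ⟨h1, h2, B, hB⟩ := hu
  have hgrad : ∀ θ v, inner ℝ (gradient u θ) v = fderiv ℝ u θ v := fun θ v => by
    rw [gradient, InnerProductSpace.toDual_symm_apply]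
  have hB0 : 0 ≤ B := (abs_nonneg _).trans (hB 0).1
  have hlip : ∀ x y, ‖fderiv ℝ u y - fderiv ℝ u x‖ ≤ B * ‖y - x‖ := fun x y =>
    convex_univ.norm_image_sub_le_of_norm_fderiv_le (𝕜 := ℝ) (fun z _ => h2 z)
      (fun z _ => (hB z).2.2) (Set.mem_univ _) (Set.mem_univ _)
  refine ⟨B, fun θ v => ⟨(hB θ).1, ?_, ?_, ?_⟩⟩
  · rw [gradient, LinearIsometryEquiv.norm_map]
    exact (hB θ).2.1
  · have := convex_univ.norm_image_sub_le_of_norm_fderiv_le (𝕜 := ℝ) (f := u) (fun z _ => h1 z)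
      (fun z _ => (hB z).2.1) (Set.mem_univ θ) (Set.mem_univ (θ + v))
    simpa using this
  · rw [hgrad]
    have := (convex_closedBall θ ‖v‖).norm_image_sub_le_of_norm_fderiv_le' (𝕜 := ℝ) (f := u)
      (φ := fderiv ℝ u θ) (C := B * ‖v‖) (fun z _ => h1 z) (fun z hz => (hlip θ z).trans (by
        gcongr; rwa [← mem_closedBall_iff_norm])) (Metric.mem_closedBall_self (norm_nonneg v))
      (y := θ + v) (by simp)
    rw [add_sub_cancel_left, Real.norm_eq_abs] at this
    rwa [sq, ← mul_assoc]

end Smooth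

section LoopFamilyOf

variable {l : ℕ} {X : Type*} [Fintype X]

/-- The relations between a family of loops and the model that it comes from. -/
structure IsLoopFamilyOf (S : Model l X)
    (𝓛 : LoopFamily (Param l) (List {x : X // x ≠ S.xstar})) : Prop where
  n_eq : ∀ w, 𝓛.n w = w.length + 1
  p_eq : ∀ w θ, 𝓛.p w θ = loopProb S.xstar (S.P θ) S.xstar w
  c_eq : ∀ w θ, 𝓛.c w θ
    = ∑ i ∈ Finset.range (w.length + 1), S.α * S.C θ (loopPath S.xstar S.xstar w i)
  score_eq : ∀ w θ, 𝓛.score w θ = ∑ i ∈ Finset.range (w.length + 1),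
    S.L θ (loopPath S.xstar S.xstar w i) (loopPath S.xstar S.xstar w (i + 1))
  hasSum_loopProb : ∀ θ x, HasSum (loopProb S.xstar (S.P θ) x) 1

variable [DecidableEq X] (S : Model l X)

/-- The assumptions on the model provide all the uniform bounds of a family of loops. -/
theorem exists_loopFamily (h_erg : S.Ergodic) (h_smooth : S.Smooth) (h_ratio : S.LikelihoodRatio)
    [MeasurableSpace X] [DiscreteMeasurableSpace X] :
    ∃ 𝓛 : LoopFamily (Param l) (List {x : X // x ≠ S.xstar}), IsLoopFamilyOf S 𝓛 ∧
      ∀ θ x, Tendsto (S.finiteCost θ x) atTop (𝓝 (𝓛.risk θ)) := by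
  obtain ⟨N, hN, δ, hδ, hreach⟩ := exists_uniform_reaches (P := S.P) S.isStochastic
    fun Q hQ => (h_erg Q hQ).1
  have hN' : (0 : ℝ) < N := by exact_mod_cast hN
  obtain ⟨BC, hBC1, hBC⟩ := exists_forall_bound (ι := X)
    (p := fun x B => ∀ θ v, |S.C θ x| ≤ B ∧ ‖gradient (fun ϑ => S.C ϑ x) θ‖ ≤ B ∧
      |S.C (θ + v) x - S.C θ x| ≤ B * ‖v‖ ∧
      |S.C (θ + v) x - S.C θ x - inner ℝ (gradient (fun ϑ => S.C ϑ x) θ) v| ≤ B * ‖v‖ ^ 2)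
    (fun x a b hab h θ v => ⟨(h θ v).1.trans hab, (h θ v).2.1.trans hab,
      (h θ v).2.2.1.trans (by gcongr), (h θ v).2.2.2.trans (by gcongr)⟩)
    fun x => (h_smooth.2 x).exists_taylor
  obtain ⟨BP, hBP1, hBP⟩ := exists_forall_bound (ι := X × X)
    (p := fun q B => 1 ≤ B ∧ ∀ θ, ‖S.L θ q.1 q.2‖ ≤ B ∧
      ‖fderiv ℝ (fderiv ℝ fun ϑ => S.P ϑ q.1 q.2) θ‖ ≤ B * S.P θ q.1 q.2)
    (fun q a b hab h => ⟨h.1.trans hab, fun θ => ⟨(h.2 θ).1.trans hab,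
      (h.2 θ).2.trans (mul_le_mul_of_nonneg_right hab (S.P_nonneg _ _ _))⟩⟩)
    fun q => by
      obtain ⟨⟨B, hB⟩, -, L₂, ⟨B₂, hB₂⟩, h⟩ := h_ratio q.1 q.2
      refine ⟨max 1 (max B B₂), le_max_left _ _, fun θ =>
        ⟨(hB θ).trans ((le_max_left _ _).trans (le_max_right _ _)), ?_⟩⟩
      rw [h θ]
      refine (ContinuousLinearMap.opNorm_smul_le _ _).trans ?_
      rw [Real.norm_of_nonneg (S.P_nonneg _ _ _), mul_comm]
      exact mul_le_mul_of_nonneg_right ((hB₂ θ).trans ((le_max_right _ _).trans (le_max_right _ _)))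
        (S.P_nonneg _ _ _)
  have hα := S.α_pos
  set K := S.α * BC with hK
  have hK0 : 0 ≤ K := by positivity
  have hCK : ∀ θ x, |S.α * S.C θ x| ≤ K := fun θ x => by
    rw [abs_mul, abs_of_pos hα]
    exact mul_le_mul_of_nonneg_left (hBC x θ 0).1 hα.le
  have htilt := fun θ => exists_tilt hN hδ hK0 (S.isStochastic θ) (hreach θ)
    (c := fun x => S.α * S.C θ x) (hCK θ) S.xstar
  choose risk habs v hv heig hrisk hmom using htilt
  have hratio0 : 0 < tiltRatio K N δ := by unfold tiltRatio; positivity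
  set δ' := tiltRatio K N δ ^ N * δ with hδ'
  have hδ'0 : 0 < δ' := by positivity
  set A := max BP K with hA
  have hAP : BP ≤ A := le_max_left _ _
  have hAK : K ≤ A := le_max_right _ _
  have hA1 : 1 ≤ A := hBP1.trans hAP
  have hPT : ∀ x y, ExpTaylor A (fun θ => S.P θ x y)
      fun θ v => S.P θ x y * inner ℝ (S.L θ x y) v := fun x y => by
    obtain ⟨hd, hd2, -⟩ := h_smooth.1 x y
    have hgr : ∀ θ w, fderiv ℝ (fun ϑ => S.P ϑ x y) θ w = S.P θ x y * inner ℝ (S.L θ x y) w :=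
      fun θ w => by
        have := (h_ratio x y).2.1 θ
        rw [← InnerProductSpace.toDual_symm_apply (𝕜 := ℝ) (y := fderiv ℝ _ θ)]
        change inner ℝ (gradient _ θ) w = _
        rw [this, real_inner_smul_left]
    have h := ExpTaylor.of_fderiv (k := A) (by linarith) (fun θ => S.P_nonneg θ x y) hd hd2
      (fun θ => by
        have h1 : ‖fderiv ℝ (fun ϑ => S.P ϑ x y) θ‖ = ‖gradient (fun ϑ => S.P ϑ x y) θ‖ := by
          rw [gradient, LinearIsometryEquiv.norm_map]
        rw [h1, (h_ratio x y).2.1 θ, norm_smul, Real.norm_of_nonneg (S.P_nonneg _ _ _), mul_comm]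
        exact mul_le_mul_of_nonneg_right (((hBP (x, y)).2 θ).1.trans hAP) (S.P_nonneg _ _ _))
      (fun θ => ((hBP (x, y)).2 θ).2.trans (mul_le_mul_of_nonneg_right
        (hAP.trans (le_self_pow₀ hA1 two_ne_zero)) (S.P_nonneg _ _ _)))
    simpa only [hgr] using h
  have hsumle : ∀ (w : List {x : X // x ≠ S.xstar}) {f : ℕ → ℝ} {b : ℝ}, (∀ i, f i ≤ b) →
      ∑ i ∈ Finset.range (w.length + 1), f i ≤ b * ((w.length + 1 : ℕ) : ℝ) := fun w f b h => by
    refine (Finset.sum_le_sum fun i _ => h i).trans (le_of_eq ?_)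
    rw [Finset.sum_const, Finset.card_range, nsmul_eq_mul, mul_comm]
  have hlogsum : ∀ (w : List {x : X // x ≠ S.xstar}) θ,
      (∑ i ∈ Finset.range (w.length + 1), (S.α * S.C θ (loopPath S.xstar S.xstar w i) - risk θ))
      = ∑ i ∈ Finset.range (w.length + 1), S.α * S.C θ (loopPath S.xstar S.xstar w i)
        - ((w.length + 1 : ℕ) : ℝ) * risk θ := fun w θ => by
    rw [Finset.sum_sub_distrib, Finset.sum_const, Finset.card_range, nsmul_eq_mul]
  refine ⟨{
    n := fun w => w.length + 1
    p := fun w θ => loopProb S.xstar (S.P θ) S.xstar w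
    c := fun w θ => ∑ i ∈ Finset.range (w.length + 1), S.α * S.C θ (loopPath S.xstar S.xstar w i)
    score := fun w θ => ∑ i ∈ Finset.range (w.length + 1),
      S.L θ (loopPath S.xstar S.xstar w i) (loopPath S.xstar S.xstar w (i + 1))
    dc := fun w θ => ∑ i ∈ Finset.range (w.length + 1),
      S.α • gradient (fun ϑ => S.C ϑ (loopPath S.xstar S.xstar w i)) θ
    risk := risk
    A := A
    K := K
    κ := min (δ / (2 * N)) (δ' / (2 * N))
    B := max (returnBound N δ) (returnBound N δ')
    n_pos := fun w => Nat.succ_pos _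
    one_le_A := hA1
    K_nonneg := hK0
    κ_pos := lt_min (by positivity) (by positivity)
    p_taylor := fun w => ?_
    norm_score := fun w θ => (norm_sum_le _ _).trans (hsumle w fun i =>
      ((hBP (_, _)).2 θ).1.trans hAP)
    abs_c := fun w θ => (Finset.abs_sum_le_sum_abs _ _).trans (hsumle w fun i => hCK θ _)
    c_lip := fun w θ u => ?_
    c_taylor := fun w θ u => ?_
    norm_dc := fun w θ => (norm_sum_le _ _).trans (hsumle w fun i => ?_)
    hasSum_p := fun θ => hasSum_loopProb (S.isStochastic θ) hN hδ (hreach θ _) _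
    p_moment := fun θ s => ?_
    abs_risk := habs
    hasSum_risk := fun θ => by simpa only [hlogsum] using hrisk θ
    risk_moment := fun θ s => ?_ }, ⟨fun _ => rfl, fun _ _ => rfl, fun _ _ => rfl, fun _ _ => rfl,
      fun θ x => hasSum_loopProb (S.isStochastic θ) hN hδ (hreach θ _) x⟩,
    fun θ x => tendsto_finiteCost S θ x (hv θ) (heig θ)⟩
  · have := ExpTaylor.prod (k := A) (φ := fun i θ => S.P θ (loopPath S.xstar S.xstar w i)
      (loopPath S.xstar S.xstar w (i + 1))) (s := fun i θ u => inner ℝ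
      (S.L θ (loopPath S.xstar S.xstar w i) (loopPath S.xstar S.xstar w (i + 1))) u)
      (fun i => hPT _ _) (w.length + 1)
    simp only [sum_inner]
    exact this
  · rw [← Finset.sum_sub_distrib, mul_right_comm]
    refine (Finset.abs_sum_le_sum_abs _ _).trans (hsumle w fun i => ?_)
    rw [← mul_sub, abs_mul, abs_of_pos hα]
    calc _ ≤ S.α * (BC * ‖u‖) := by gcongr; exact (hBC _ θ u).2.2.1
      _ = K * ‖u‖ := by ring
      _ ≤ _ := by gcongr
  · rw [← Finset.sum_sub_distrib, sum_inner, ← Finset.sum_sub_distrib, mul_right_comm]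
    refine (Finset.abs_sum_le_sum_abs _ _).trans (hsumle w fun i => ?_)
    rw [real_inner_smul_left, ← mul_sub, ← mul_sub, abs_mul, abs_of_pos hα]
    calc _ ≤ S.α * (BC * ‖u‖ ^ 2) := by gcongr; exact (hBC _ θ u).2.2.2
      _ = K * ‖u‖ ^ 2 := by ring
      _ ≤ _ := by gcongr
  · rw [norm_smul, Real.norm_of_nonneg hα.le]
    exact (mul_le_mul_of_nonneg_left (hBC _ θ 0).2.1 hα.le).trans hAK
  · refine le_trans (Finset.sum_le_sum fun w _ => ?_) ((sum_loopProb_exp_le (S.isStochastic θ) hN hδ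
      (hreach θ S.xstar) S.xstar s).trans (le_max_left _ _))
    have := loopProb_nonneg S.xstar (S.P_nonneg θ) S.xstar w
    push_cast
    gcongr
    exact min_le_left _ _
  · refine le_trans (Finset.sum_le_sum fun w _ => ?_) ((hmom θ s).trans (le_max_right _ _))
    have := loopProb_nonneg S.xstar (S.P_nonneg θ) S.xstar w
    rw [hlogsum]
    push_cast
    gcongr
    exact min_le_right _ _

end LoopFamilyOf

/-! ### The functionals of the model on loops -/

section Functionals

variable {l : ℕ} {X : Type*} [Fintype X] {S : Model l X}
  {𝓛 : LoopFamily (Param l) (List {x : X // x ≠ S.xstar})}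

theorem returnTime_of_isLoop {w : List {x : X // x ≠ S.xstar}} {ω : ℕ → X}
    (h : IsLoop S.xstar w ω) : S.returnTime ω = w.length + 1 := by
  refine le_antisymm (Nat.sInf_le ⟨Nat.succ_pos _, h.end⟩) (le_csInf ⟨_, Nat.succ_pos _, h.end⟩ ?_)
  rintro n ⟨hn, hz⟩
  by_contra! hlt
  exact h.ne hn (by omega) hz

namespace IsLoopFamilyOf

variable {w : List {x : X // x ≠ S.xstar}} {ω : ℕ → X}

theorem H_eq (h𝓛 : IsLoopFamilyOf S 𝓛) (h0 : ω 0 = S.xstar) (hw : IsLoop S.xstar w ω) (θ : Param l)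
    (Λ : ℝ) : S.H θ Λ ω = Real.exp (𝓛.logH w θ Λ) := by
  rw [Model.H, LoopFamily.logH, h𝓛.c_eq, h𝓛.n_eq, returnTime_of_isLoop hw, Finset.sum_sub_distrib,
    Finset.sum_const, Finset.card_range, nsmul_eq_mul]
  congr 2
  refine Finset.sum_congr rfl fun i hi => ?_
  rw [hw i (Finset.mem_range.1 hi).le, h0]

theorem G_eq (h𝓛 : IsLoopFamilyOf S 𝓛) (h0 : ω 0 = S.xstar) (hw : IsLoop S.xstar w ω) {M : ℝ}
    (hM : 1 < M) (θ : Param l) (Λ : ℝ) : S.G M θ Λ ω = truncExp M (𝓛.logH w θ Λ) := by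
  have hM0 : 0 < M := by linarith
  rw [Model.G, h𝓛.H_eq h0 hw]
  split_ifs with h
  · have h1 : 𝓛.logH w θ Λ ≤ Real.log M := by rwa [Real.le_log_iff_exp_le hM0]
    rw [truncExp, taylorExp_of_nonpos _ (by linarith), Real.exp_sub, Real.exp_log hM0]
    field_simp
  · have h1 : Real.log M < 𝓛.logH w θ Λ := by
      rw [Real.log_lt_iff_lt_exp hM0]; exact not_le.1 h
    rw [truncExp, taylorExp_of_nonneg _ (by linarith),
      Real.log_mul (inv_ne_zero hM0.ne') (Real.exp_pos _).ne', Real.log_inv, Real.log_exp,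
      neg_add_eq_sub]

/-- On a loop, the direction of the parameter update is the estimator of the gradient of
`𝓛.g`: the gradient of `G` is given by the chain rule. -/
theorem F_eq (h𝓛 : IsLoopFamilyOf S 𝓛) (h0 : ω 0 = S.xstar) (hw : IsLoop S.xstar w ω) {M : ℝ}
    (hM : 1 < M) (θ : Param l) (Λ : ℝ) :
    S.F M θ Λ ω = 𝓛.est (truncExp M) (truncExpDeriv M) w θ Λ := by
  have hgrad : HasGradientAt (fun ϑ => S.G M ϑ Λ ω)
      (truncExpDeriv M (𝓛.logH w θ Λ) • 𝓛.dc w θ) θ := by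
    have h1 : HasGradientAt (𝓛.c w) (𝓛.dc w θ) θ := hasGradientAt_of_taylor (𝓛.c_taylor w) θ
    have h2 : HasFDerivAt (fun ϑ => 𝓛.logH w ϑ Λ) (InnerProductSpace.toDual ℝ _ (𝓛.dc w θ)) θ := by
      simpa only [LoopFamily.logH] using h1.hasFDerivAt.sub_const _
    have h3 := (hasDerivAt_truncExp M (𝓛.logH w θ Λ)).comp_hasFDerivAt θ h2
    rw [hasGradientAt_iff_hasFDerivAt, map_smul]
    refine h3.congr_of_eventuallyEq (Eventually.of_forall fun ϑ => ?_)
    exact h𝓛.G_eq h0 hw hM ϑ Λ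
  rw [Model.F, hgrad.gradient, h𝓛.G_eq h0 hw hM, LoopFamily.est, h𝓛.score_eq,
    returnTime_of_isLoop hw]
  congr 2
  refine Finset.sum_congr rfl fun i hi => ?_
  have := Finset.mem_range.1 hi
  rw [hw i this.le, hw (i + 1) this, h0]

variable [DecidableEq X] [MeasurableSpace X] [DiscreteMeasurableSpace X]

theorem g_eq (h𝓛 : IsLoopFamilyOf S 𝓛) {M : ℝ} (hM : 1 < M) (θ : Param l) (Λ : ℝ) :
    S.g M θ Λ = 𝓛.g (truncExp M) θ Λ := by
  have hs : Summable fun w => loopProb S.xstar (S.P θ) S.xstar w * |truncExp M (𝓛.logH w θ Λ)| := by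
    refine (LoopFamily.summable_truncExp (𝓛 := 𝓛) hM θ Λ).congr fun w => ?_
    rw [h𝓛.p_eq, abs_of_pos ((isTruncation_truncExp hM).pos _)]
  rw [Model.g, integral_law_loop S θ (z := S.xstar) S.xstar (h𝓛.hasSum_loopProb θ _)
    (φ := fun w => truncExp M (𝓛.logH w θ Λ)) (fun ω w h0 hw => h𝓛.G_eq h0 hw hM θ Λ) hs,
    LoopFamily.g]
  exact tsum_congr fun w => by rw [h𝓛.p_eq]

theorem existsUnique_truncCost (h𝓛 : IsLoopFamilyOf S 𝓛) {M : ℝ} (hM : 1 < M) (θ : Param l) :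
    ∃! Λ : ℝ, S.g M θ Λ = 1 := by
  simpa only [h𝓛.g_eq hM] using (LoopFamily.existsUnique_root (𝓛 := 𝓛) hM θ).1

theorem g_truncCost (h𝓛 : IsLoopFamilyOf S 𝓛) {M : ℝ} (hM : 1 < M) (θ : Param l) :
    𝓛.g (truncExp M) θ (S.truncCost M θ) = 1 := by
  rw [← h𝓛.g_eq hM]
  exact Classical.epsilon_spec (h𝓛.existsUnique_truncCost hM θ).exists

end IsLoopFamilyOf

end Functionals

/-! ### Noise series of a process of words -/

/-- A process of words with countable histories: given the history `a` before step `m`, the next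
word is `w` with probability `q m a w`, and the next history determines both. -/
structure IsWordProcess {Ω H W : Type*} [MeasurableSpace Ω] [MeasurableSpace H] [MeasurableSpace W]
    (ν : Measure Ω) (hist : ℕ → Ω → H) (word : ℕ → Ω → W) (q : ℕ → H → W → ℝ) : Prop where
  measurable_hist : ∀ m, Measurable (hist m)
  measurable_word : ∀ m, Measurable (word m)
  q_nonneg : ∀ m a w, 0 ≤ q m a w
  law : ∀ m a w, ν.real {ω | hist m ω = a ∧ word m ω = w} = ν.real {ω | hist m ω = a} * q m a w
  exists_dec : ∃ dec : H → H × W, ∀ m ω, dec (hist (m + 1) ω) = (hist m ω, word m ω)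

namespace IsWordProcess

variable {Ω H W : Type*} [MeasurableSpace Ω] [MeasurableSpace H] [MeasurableSpace W]
  {ν : Measure Ω} {hist : ℕ → Ω → H} {word : ℕ → Ω → W} {q : ℕ → H → W → ℝ}

theorem measurable_pair (h : IsWordProcess ν hist word q) (m : ℕ) :
    Measurable fun ω => (hist m ω, word m ω) :=
  (h.measurable_hist m).prodMk (h.measurable_word m)

variable [Countable H] [DiscreteMeasurableSpace H] [Countable W] [DiscreteMeasurableSpace W]

theorem measurable_comp (h : IsWordProcess ν hist word q) (m : ℕ) {E : Type*} [MeasurableSpace E]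
    (f : H → W → E) : Measurable fun ω => f (hist m ω) (word m ω) :=
  (Measurable.of_discrete (f := Function.uncurry f)).comp (h.measurable_pair m)

theorem map_real_singleton (h : IsWordProcess ν hist word q) (m : ℕ) (a : H) (w : W) :
    (ν.map fun ω => (hist m ω, word m ω)).real {(a, w)} = ν.real {ω | hist m ω = a} * q m a w := by
  rw [map_measureReal_apply (h.measurable_pair m) (measurableSet_singleton _), ← h.law m a w]
  congr 1
  ext ω
  simp

/-- Conditionally centered functions are orthogonal to functions of the history. -/
theorem integral_mul_eq_zero (h : IsWordProcess ν hist word q) {m : ℕ} {f : H → W → ℝ}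
    (hf : ∀ a, HasSum (fun w => q m a w * f a w) 0) (s : H → ℝ)
    (hi : Integrable (fun ω => s (hist m ω) * f (hist m ω) (word m ω)) ν) :
    ∫ ω, s (hist m ω) * f (hist m ω) (word m ω) ∂ν = 0 := by
  set lam := ν.map fun ω => (hist m ω, word m ω) with hlam
  set F : H × W → ℝ := fun p => s p.1 * f p.1 p.2 with hF
  have hFm : Measurable F := .of_discrete
  have hFi : Integrable F lam :=
    (integrable_map_measure hFm.aestronglyMeasurable (h.measurable_pair m).aemeasurable).2 hi
  have h1 : ∫ ω, s (hist m ω) * f (hist m ω) (word m ω) ∂ν = ∫ p, F p ∂lam := by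
    rw [hlam, integral_map (h.measurable_pair m).aemeasurable hFm.aestronglyMeasurable]
  have hsum : Summable fun p => lam.real {p} * F p := by
    rw [← Measure.sum_smul_dirac lam] at hFi
    have := hFi.summable_of_dirac
    refine Summable.of_norm ?_
    simpa [abs_mul, measureReal_def] using this
  rw [h1, integral_countable hFi]
  simp only [smul_eq_mul]
  rw [hsum.tsum_prod]
  refine (tsum_congr fun a => ?_).trans tsum_zero
  have h2 := (hf a).mul_left (ν.real {ω | hist m ω = a} * s a)
  rw [mul_zero] at h2
  rw [← h2.tsum_eq]
  refine tsum_congr fun w => ?_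
  rw [hlam, h.map_real_singleton]
  ring

variable [IsProbabilityMeasure ν]

/-- A bound of the conditional expectations bounds the expectation. -/
theorem lintegral_le (h : IsWordProcess ν hist word q) {m : ℕ} {f : H → W → ℝ} {σ : ℝ}
    (hf : ∀ a w, 0 ≤ f a w) (hσ : ∀ a, ∀ s : Finset W, ∑ w ∈ s, q m a w * f a w ≤ σ) :
    ∫⁻ ω, ENNReal.ofReal (f (hist m ω) (word m ω)) ∂ν ≤ ENNReal.ofReal σ := by
  have h1 : ∀ a, ∑' w, ENNReal.ofReal (q m a w * f a w) ≤ ENNReal.ofReal σ := fun a => by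
    rw [ENNReal.tsum_eq_iSup_sum]
    refine iSup_le fun s => ?_
    rw [← ENNReal.ofReal_sum_of_nonneg fun w _ => mul_nonneg (h.q_nonneg m a w) (hf a w)]
    exact ENNReal.ofReal_le_ofReal (hσ a s)
  have h2 : ∀ a w, ENNReal.ofReal (f a w) * (ν.map fun ω => (hist m ω, word m ω)) {(a, w)}
      = ν {ω | hist m ω = a} * ENNReal.ofReal (q m a w * f a w) := fun a w => by
    have := Measure.isProbabilityMeasure_map (μ := ν) (h.measurable_pair m).aemeasurable
    rw [← ofReal_measureReal (μ := ν.map _), h.map_real_singleton,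
      ENNReal.ofReal_mul measureReal_nonneg, ofReal_measureReal, mul_left_comm, mul_comm (q m a w),
      ENNReal.ofReal_mul (hf a w)]
  calc ∫⁻ ω, ENNReal.ofReal (f (hist m ω) (word m ω)) ∂ν
      = ∫⁻ p, ENNReal.ofReal (f p.1 p.2) ∂(ν.map fun ω => (hist m ω, word m ω)) := by
        rw [lintegral_map .of_discrete (h.measurable_pair m)]
    _ = ∑' a, ∑' w, ν {ω | hist m ω = a} * ENNReal.ofReal (q m a w * f a w) := by
        rw [lintegral_countable', ENNReal.tsum_prod']
        simp only [h2]
    _ ≤ ∑' a, ν {ω | hist m ω = a} * ENNReal.ofReal σ := by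
        refine ENNReal.tsum_le_tsum fun a => ?_
        rw [ENNReal.tsum_mul_left]
        gcongr
        exact h1 a
    _ = (∑' a, (ν.map (hist m)) {a}) * ENNReal.ofReal σ := by
        rw [ENNReal.tsum_mul_right]
        congr 2
        funext a
        rw [Measure.map_apply (h.measurable_hist m) (measurableSet_singleton _)]
        rfl
    _ = ENNReal.ofReal σ := by
        have := Measure.isProbabilityMeasure_map (μ := ν) (h.measurable_hist m).aemeasurable
        have h3 := lintegral_countable' (μ := ν.map (hist m)) fun _ => 1
        simp only [one_mul, lintegral_one, measure_univ] at h3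
        rw [← h3, one_mul]

/-- A series of nonnegative terms with summable conditional expectations. -/
theorem ae_summable (h : IsWordProcess ν hist word q) {f : ℕ → H → W → ℝ} {σ : ℕ → ℝ}
    (hf : ∀ m a w, 0 ≤ f m a w) (hσ : ∀ m a, ∀ s : Finset W, ∑ w ∈ s, q m a w * f m a w ≤ σ m)
    (hs : Summable σ) (hσ0 : ∀ m, 0 ≤ σ m) :
    ∀ᵐ ω ∂ν, Summable fun m => f m (hist m ω) (word m ω) := by
  have h1 : ∫⁻ ω, ∑' m, ENNReal.ofReal (f m (hist m ω) (word m ω)) ∂ν ≠ ∞ := by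
    rw [lintegral_tsum fun m => (h.measurable_comp m fun a w =>
      ENNReal.ofReal (f m a w)).aemeasurable]
    refine ne_top_of_le_ne_top ?_ (ENNReal.tsum_le_tsum fun m => h.lintegral_le (hf m) (hσ m))
    rw [← ENNReal.ofReal_tsum_of_nonneg hσ0 hs]
    exact ENNReal.ofReal_ne_top
  have hm : AEMeasurable (fun ω => ∑' m, ENNReal.ofReal (f m (hist m ω) (word m ω))) ν :=
    AEMeasurable.tsum fun m =>
      (h.measurable_comp m fun a w => ENNReal.ofReal (f m a w)).aemeasurable
  filter_upwards [ae_lt_top' hm h1] with ω hω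
  have := ENNReal.summable_toReal hω.ne
  refine this.congr fun m => ?_
  rw [ENNReal.toReal_ofReal (hf m _ _)]

/-- A series of conditionally centered terms with summable conditional variances converges, by the
convergence theorem for martingales bounded in `L²`. -/
theorem ae_seriesConverges (h : IsWordProcess ν hist word q) {f : ℕ → H → W → ℝ} {σ : ℕ → ℝ}
    (hf : ∀ m a, HasSum (fun w => q m a w * f m a w) 0)
    (hσ : ∀ m a, ∀ s : Finset W, ∑ w ∈ s, q m a w * f m a w ^ 2 ≤ σ m)
    (hs : Summable σ) (hσ0 : ∀ m, 0 ≤ σ m) :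
    ∀ᵐ ω ∂ν, SeriesConverges fun m => f m (hist m ω) (word m ω) := by
  set x : ℕ → Ω → ℝ := fun m ω => f m (hist m ω) (word m ω) with hx
  have hxm : ∀ m, Measurable (x m) := fun m => h.measurable_comp m (f m)
  have hx2 : ∀ m, MemLp (x m) 2 ν := fun m => by
    rw [memLp_two_iff_integrable_sq (hxm m).aestronglyMeasurable]
    refine ⟨((hxm m).pow_const 2).aestronglyMeasurable, ?_⟩
    rw [hasFiniteIntegral_iff_ofReal (ae_of_all _ fun ω => sq_nonneg _)]
    exact (h.lintegral_le (fun a w => sq_nonneg (f m a w)) (hσ m)).trans_lt ENNReal.ofReal_lt_top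
  have hx2' : ∀ m, ∫ ω, x m ω ^ 2 ∂ν ≤ σ m := fun m => by
    rw [integral_eq_lintegral_of_nonneg_ae (ae_of_all _ fun ω => sq_nonneg _)
      ((hxm m).pow_const 2).aestronglyMeasurable]
    exact ENNReal.toReal_le_of_le_ofReal (hσ0 m)
      (h.lintegral_le (fun a w => sq_nonneg (f m a w)) (hσ m))
  set S : ℕ → Ω → ℝ := fun n ω => ∑ i ∈ Finset.range n, x i ω with hS
  have hSs : ∀ n ω, S (n + 1) ω = S n ω + x n ω := fun n ω => Finset.sum_range_succ _ _
  obtain ⟨dec, hdec⟩ := h.exists_dec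
  have hSh : ∀ n, ∃ s : H → ℝ, ∀ ω, S n ω = s (hist n ω) := by
    intro n
    induction n with
    | zero => exact ⟨fun _ => 0, fun ω => by simp [hS]⟩
    | succ n ih =>
      obtain ⟨s, hs⟩ := ih
      refine ⟨fun a => s (dec a).1 + f n (dec a).1 (dec a).2, fun ω => ?_⟩
      rw [hSs, hs]
      simp only [hdec, hx]
  have hS2 : ∀ n, MemLp (S n) 2 ν := fun n => memLp_finsetSum _ fun i _ => hx2 i
  have horth : ∀ n, ∫ ω, S n ω * x n ω ∂ν = 0 := fun n => by
    obtain ⟨s, hs⟩ := hSh n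
    have hi := (hS2 n).integrable_mul (hx2 n)
    simp only [Pi.mul_def] at hi
    simp only [hs] at hi ⊢
    exact h.integral_mul_eq_zero (hf n) s hi
  have hvar : ∀ n, ∫ ω, S n ω ^ 2 ∂ν ≤ ∑ i ∈ Finset.range n, σ i := fun n => by
    induction n with
    | zero => simp [hS]
    | succ n ih =>
      have e : ∀ ω, S (n + 1) ω ^ 2 = (S n ω ^ 2 + 2 * (S n ω * x n ω)) + x n ω ^ 2 := fun ω => by
        rw [hSs]; ring
      have hi : Integrable (fun ω => S n ω * x n ω) ν := (hS2 n).integrable_mul (hx2 n)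
      have hi' : Integrable (fun ω => S n ω ^ 2 + 2 * (S n ω * x n ω)) ν :=
        (hS2 n).integrable_sq.add (hi.const_mul 2)
      simp only [e]
      rw [integral_add hi' (hx2 n).integrable_sq,
        integral_add (hS2 n).integrable_sq (hi.const_mul 2), integral_const_mul, horth,
        Finset.sum_range_succ]
      linarith [hx2' n]
  let 𝒢 : Filtration ℕ ‹MeasurableSpace Ω› :=
    { seq := fun m => MeasurableSpace.comap (hist m) ⊤
      mono' := monotone_nat_of_le_succ fun m => by
        have : hist m = (fun a => (dec a).1) ∘ hist (m + 1) := by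
          funext ω; simp [hdec]
        rw [this, ← MeasurableSpace.comap_comp]
        exact MeasurableSpace.comap_mono le_top
      le' := fun m => by
        rintro _ ⟨s, -, rfl⟩
        exact h.measurable_hist m (.of_discrete) }
  have hmart : Martingale S 𝒢 ν := by
    refine martingale_of_setIntegral_eq_succ (fun n => ?_)
      (fun n => (hS2 n).integrable one_le_two) fun n t ht => ?_
    · obtain ⟨s, hs⟩ := hSh n
      have : S n = s ∘ hist n := funext hs
      rw [this]
      exact Measurable.stronglyMeasurable fun t _ => ⟨s ⁻¹' t, trivial, rfl⟩
    · obtain ⟨A, -, rfl⟩ := ht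
      classical
      have hA : MeasurableSet (hist n ⁻¹' A) := h.measurable_hist n (.of_discrete)
      have hxi := (hx2 n).integrable one_le_two
      simp only [hSs]
      rw [integral_add ((hS2 n).integrable one_le_two).integrableOn hxi.integrableOn,
        left_eq_add, ← integral_indicator hA]
      have e : (hist n ⁻¹' A).indicator (fun ω => x n ω)
          = fun ω => A.indicator (fun _ => (1 : ℝ)) (hist n ω) * f n (hist n ω) (word n ω) := by
        funext ω
        by_cases hω : hist n ω ∈ A <;> simp [Set.indicator, hω, hx]
      have hi := hxi.indicator hA
      rw [e] at hi ⊢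
      exact h.integral_mul_eq_zero (hf n) _ hi
  have hbdd : ∀ n, eLpNorm (S n) 1 ν ≤ ((1 + ∑' i, σ i).toNNReal : ℝ≥0∞) := fun n => by
    have hint := (hS2 n).integrable one_le_two
    rw [eLpNorm_one_eq_lintegral_enorm, ← ofReal_integral_norm_eq_lintegral_enorm hint]
    refine ENNReal.ofReal_le_ofReal ?_
    have h1 : ∫ ω, ‖S n ω‖ ∂ν ≤ ∫ ω, (1 + S n ω ^ 2) ∂ν :=
      integral_mono hint.norm ((integrable_const _).add (hS2 n).integrable_sq) fun ω => by
        change ‖S n ω‖ ≤ 1 + S n ω ^ 2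
        rw [Real.norm_eq_abs, ← sq_abs]
        nlinarith [sq_nonneg (|S n ω| - 1), abs_nonneg (S n ω)]
    rw [integral_add (integrable_const _) (hS2 n).integrable_sq, integral_const,
      probReal_univ, one_smul] at h1
    linarith [hvar n, hs.sum_le_tsum (Finset.range n) fun i _ => hσ0 i]
  exact hmart.submartingale.exists_ae_tendsto_of_bdd hbdd

end IsWordProcess

/-! ### The words of a path -/

/-- Lists carry the discrete σ-algebra, which is adequate for lists over countable types. -/
instance {Y : Type*} : MeasurableSpace (List Y) := ⊤

instance {Y : Type*} : DiscreteMeasurableSpace (List Y) := ⟨fun _ => trivial⟩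

section Words

variable {X : Type*} {z : X}

/-- The number of steps of a list of loops. -/
def duration : List (List {y : X // y ≠ z}) → ℕ
  | [] => 0
  | w :: a => duration a + (w.length + 1)

/-- The state in which a path that starts at `x` is after the loops of `a`. -/
def endpoint (x : X) : List (List {y : X // y ≠ z}) → X
  | [] => x
  | _ :: _ => z

/-- The path consists, at first, of the loops of `a`; the head of `a` is the last loop. -/
def Follows : List (List {y : X // y ≠ z}) → (ℕ → X) → Prop
  | [], _ => True
  | w :: a, ω => Follows a ω ∧ IsLoop z w fun i => ω (duration a + i)

/-- A path that starts at `x` and follows `a`. -/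
def pathOf (x : X) : List (List {y : X // y ≠ z}) → ℕ → X
  | [], _ => x
  | w :: a, i => if i ≤ duration a then pathOf x a i
    else loopPath z (endpoint x a) w (i - duration a)

open Classical in
/-- The loop that a path performs, if there is one. -/
def firstLoop (z : X) (ω : ℕ → X) : List {y : X // y ≠ z} :=
  if h : ∃ w, IsLoop z w ω then h.choose else []

/-- The first `m` loops of a path, the last one first. -/
def words (z : X) (ω : ℕ → X) : ℕ → List (List {y : X // y ≠ z})
  | 0 => []
  | m + 1 => firstLoop z (fun i => ω (duration (words z ω m) + i)) :: words z ω m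

theorem isLoop_loopPath (z x : X) (w : List {y : X // y ≠ z}) : IsLoop z w (loopPath z x w) :=
  fun i _ => by rw [loopPath_zero]

theorem IsLoop.firstLoop_eq {w : List {y : X // y ≠ z}} {ω : ℕ → X} (h : IsLoop z w ω) :
    firstLoop z ω = w := by
  have h' : ∃ w, IsLoop z w ω := ⟨w, h⟩
  rw [firstLoop, dif_pos h']
  exact h'.choose_spec.unique h

theorem length_words (ω : ℕ → X) (m : ℕ) : (words z ω m).length = m := by
  induction m with
  | zero => rfl
  | succ m ih => simp [words, ih]

theorem Follows.words_eq {a : List (List {y : X // y ≠ z})} {ω : ℕ → X} (h : Follows a ω) :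
    words z ω a.length = a := by
  induction a with
  | nil => rfl
  | cons w a ih =>
    have h1 := ih h.1
    have h2 := h.2.firstLoop_eq
    simp only [List.length_cons, words, h1, h2]

theorem Follows.apply_duration {a : List (List {y : X // y ≠ z})} {ω : ℕ → X} (h : Follows a ω) :
    ω (duration a) = endpoint (ω 0) a := by
  cases a with
  | nil => rfl
  | cons w a => exact h.2.end

theorem mem_prefixSet_pathOf (x : X) (a : List (List {y : X // y ≠ z})) (ω : ℕ → X) :
    ω ∈ prefixSet (pathOf x a) (duration a) ↔ ω 0 = x ∧ Follows a ω := by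
  induction a with
  | nil =>
    constructor
    · exact fun h => ⟨h 0 le_rfl, trivial⟩
    · rintro ⟨h, -⟩ i hi
      obtain rfl : i = 0 := by simpa [duration] using hi
      exact h
  | cons w a ih =>
    constructor
    · intro h
      obtain ⟨h1, h2⟩ := ih.1 fun i hi => by
        rw [h i (by simp only [duration]; omega), pathOf, if_pos hi]
      refine ⟨h1, h2, fun i hi => ?_⟩
      rcases Nat.eq_zero_or_pos i with rfl | hi0
      · simp
      · beta_reduce
        rw [h (duration a + i) (by simp only [duration]; omega), pathOf, if_neg (by omega),
          Nat.add_sub_cancel_left, add_zero, h2.apply_duration, h1]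
    · rintro ⟨h1, h2, h3⟩ i hi
      rw [pathOf]
      split_ifs with hia
      · exact ih.2 ⟨h1, h2⟩ i hia
      · have := h3 (i - duration a) (by simp only [duration] at hi; omega)
        beta_reduce at this
        rw [add_zero, h2.apply_duration, h1, Nat.add_sub_cancel' (by omega)] at this
        exact this

theorem pathOf_duration (x : X) (a : List (List {y : X // y ≠ z})) :
    pathOf x a (duration a) = endpoint x a := by
  have h := (mem_prefixSet_pathOf x a (pathOf x a)).1 fun i _ => rfl
  rw [h.2.apply_duration, h.1]

theorem pathOf_cons_add (x : X) (w : List {y : X // y ≠ z}) (a : List (List {y : X // y ≠ z}))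
    (i : ℕ) : pathOf x (w :: a) (duration a + i) = loopPath z (endpoint x a) w i := by
  rw [pathOf]
  split_ifs with h
  · obtain rfl : i = 0 := by omega
    simpa using pathOf_duration x a
  · rw [Nat.add_sub_cancel_left]

variable [Countable X] [MeasurableSpace X] [DiscreteMeasurableSpace X]

theorem measurable_firstLoop (t : ℕ) :
    Measurable fun ω : ℕ → X => firstLoop z fun i => ω (t + i) := by
  refine measurable_to_countable' fun w => ?_
  have : (fun ω : ℕ → X => firstLoop z fun i => ω (t + i)) ⁻¹' {w}
      = {ω | IsLoop z w fun i => ω (t + i)} ∪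
        ({ω | w = []} ∩ ⋂ w', {ω | IsLoop z w' fun i => ω (t + i)}ᶜ) := by
    ext ω
    simp only [Set.mem_preimage, Set.mem_singleton_iff, Set.mem_union, Set.mem_ofPred_eq,
      Set.mem_inter_iff, Set.mem_iInter, Set.mem_compl_iff]
    constructor
    · intro h
      by_cases h' : ∃ w', IsLoop z w' fun i => ω (t + i)
      · obtain ⟨w', hw'⟩ := h'
        left
        rwa [← h, hw'.firstLoop_eq]
      · right
        refine ⟨?_, fun w' hw' => h' ⟨w', hw'⟩⟩
        rw [← h, firstLoop, dif_neg h']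
    · rintro (h | ⟨h1, h2⟩)
      · exact h.firstLoop_eq
      · rw [firstLoop, dif_neg (not_exists.2 h2), h1]
  rw [this]
  exact (measurableSet_isLoop z w t).union ((MeasurableSet.const _).inter
    (MeasurableSet.iInter fun w' => (measurableSet_isLoop z w' t).compl))

theorem measurable_words (m : ℕ) : Measurable fun ω : ℕ → X => words z ω m := by
  induction m with
  | zero => exact measurable_const
  | succ m ih =>
    have h1 : Measurable fun p : List (List {y : X // y ≠ z}) × (ℕ → X) =>
        firstLoop z (fun i => p.2 (duration p.1 + i)) :=
      measurable_from_prod_countable_right fun a => measurable_firstLoop (duration a)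
    have h2 : Measurable fun p : List {y : X // y ≠ z} × List (List {y : X // y ≠ z}) =>
        p.1 :: p.2 := .of_discrete
    exact h2.comp ((h1.comp (ih.prodMk measurable_id)).prodMk ih)

theorem measurableSet_follows (x : X) (a : List (List {y : X // y ≠ z})) :
    MeasurableSet {ω : ℕ → X | ω 0 = x ∧ Follows a ω} := by
  have : {ω : ℕ → X | ω 0 = x ∧ Follows a ω} = prefixSet (pathOf x a) (duration a) :=
    Set.ext fun ω => (mem_prefixSet_pathOf x a ω).symm
  rw [this]
  exact measurableSet_prefixSet _ _

end Words

/-! ### The algorithm as a function of the words -/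

section Controlled

variable {l : ℕ} {X : Type*} [Fintype X] (S : Model l X) (U : UpdateRule) (γ : ℕ → ℝ) (η : ℝ)
  (M : ℕ → ℝ) (θ₀ : Param l) (Λ₀ : ℝ)

/-- The iterate of the algorithm after the loops of `a`, on a path that starts at `x`. -/
def stateOf (x : X) : List (List {y : X // y ≠ S.xstar}) → Param l × ℝ
  | [] => (θ₀, Λ₀)
  | w :: a =>
    let r := stateOf x a
    let cycle : ℕ → X := loopPath S.xstar (endpoint x a) w
    (r.1 - U.onParam (γ a.length • S.F (M a.length) r.1 r.2 cycle),
      r.2 + U.onCost (η * γ a.length * (S.G (M a.length) r.1 r.2 cycle - 1)))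

variable {S}

theorem H_congr {w : List {y : X // y ≠ S.xstar}} {ω ω' : ℕ → X} (h : IsLoop S.xstar w ω)
    (h' : IsLoop S.xstar w ω') (h0 : ω 0 = ω' 0) (θ : Param l) (Λ : ℝ) :
    S.H θ Λ ω = S.H θ Λ ω' := by
  rw [Model.H, Model.H, returnTime_of_isLoop h, returnTime_of_isLoop h']
  congr 1
  refine Finset.sum_congr rfl fun i hi => ?_
  rw [h i (Finset.mem_range.1 hi).le, h' i (Finset.mem_range.1 hi).le, h0]

theorem G_congr {w : List {y : X // y ≠ S.xstar}} {ω ω' : ℕ → X} (h : IsLoop S.xstar w ω)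
    (h' : IsLoop S.xstar w ω') (h0 : ω 0 = ω' 0) (M : ℝ) (θ : Param l) (Λ : ℝ) :
    S.G M θ Λ ω = S.G M θ Λ ω' := by
  rw [Model.G, Model.G, H_congr h h' h0]

theorem F_congr {w : List {y : X // y ≠ S.xstar}} {ω ω' : ℕ → X} (h : IsLoop S.xstar w ω)
    (h' : IsLoop S.xstar w ω') (h0 : ω 0 = ω' 0) (M : ℝ) (θ : Param l) (Λ : ℝ) :
    S.F M θ Λ ω = S.F M θ Λ ω' := by
  have h1 : (fun ϑ => S.G M ϑ Λ ω) = fun ϑ => S.G M ϑ Λ ω' :=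
    funext fun ϑ => G_congr h h' h0 M ϑ Λ
  rw [Model.F, Model.F, h1, G_congr h h' h0, returnTime_of_isLoop h, returnTime_of_isLoop h']
  congr 2
  refine Finset.sum_congr rfl fun i hi => ?_
  have := Finset.mem_range.1 hi
  rw [h i this.le, h' i this.le, h (i + 1) this, h' (i + 1) this, h0]

theorem Follows.visit_eq {a : List (List {y : X // y ≠ S.xstar})} {ω : ℕ → X} (h : Follows a ω) :
    S.visit ω a.length = duration a := by
  induction a with
  | nil => rfl
  | cons w a ih =>
    rw [List.length_cons, Model.visit, ih h.1, returnTime_of_isLoop h.2, duration]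

theorem Follows.iterate_eq {a : List (List {y : X // y ≠ S.xstar})} {ω : ℕ → X} (h : Follows a ω) :
    S.iterate U γ η M θ₀ Λ₀ ω a.length = stateOf S U γ η M θ₀ Λ₀ (ω 0) a := by
  induction a with
  | nil => rfl
  | cons w a ih =>
    have h1 := isLoop_loopPath S.xstar (endpoint (ω 0) a) w
    have h0 : ω (duration a + 0) = loopPath S.xstar (endpoint (ω 0) a) w 0 := by
      rw [add_zero, loopPath_zero, h.1.apply_duration]
    rw [List.length_cons, Model.iterate, ih h.1, h.1.visit_eq, stateOf, F_congr h.2 h1 h0,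
      G_congr h.2 h1 h0]

variable [DecidableEq X]

theorem visitCount_succ (ω : ℕ → X) (n : ℕ) :
    S.visitCount ω (n + 1) = S.visitCount ω n + if ω (n + 1) = S.xstar then 1 else 0 := by
  have : Finset.Icc 1 (n + 1) = insert (n + 1) (Finset.Icc 1 n) := by
    ext i; simp only [Finset.mem_Icc, Finset.mem_insert]; omega
  rw [Model.visitCount, Model.visitCount, this, Finset.filter_insert]
  split_ifs with h
  · rw [Finset.card_insert_of_notMem (by simp)]
  · rfl

theorem visitCount_add {ω : ℕ → X} {t i : ℕ} (h : ∀ j, 0 < j → j ≤ i → ω (t + j) ≠ S.xstar) :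
    S.visitCount ω (t + i) = S.visitCount ω t := by
  induction i with
  | zero => rfl
  | succ i ih =>
    rw [← add_assoc, visitCount_succ, if_neg (by
      rw [add_assoc]; exact h (i + 1) i.succ_pos le_rfl), add_zero,
      ih fun j h0 hj => h j h0 (hj.trans i.le_succ)]

theorem Follows.visitCount_eq {a : List (List {y : X // y ≠ S.xstar})} {ω : ℕ → X}
    (h : Follows a ω) : S.visitCount ω (duration a) = a.length := by
  induction a with
  | nil => simp [duration, Model.visitCount]
  | cons w a ih =>
    rw [duration, ← add_assoc, visitCount_succ,
      visitCount_add fun j h0 hj => h.2.ne h0 hj, ih h.1, if_pos (by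
        rw [add_assoc]; exact h.2.end), List.length_cons]

variable [MeasurableSpace X] {ν : Measure (ℕ → X)}

/-- Given the loops of `a`, the next loop is a loop of the chain with the current parameter. The
hypothesis `hν` gives the one-step transition probabilities of the path: after a piece of path
that determines the current parameter to be `ϑ`, they are those of `S.P ϑ`. -/
theorem real_follows_cons
    (hν : ∀ ρ n ϑ, (∀ ω ∈ prefixSet ρ n,
        (S.iterate U γ η M θ₀ Λ₀ ω (S.visitCount ω n)).1 = ϑ) →
      ν.real (prefixSet ρ (n + 1)) = ν.real (prefixSet ρ n) * S.P ϑ (ρ n) (ρ (n + 1)))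
    (x : X) (w : List {y : X // y ≠ S.xstar}) (a : List (List {y : X // y ≠ S.xstar})) :
    ν.real {ω | ω 0 = x ∧ Follows (w :: a) ω} = ν.real {ω | ω 0 = x ∧ Follows a ω} *
      loopProb S.xstar (S.P (stateOf S U γ η M θ₀ Λ₀ x a).1) (endpoint x a) w := by
  have e : ∀ a : List (List {y : X // y ≠ S.xstar}),
      {ω | ω 0 = x ∧ Follows a ω} = prefixSet (pathOf x a) (duration a) := fun a =>
    Set.ext fun ω => (mem_prefixSet_pathOf x a ω).symm
  have e2 : prefixSet (pathOf x (w :: a)) (duration a) = prefixSet (pathOf x a) (duration a) := by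
    ext ω
    simp only [mem_prefixSet]
    refine forall₂_congr fun i hi => ?_
    rw [pathOf, if_pos hi]
  rw [e, e, duration, measureReal_prefixSet_add
    (Q := S.P (stateOf S U γ η M θ₀ Λ₀ x a).1) fun i hi => hν _ _ _ fun ω hω => ?_, e2, loopProb]
  · simp only [add_assoc, pathOf_cons_add]
  · have h1 := (mem_prefixSet_pathOf x a ω).1 (e2 ▸ fun j hj => hω j (by omega))
    rw [visitCount_add fun j h0 hj => by
        rw [hω _ (by omega), pathOf_cons_add]
        exact loopPath_ne _ _ _ _ h0 (by omega),
      h1.2.visitCount_eq, h1.2.iterate_eq, h1.1]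

variable [DiscreteMeasurableSpace X]

/-- Almost every controlled path is a sequence of loops. -/
theorem ae_follows_words [IsFiniteMeasure ν]
    (hν : ∀ ρ n ϑ, (∀ ω ∈ prefixSet ρ n,
        (S.iterate U γ η M θ₀ Λ₀ ω (S.visitCount ω n)).1 = ϑ) →
      ν.real (prefixSet ρ (n + 1)) = ν.real (prefixSet ρ n) * S.P ϑ (ρ n) (ρ (n + 1)))
    (hsum : ∀ θ x, HasSum (loopProb S.xstar (S.P θ) x) 1) :
    ∀ᵐ ω ∂ν, ∀ m, Follows (words S.xstar ω m) ω := by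
  have h1 : ∀ᵐ ω ∂ν, ∀ (x : X) (a : List (List {y : X // y ≠ S.xstar})),
      ω 0 = x ∧ Follows a ω → ∃ w, IsLoop S.xstar w fun i => ω (duration a + i) := by
    rw [ae_all_iff]; intro x
    rw [ae_all_iff]; intro a
    refine ae_exists_isLoop (measurableSet_follows x a) (fun w => ?_)
      (hsum (stateOf S U γ η M θ₀ Λ₀ x a).1 (endpoint x a))
    rw [← real_follows_cons U γ η M θ₀ Λ₀ hν x w a]
    congr 1
    ext ω
    simp only [Set.mem_inter_iff, Set.mem_ofPred_eq, Follows, and_assoc]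
  filter_upwards [h1] with ω hω m
  induction m with
  | zero => trivial
  | succ m ih =>
    obtain ⟨w, hw⟩ := hω (ω 0) _ ⟨rfl, ih⟩
    refine ⟨ih, ?_⟩
    rwa [hw.firstLoop_eq]

/-- After the first visit to `xstar`, the loops of a controlled path form a process of words. The
first of the `m + 1` words in the history describes the way from the initial state to `xstar`. -/
theorem isWordProcess_words [IsProbabilityMeasure ν]
    (hν : ∀ ρ n ϑ, (∀ ω ∈ prefixSet ρ n,
        (S.iterate U γ η M θ₀ Λ₀ ω (S.visitCount ω n)).1 = ϑ) →
      ν.real (prefixSet ρ (n + 1)) = ν.real (prefixSet ρ n) * S.P ϑ (ρ n) (ρ (n + 1)))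
    (hsum : ∀ θ x, HasSum (loopProb S.xstar (S.P θ) x) 1) :
    IsWordProcess ν (fun m ω => (ω 0, words S.xstar ω (m + 1)))
      (fun m ω => firstLoop S.xstar fun i => ω (duration (words S.xstar ω (m + 1)) + i))
      (fun _ a w => loopProb S.xstar (S.P (stateOf S U γ η M θ₀ Λ₀ a.1 a.2).1) S.xstar w) where
  measurable_hist m := (measurable_pi_apply 0).prodMk (measurable_words (m + 1))
  measurable_word m := by
    have h1 : Measurable fun p : List (List {y : X // y ≠ S.xstar}) × (ℕ → X) =>
        firstLoop S.xstar (fun i => p.2 (duration p.1 + i)) :=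
      measurable_from_prod_countable_right fun a => measurable_firstLoop (duration a)
    exact h1.comp ((measurable_words (m + 1)).prodMk measurable_id)
  q_nonneg _ a w := loopProb_nonneg _ (S.P_nonneg _) _ _
  exists_dec := by
    refine ⟨fun a => ((a.1, a.2.tail), a.2.headI), fun m ω => rfl⟩
  law m := by
    rintro ⟨x, a⟩ w
    have hae := ae_follows_words U γ η M θ₀ Λ₀ hν hsum
    by_cases ha : a.length = m + 1
    · have e1 : ν.real {ω | (ω 0, words S.xstar ω (m + 1)) = (x, a)}
          = ν.real {ω | ω 0 = x ∧ Follows a ω} := by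
        refine measureReal_congr ?_
        filter_upwards [hae] with ω hω
        refine propext ⟨fun h => ?_, fun h => ?_⟩
        · obtain ⟨h1, h2⟩ := Prod.mk.inj h
          exact ⟨h1, h2 ▸ hω (m + 1)⟩
        · exact Prod.ext h.1 (by rw [← ha]; exact h.2.words_eq)
      have e2 : ν.real {ω | (ω 0, words S.xstar ω (m + 1)) = (x, a) ∧
          (firstLoop S.xstar fun i => ω (duration (words S.xstar ω (m + 1)) + i)) = w}
          = ν.real {ω | ω 0 = x ∧ Follows (w :: a) ω} := by
        refine measureReal_congr ?_
        filter_upwards [hae] with ω hω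
        refine propext ⟨fun h => ?_, fun h => ?_⟩
        · obtain ⟨h0, h3⟩ := h
          obtain ⟨h1, h2⟩ := Prod.mk.inj h0
          have h4 := hω (m + 2)
          rw [words, h3, h2] at h4
          exact ⟨h1, h4⟩
        · have h4 : words S.xstar ω (m + 1) = a := by rw [← ha]; exact h.2.1.words_eq
          refine ⟨Prod.ext h.1 h4, ?_⟩
          rw [h4]
          exact h.2.2.firstLoop_eq
      rw [e1, e2, real_follows_cons U γ η M θ₀ Λ₀ hν]
      cases a with
      | nil => simp at ha
      | cons w' a => rfl
    · have e1 : {ω : ℕ → X | (ω 0, words S.xstar ω (m + 1)) = (x, a)} = ∅ := by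
        refine Set.eq_empty_iff_forall_notMem.2 fun ω h => ha ?_
        rw [← (Prod.mk.inj h).2, length_words]
      have e2 : {ω : ℕ → X | (ω 0, words S.xstar ω (m + 1)) = (x, a) ∧
          (firstLoop S.xstar fun i => ω (duration (words S.xstar ω (m + 1)) + i)) = w} = ∅ :=
        Set.eq_empty_iff_forall_notMem.2 fun ω h =>
          Set.eq_empty_iff_forall_notMem.1 e1 ω h.1
      rw [e1, e2]
      simp

/-- The one-step transition probabilities of the path of a controlled process. -/
theorem Model.IsControlledPath.real_prefixSet_succ {Ω : Type*} [mΩ : MeasurableSpace Ω]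
    {μ : Measure Ω} [IsProbabilityMeasure μ] {𝓕 : Filtration ℕ mΩ} {Φ : ℕ → Ω → X}
    (h : S.IsControlledPath U γ η M θ₀ Λ₀ μ 𝓕 Φ) (ρ : ℕ → X) (n : ℕ) (ϑ : Param l)
    (hϑ : ∀ ω ∈ prefixSet ρ n, (S.iterate U γ η M θ₀ Λ₀ ω (S.visitCount ω n)).1 = ϑ) :
    (μ.map fun ω k => Φ k ω).real (prefixSet ρ (n + 1))
      = (μ.map fun ω k => Φ k ω).real (prefixSet ρ n) * S.P ϑ (ρ n) (ρ (n + 1)) := by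
  have hm : ∀ k, Measurable (Φ k) := fun k => (h.adapted k).mono (𝓕.le k) le_rfl
  have hpath : Measurable fun ω k => Φ k ω := measurable_pi_lambda _ hm
  rw [map_measureReal_apply hpath (measurableSet_prefixSet _ _),
    map_measureReal_apply hpath (measurableSet_prefixSet _ _), prefixSet_succ, Set.preimage_inter]
  set s : Set Ω := (fun ω k => Φ k ω) ⁻¹' prefixSet ρ n with hs
  have hsm : MeasurableSet[𝓕 n] s := by
    have : s = ⋂ i ∈ Finset.Iic n, Φ i ⁻¹' {ρ i} := by
      ext ω; simp [hs, mem_prefixSet]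
    rw [this]
    exact Finset.measurableSet_biInter _ fun i hi =>
      𝓕.mono (Finset.mem_Iic.1 hi) _ (h.adapted i (measurableSet_singleton _))
  have hint : Integrable ((Φ (n + 1) ⁻¹' {ρ (n + 1)}).indicator fun _ => (1 : ℝ)) μ :=
    (integrable_const 1).indicator (hm _ (measurableSet_singleton _))
  have h1 := setIntegral_condExp (𝓕.le n) hint hsm
  have h2 : ∫ ω in s, (μ[(Φ (n + 1) ⁻¹' {ρ (n + 1)}).indicator fun _ => (1 : ℝ) | 𝓕 n]) ω ∂μ
      = ∫ _ in s, S.P ϑ (ρ n) (ρ (n + 1)) ∂μ := by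
    refine setIntegral_congr_ae (𝓕.le n _ hsm) ?_
    filter_upwards [h.transition n (ρ (n + 1))] with ω hω hωs
    rw [hω, hϑ _ hωs]
    congr 1
    exact hωs n le_rfl
  rw [h2, setIntegral_const, smul_eq_mul,
    integral_indicator_const _ (hm _ (measurableSet_singleton _)), smul_eq_mul, mul_one,
    measureReal_restrict_apply (hm _ (measurableSet_singleton _)), Set.inter_comm] at h1
  exact h1.symm

end Controlled

/-! ### Projected increments -/

theorem abs_clip_le {a : ℝ} (ha : 0 < a) (x : ℝ) : |clip a x| ≤ |x| := by
  unfold clip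
  rw [abs_le]
  constructor
  · rcases le_total x a with h | h
    · rw [min_eq_left h]
      exact (neg_abs_le x).trans (le_max_right _ _)
    · rw [min_eq_right h]
      exact (neg_nonpos.2 (abs_nonneg x)).trans (ha.le.trans (le_max_right _ _))
  · refine max_le ((neg_nonpos.2 ha.le).trans (abs_nonneg x))
      ((min_le_left _ _).trans (le_abs_self x))

/-- The projection changes an increment by at most a multiple of its square, since it leaves
increments of at most `a` unchanged. -/
theorem abs_clip_sub_le {a : ℝ} (ha : 0 < a) (x : ℝ) : |clip a x - x| ≤ 1 / a * x ^ 2 := by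
  rcases le_or_gt |x| a with h | h
  · rw [abs_le] at h
    rw [clip, min_eq_left h.2, max_eq_right h.1, sub_self, abs_zero]
    positivity
  · have h1 : |clip a x - x| ≤ |x| := by
      unfold clip
      rcases lt_abs.1 h with h' | h'
      · rw [min_eq_right h'.le, max_eq_right (by linarith), abs_of_neg (by linarith),
          abs_of_pos (by linarith)]
        linarith
      · rw [min_eq_left (by linarith), max_eq_left (by linarith), abs_of_pos (by linarith),
          abs_of_neg (by linarith)]
        linarith
    refine h1.trans ?_
    rw [one_div, inv_mul_eq_div, le_div_iff₀ ha, ← sq_abs, sq]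
    gcongr

theorem UpdateRule.norm_onParam_le {l : ℕ} (U : UpdateRule) (v : Param l) :
    ‖U.onParam v‖ ≤ ‖v‖ := by
  cases U with
  | plain => exact le_rfl
  | projected a b ha hb =>
    rw [EuclideanSpace.norm_eq, EuclideanSpace.norm_eq]
    refine Real.sqrt_le_sqrt (Finset.sum_le_sum fun i _ => ?_)
    exact pow_le_pow_left₀ (norm_nonneg _) (abs_clip_le ha (v i)) 2

theorem UpdateRule.exists_onParam_sub_le {l : ℕ} (U : UpdateRule) :
    ∃ C, 0 ≤ C ∧ ∀ v : Param l, ‖U.onParam v - v‖ ≤ C * ‖v‖ ^ 2 := by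
  cases U with
  | plain => exact ⟨0, le_rfl, fun v => by simp [UpdateRule.onParam]⟩
  | projected a b ha hb =>
    refine ⟨1 / a, by positivity, fun v => ?_⟩
    rw [EuclideanSpace.norm_eq, EuclideanSpace.norm_sq_eq v]
    refine (Real.sqrt_le_sqrt (Finset.sum_sq_le_sq_sum_of_nonneg fun i _ =>
      norm_nonneg _)).trans ?_
    rw [Real.sqrt_sq (Finset.sum_nonneg fun i _ => norm_nonneg _), Finset.mul_sum]
    refine Finset.sum_le_sum fun i _ => ?_
    simp only [UpdateRule.onParam, PiLp.sub_apply, Real.norm_eq_abs, sq_abs]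
    exact abs_clip_sub_le ha (v i)

theorem UpdateRule.abs_onCost_le (U : UpdateRule) (s : ℝ) : |U.onCost s| ≤ |s| := by
  cases U with
  | plain => exact le_rfl
  | projected a b ha hb => exact abs_clip_le hb s

theorem UpdateRule.monotone_onCost (U : UpdateRule) : Monotone U.onCost := by
  cases U with
  | plain => exact monotone_id
  | projected a b ha hb =>
    exact fun x y h => max_le_max le_rfl (min_le_min_right _ h)

theorem UpdateRule.exists_onCost_sub_le (U : UpdateRule) :
    ∃ C, 0 ≤ C ∧ ∀ s, |U.onCost s - s| ≤ C * s ^ 2 := by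
  cases U with
  | plain => exact ⟨0, le_rfl, fun s => by simp [UpdateRule.onCost]⟩
  | projected a b ha hb => exact ⟨1 / b, by positivity, abs_clip_sub_le hb⟩

/-! ### Noise series and boundedness from below -/

theorem SeriesConverges.const_mul {f : ℕ → ℝ} (hf : SeriesConverges f) (c : ℝ) :
    SeriesConverges fun i => c * f i := by
  obtain ⟨L, hL⟩ := hf
  exact ⟨c * L, by simpa only [Finset.mul_sum] using hL.const_mul c⟩

theorem SeriesConverges.of_coordinates {l : ℕ} {f : ℕ → Param l}
    (h : ∀ i, SeriesConverges fun m => f m i) : SeriesConverges f := by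
  choose L hL using h
  refine ⟨WithLp.toLp 2 L, ?_⟩
  have h1 : Tendsto (fun n i => ∑ m ∈ Finset.range n, f m i) atTop (𝓝 L) :=
    tendsto_pi_nhds.2 hL
  refine (((PiLp.continuous_toLp 2 fun _ : Fin l => ℝ).tendsto L).comp h1).congr fun n => ?_
  ext i
  simp

/-- A sequence whose drift is nonnegative below a level, and bounded below everywhere, is bounded
below if its noise series converges. -/
theorem exists_lower_bound {x d e : ℕ → ℝ} {K D : ℝ} (hx : ∀ m, x m + d m + e m ≤ x (m + 1))
    (hd : ∀ m, x m ≤ -K → 0 ≤ d m) (hD : ∀ m, -D ≤ d m) (he : SeriesConverges e) :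
    ∃ b : ℕ, ∀ m, -(b : ℝ) ≤ x m := by
  obtain ⟨L, hL⟩ := he
  obtain ⟨B₁, hB₁⟩ := hL.bddAbove_range
  obtain ⟨B₂, hB₂⟩ := hL.bddBelow_range
  set E : ℕ → ℝ := fun n => ∑ i ∈ Finset.range n, e i with hE
  have hES : ∀ n, E (n + 1) = E n + e n := fun n => Finset.sum_range_succ _ _
  set c := min (x 0) (-K - B₁ - D) with hc
  have hT : ∀ n, c ≤ x n - E n := by
    intro n
    induction n with
    | zero =>
      simp only [hE, Finset.sum_range_zero, sub_zero]
      exact min_le_left _ _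
    | succ n ih =>
      have h1 := hx n
      have h2 := hES n
      rcases le_or_gt (x n) (-K) with h | h
      · have := hd n h
        linarith
      · have h3 : E n ≤ B₁ := hB₁ ⟨n, rfl⟩
        have h4 := hD n
        have h5 : c ≤ -K - B₁ - D := min_le_right _ _
        linarith
  obtain ⟨b, hb⟩ := exists_nat_ge (-(c + B₂))
  refine ⟨b, fun m => ?_⟩
  have h1 : B₂ ≤ E m := hB₂ ⟨m, rfl⟩
  linarith [hT m]

/-- Centering decreases second moments. -/
theorem sum_mul_sub_sq_le {ι : Type*} {p y : ι → ℝ} {μ V : ℝ} (hp0 : ∀ i, 0 ≤ p i)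
    (hp : HasSum p 1) (hy : HasSum (fun i => p i * y i) μ)
    (hV : ∀ s : Finset ι, ∑ i ∈ s, p i * y i ^ 2 ≤ V) (s : Finset ι) :
    ∑ i ∈ s, p i * (y i - μ) ^ 2 ≤ V := by
  have h1 : Summable fun i => p i * y i ^ 2 :=
    summable_of_sum_le (fun i => mul_nonneg (hp0 i) (sq_nonneg _)) hV
  have h2 := (h1.hasSum.sub (hy.mul_left (2 * μ))).add (hp.mul_left (μ ^ 2))
  have h3 : HasSum (fun i => p i * (y i - μ) ^ 2) (∑' i, p i * y i ^ 2 - 2 * μ * μ + μ ^ 2 * 1) :=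
    h2.congr_fun fun i => by ring
  refine (sum_le_hasSum s (fun i _ => mul_nonneg (hp0 i) (sq_nonneg _)) h3).trans ?_
  have h4 : ∑' i, p i * y i ^ 2 ≤ V := h1.tsum_le_of_sum_le hV
  nlinarith [sq_nonneg μ]

/-! ### The noise of the estimators -/

section Noise

variable {Ω H W Θ : Type*} [MeasurableSpace Ω] [Countable H] [MeasurableSpace H]
  [DiscreteMeasurableSpace H] [Countable W] [MeasurableSpace W] [DiscreteMeasurableSpace W]
  [NormedAddCommGroup Θ] [InnerProductSpace ℝ Θ]
  {ν : Measure Ω} [IsProbabilityMeasure ν] {hist : ℕ → Ω → H} {word : ℕ → Ω → W}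
  {𝓛 : LoopFamily Θ W} {θ : ℕ → H → Θ} {Λ : ℕ → H → ℝ} {γ M : ℕ → ℝ}

/-- The size of the estimators is square summable along the step sizes, where the cost estimates
are bounded below. -/
theorem ae_summable_sq (h : IsWordProcess ν hist word fun m a w => 𝓛.p w (θ m a))
    (hM : ∀ m, 1 < M m) (hγM : Summable fun m => (γ m * M m) ^ 2)
    (hΛ : ∀ᵐ ω ∂ν, ∃ b : ℕ, ∀ m, -(b : ℝ) ≤ Λ m (hist m ω)) :
    ∀ᵐ ω ∂ν, Summable fun m => (γ m * (𝓛.n (word m ω) *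
      truncExp (M m) (𝓛.logH (word m ω) (θ m (hist m ω)) (Λ m (hist m ω))))) ^ 2 := by
  classical
  have h1 : ∀ᵐ ω ∂ν, ∀ b : ℕ, Summable fun m =>
      if -(b : ℝ) ≤ Λ m (hist m ω) then (γ m * (𝓛.n (word m ω) *
        truncExp (M m) (𝓛.logH (word m ω) (θ m (hist m ω)) (Λ m (hist m ω))))) ^ 2 else 0 := by
    rw [ae_all_iff]
    intro b
    obtain ⟨C, hC, hCb⟩ := LoopFamily.sum_sq_truncExp_le (𝓛 := 𝓛) (Nat.cast_nonneg b)
    refine h.ae_summable (f := fun m a w => if -(b : ℝ) ≤ Λ m a then (γ m * (𝓛.n w *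
        truncExp (M m) (𝓛.logH w (θ m a) (Λ m a)))) ^ 2 else 0)
      (σ := fun m => C * (γ m * M m) ^ 2) (fun m a w => ?_) (fun m a s => ?_) (hγM.mul_left C)
      (fun m => by positivity)
    · split_ifs <;> positivity
    · split_ifs with hb
      · have := hCb (M m) (hM m) (θ m a) (Λ m a) hb s
        calc _ = γ m ^ 2 * ∑ w ∈ s, 𝓛.p w (θ m a) *
              (𝓛.n w * truncExp (M m) (𝓛.logH w (θ m a) (Λ m a))) ^ 2 := by
              rw [Finset.mul_sum]
              exact Finset.sum_congr rfl fun w _ => by ring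
          _ ≤ γ m ^ 2 * (C * M m ^ 2) := by gcongr
          _ = _ := by ring
      · simp only [mul_zero, Finset.sum_const_zero]
        positivity
  filter_upwards [h1, hΛ] with ω hω ⟨b, hb⟩
  exact (hω b).congr fun m => by rw [if_pos (hb m)]

/-- The centered estimators form convergent series, where the cost estimates are bounded below. -/
theorem ae_seriesConverges_noise (h : IsWordProcess ν hist word fun m a w => 𝓛.p w (θ m a))
    (hM : ∀ m, 1 < M m) (hγM : Summable fun m => (γ m * M m) ^ 2)
    (hΛ : ∀ᵐ ω ∂ν, ∃ b : ℕ, ∀ m, -(b : ℝ) ≤ Λ m (hist m ω)) {f : ℕ → H → W → ℝ} {μ : ℕ → H → ℝ}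
    (hμ : ∀ m a, HasSum (fun w => 𝓛.p w (θ m a) * f m a w) (μ m a)) {D : ℝ}
    (hf : ∀ m a w, |f m a w| ≤ D * (𝓛.n w * truncExp (M m) (𝓛.logH w (θ m a) (Λ m a)))) :
    ∀ᵐ ω ∂ν, SeriesConverges fun m =>
      γ m * (f m (hist m ω) (word m ω) - μ m (hist m ω)) := by
  classical
  have h1 : ∀ᵐ ω ∂ν, ∀ b : ℕ, SeriesConverges fun m =>
      if -(b : ℝ) ≤ Λ m (hist m ω) then
        γ m * (f m (hist m ω) (word m ω) - μ m (hist m ω)) else 0 := by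
    rw [ae_all_iff]
    intro b
    obtain ⟨C, hC, hCb⟩ := LoopFamily.sum_sq_truncExp_le (𝓛 := 𝓛) (Nat.cast_nonneg b)
    refine h.ae_seriesConverges (f := fun m a w => if -(b : ℝ) ≤ Λ m a then
        γ m * (f m a w - μ m a) else 0)
      (σ := fun m => D ^ 2 * C * (γ m * M m) ^ 2) (fun m a => ?_) (fun m a s => ?_)
      (hγM.mul_left _) (fun m => by positivity)
    · split_ifs with hb
      · have h2 := ((hμ m a).sub ((𝓛.hasSum_p (θ m a)).mul_right (μ m a))).mul_left (γ m)
        rw [one_mul, sub_self, mul_zero] at h2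
        exact h2.congr_fun fun w => by ring
      · simp
    · split_ifs with hb
      · have h2 := hCb (M m) (hM m) (θ m a) (Λ m a) hb
        have h3 := sum_mul_sub_sq_le (fun w => LoopFamily.p_nonneg w (θ m a)) (𝓛.hasSum_p (θ m a))
          (hμ m a)
          (V := D ^ 2 * (C * M m ^ 2)) (fun s => by
            refine le_trans (Finset.sum_le_sum fun w _ => ?_)
              ((Finset.mul_sum _ _ _).symm.le.trans
                (mul_le_mul_of_nonneg_left (h2 s) (sq_nonneg D)))
            rw [mul_left_comm, ← mul_pow]
            refine mul_le_mul_of_nonneg_left ?_ (LoopFamily.p_nonneg w (θ m a))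
            rw [← sq_abs]
            exact pow_le_pow_left₀ (abs_nonneg _) (hf m a w) 2) s
        calc _ = γ m ^ 2 * ∑ w ∈ s, 𝓛.p w (θ m a) * (f m a w - μ m a) ^ 2 := by
              rw [Finset.mul_sum]
              exact Finset.sum_congr rfl fun w _ => by ring
          _ ≤ γ m ^ 2 * (D ^ 2 * (C * M m ^ 2)) := by gcongr
          _ = _ := by ring
      · simp only [ne_eq, OfNat.ofNat_ne_zero, not_false_eq_true, zero_pow, mul_zero,
          Finset.sum_const_zero]
        positivity
  filter_upwards [h1, hΛ] with ω hω ⟨b, hb⟩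
  have := hω b
  simp only [hb, if_true] at this
  exact this

end Noise

/-! ### Convergence of the algorithm on a process of words -/

section Convergence

variable {Ω H W : Type*} [MeasurableSpace Ω] [Countable H] [MeasurableSpace H]
  [DiscreteMeasurableSpace H] [Countable W] [MeasurableSpace W] [DiscreteMeasurableSpace W]
  {ν : Measure Ω} [IsProbabilityMeasure ν] {hist : ℕ → Ω → H} {word : ℕ → Ω → W}
  {l : ℕ} {𝓛 : LoopFamily (Param l) W} {θ : ℕ → H → Param l} {Λ : ℕ → H → ℝ} {γ M : ℕ → ℝ}

/-- The bound of the increment of the cost estimate by quantities with summable squares. -/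
theorem sq_increment_le (η : ℝ) {g G n : ℝ} (hG : 0 ≤ G) (hn : 1 ≤ n) :
    (η * g * (G - 1)) ^ 2 ≤ 2 * η ^ 2 * (g * (n * G)) ^ 2 + 2 * η ^ 2 * g ^ 2 := by
  have h1 : (G - 1) ^ 2 ≤ 2 * (n * G) ^ 2 + 2 := by
    have h2 : G ^ 2 ≤ (n * G) ^ 2 := pow_le_pow_left₀ hG (le_mul_of_one_le_left hG hn) 2
    nlinarith [sq_nonneg (G + 1)]
  calc (η * g * (G - 1)) ^ 2 = (η ^ 2 * g ^ 2) * (G - 1) ^ 2 := by ring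
    _ ≤ (η ^ 2 * g ^ 2) * (2 * (n * G) ^ 2 + 2) := by gcongr
    _ = _ := by ring

/-- The cost estimates are almost surely bounded below: the increments dominate those computed
with the estimate raised to at least `-K`, whose variances are controlled, and whose means are
nonnegative below `-K`. -/
theorem ae_lower_bound (h : IsWordProcess ν hist word fun m a w => 𝓛.p w (θ m a))
    (hγ : ∀ m, 0 < γ m) (hγ2 : Summable fun m => γ m ^ 2) (hM : ∀ m, 1 < M m)
    (hγM : Summable fun m => (γ m * M m) ^ 2) {η : ℝ} (hη : 0 < η) (U : UpdateRule)
    (hΛ : ∀ᵐ ω ∂ν, ∀ m, Λ (m + 1) (hist (m + 1) ω) = Λ m (hist m ω) + U.onCost (η * γ m *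
      (truncExp (M m) (𝓛.logH (word m ω) (θ m (hist m ω)) (Λ m (hist m ω))) - 1))) :
    ∀ᵐ ω ∂ν, ∃ b : ℕ, ∀ m, -(b : ℝ) ≤ Λ m (hist m ω) := by
  set Λ' : ℕ → H → ℝ := fun m a => max (Λ m a) (-𝓛.K) with hΛ'
  have hb' : ∀ᵐ ω ∂ν, ∃ b : ℕ, ∀ m, -(b : ℝ) ≤ Λ' m (hist m ω) := by
    obtain ⟨b, hb⟩ := exists_nat_ge 𝓛.K
    exact ae_of_all _ fun ω => ⟨b, fun m => (neg_le_neg hb).trans (le_max_right _ _)⟩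
  have hT := fun m => isTruncation_truncExp (hM m)
  have s1 := ae_seriesConverges_noise (Λ := Λ') h hM hγM hb'
    (f := fun m a w => truncExp (M m) (𝓛.logH w (θ m a) (Λ' m a)))
    (μ := fun m a => 𝓛.g (truncExp (M m)) (θ m a) (Λ' m a)) (D := 1)
    (fun m a => (LoopFamily.summable_truncExp (hM m) _ _).hasSum) (fun m a w => by
      rw [abs_of_pos ((hT m).pos _), one_mul]
      exact le_mul_of_one_le_left ((hT m).pos _).le (LoopFamily.one_le_n w))
  have s2 := ae_summable_sq (Λ := Λ') h hM hγM hb'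
  obtain ⟨C, hC, hCU⟩ := U.exists_onCost_sub_le
  obtain ⟨B, hB⟩ := hγ2.tendsto_atTop_zero.bddAbove_range
  filter_upwards [s1, s2, hΛ] with ω h1 h2 h3
  set G : ℕ → ℝ := fun m => truncExp (M m) (𝓛.logH (word m ω) (θ m (hist m ω)) (Λ' m (hist m ω)))
    with hG
  set g : ℕ → ℝ := fun m => 𝓛.g (truncExp (M m)) (θ m (hist m ω)) (Λ' m (hist m ω)) with hg
  have hG0 : ∀ m, 0 ≤ G m := fun m => ((hT m).pos _).le
  have hg0 : ∀ m, 0 ≤ g m := fun m => tsum_nonneg fun w =>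
    mul_nonneg (LoopFamily.p_nonneg w _) ((hT m).pos _).le
  refine exists_lower_bound (x := fun m => Λ m (hist m ω)) (d := fun m => η * γ m * (g m - 1))
    (e := fun m => η * (γ m * (G m - g m)) +
      (U.onCost (η * γ m * (G m - 1)) - η * γ m * (G m - 1)))
    (K := 𝓛.K) (D := η * (1 + B)) (fun m => ?_) (fun m hm => ?_) (fun m => ?_)
    ((h1.const_mul η).add (SeriesConverges.of_abs_le (g := fun m => C * (2 * η ^ 2 *
      (γ m * (𝓛.n (word m ω) * G m)) ^ 2 + 2 * η ^ 2 * γ m ^ 2))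
      (((h2.mul_left _).add (hγ2.mul_left _)).mul_left C) fun m => ?_))
  · have h4 : G m ≤ truncExp (M m) (𝓛.logH (word m ω) (θ m (hist m ω)) (Λ m (hist m ω))) :=
      (hT m).mono (LoopFamily.logH_anti _ _ (le_max_left _ _))
    have h5 : η * γ m * (G m - 1) ≤ η * γ m * (truncExp (M m)
        (𝓛.logH (word m ω) (θ m (hist m ω)) (Λ m (hist m ω))) - 1) := by
      have := hγ m
      gcongr
    have h6 := U.monotone_onCost h5
    rw [h3 m]
    linarith
  · have h4 : Λ' m (hist m ω) = -𝓛.K := max_eq_right hm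
    have h5 : 1 ≤ g m := by
      simp only [hg, h4]
      exact LoopFamily.one_le_g_truncExp (hM m) _ le_rfl
    have := hγ m
    have : 0 ≤ g m - 1 := by linarith
    positivity
  · have h4 : γ m ≤ 1 + B := by
      have : γ m ^ 2 ≤ B := hB ⟨m, rfl⟩
      nlinarith [sq_nonneg (γ m - 1)]
    have h5 : -(η * γ m) ≤ η * γ m * (g m - 1) := by
      have := hγ m
      have := hg0 m
      have : 0 ≤ η * γ m * g m := by positivity
      linarith
    have h6 : η * γ m ≤ η * (1 + B) := by gcongr
    linarith
  · refine (hCU _).trans (mul_le_mul_of_nonneg_left ?_ hC)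
    exact sq_increment_le η (hG0 m) (LoopFamily.one_le_n _)

/-- Almost sure convergence of the algorithm, for a sequence of levels with summable uniform
increments. -/
theorem ae_tendsto_levels (h : IsWordProcess ν hist word fun m a w => 𝓛.p w (θ m a))
    (hγ : ∀ m, 0 < γ m) (hγs : Tendsto (fun n => ∑ m ∈ Finset.range n, γ m) atTop atTop)
    (hγ2 : Summable fun m => γ m ^ 2) (hM : ∀ m, 1 < M m)
    (hγM : Summable fun m => (γ m * M m) ^ 2) {η : ℝ} (hη : 0 < η) (U : UpdateRule)
    (hθ : ∀ᵐ ω ∂ν, ∀ m, θ (m + 1) (hist (m + 1) ω) = θ m (hist m ω) - U.onParam (γ m •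
      𝓛.est (truncExp (M m)) (truncExpDeriv (M m)) (word m ω) (θ m (hist m ω)) (Λ m (hist m ω))))
    (hΛ : ∀ᵐ ω ∂ν, ∀ m, Λ (m + 1) (hist (m + 1) ω) = Λ m (hist m ω) + U.onCost (η * γ m *
      (truncExp (M m) (𝓛.logH (word m ω) (θ m (hist m ω)) (Λ m (hist m ω))) - 1)))
    {lev : ℕ → Param l → ℝ} (hlev : ∀ m ϑ, 𝓛.g (truncExp (M m)) ϑ (lev m ϑ) = 1) {ρ : ℕ → ℝ}
    (hρ : ∀ m ϑ, |lev (m + 1) ϑ - lev m ϑ| ≤ ρ m) (hρs : Summable ρ) :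
    ∀ᵐ ω ∂ν, (∃ L, Tendsto (fun m => lev m (θ m (hist m ω))) atTop (𝓝 L)) ∧
      Tendsto (fun m => 𝓛.gradRoot (truncExp (M m)) (truncExpDeriv (M m)) (lev m)
        (θ m (hist m ω))) atTop (𝓝 0) := by
  have hb := ae_lower_bound h hγ hγ2 hM hγM hη U hΛ
  have hT := fun m => isTruncation_truncExp (hM m)
  have hA : 0 ≤ 𝓛.A := zero_le_one.trans 𝓛.one_le_A
  obtain ⟨C, ε, hε, hgood, -⟩ := 𝓛.exists_goodLevel
  obtain ⟨ψ₁, ψ₂, hψ₁, hψ₂, hmain⟩ := exists_lyapunov_tests (Θ := Param l) (K := 𝓛.K) (C := C)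
    (LoopFamily.minSlope_pos (𝓛 := 𝓛)) hε hη
  set F : ℕ → H → W → Param l := fun m a w =>
    𝓛.est (truncExp (M m)) (truncExpDeriv (M m)) w (θ m a) (Λ m a) with hF
  set J : ℕ → H → Param l := fun m a =>
    𝓛.J (truncExp (M m)) (truncExpDeriv (M m)) (θ m a) (Λ m a) with hJ
  set G : ℕ → H → W → ℝ := fun m a w => truncExp (M m) (𝓛.logH w (θ m a) (Λ m a)) with hG
  set g : ℕ → H → ℝ := fun m a => 𝓛.g (truncExp (M m)) (θ m a) (Λ m a) with hg
  set dh : ℕ → Param l → Param l := fun m =>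
    𝓛.gradRoot (truncExp (M m)) (truncExpDeriv (M m)) (lev m) with hdh
  have hlevel := fun m => hgood (M m) (hM m) (lev m) (hlev m)
  have hG0 : ∀ m a w, 0 ≤ G m a w := fun m a w => ((hT m).pos _).le
  have hF1 : ∀ m a w, ‖F m a w‖ ≤ 2 * 𝓛.A * (𝓛.n w * G m a w) := fun m a w =>
    LoopFamily.norm_est_le (hT m) w _ _
  -- all the martingale noises are linear combinations of the centered estimators
  have hnoise : ∀ (u : ℕ → H → Param l) (s : ℕ → H → ℝ) (D : ℝ), 0 ≤ D → (∀ m a, ‖u m a‖ ≤ D) →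
      (∀ m a, |s m a| ≤ D) → ∀ᵐ ω ∂ν, SeriesConverges fun m =>
        γ m * (inner ℝ (u m (hist m ω)) (F m (hist m ω) (word m ω))
            + s m (hist m ω) * G m (hist m ω) (word m ω)
          - (inner ℝ (u m (hist m ω)) (J m (hist m ω)) + s m (hist m ω) * g m (hist m ω))) := by
    intro u s D hD hu hs
    refine ae_seriesConverges_noise h hM hγM hb
      (f := fun m a w => inner ℝ (u m a) (F m a w) + s m a * G m a w)
      (μ := fun m a => inner ℝ (u m a) (J m a) + s m a * g m a) (D := D * (2 * 𝓛.A) + D)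
      (fun m a => ?_) fun m a w => ?_
    · have h1 := ((LoopFamily.moment_truncExp (𝓛 := 𝓛) (hM m) (abs_nonneg (Λ m a)) (θ m a)
        (neg_abs_le _)).summable_J (hT m) (half_pos 𝓛.κ_pos)).1.hasSum
      have h2 := (innerSL ℝ (u m a)).hasSum h1
      have h3 := (LoopFamily.summable_truncExp (𝓛 := 𝓛) (hM m) (θ m a) (Λ m a)).hasSum.mul_left
        (s m a)
      refine (h2.add h3).congr_fun fun w => ?_
      simp only [innerSL_apply_apply, inner_smul_right, hF, hG]
      ring
    · have hn := mul_nonneg (zero_le_one.trans (LoopFamily.one_le_n (𝓛 := 𝓛) w)) (hG0 m a w)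
      have h1 : |inner ℝ (u m a) (F m a w)| ≤ D * (2 * 𝓛.A * (𝓛.n w * G m a w)) :=
        (abs_real_inner_le_norm _ _).trans
          (mul_le_mul (hu m a) (hF1 m a w) (norm_nonneg _) hD)
      have h2 : |s m a * G m a w| ≤ D * (𝓛.n w * G m a w) := by
        rw [abs_mul, abs_of_nonneg (hG0 m a w)]
        exact mul_le_mul (hs m a) (le_mul_of_one_le_left (hG0 m a w) (LoopFamily.one_le_n w))
          (hG0 m a w) hD
      refine (abs_add_le _ _).trans ((add_le_add h1 h2).trans (le_of_eq ?_))
      ring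
  have hC : 0 ≤ C := (norm_nonneg _).trans ((hlevel 0).norm_dh 0)
  set z : ℕ → H → ℝ := fun m a => Λ m a - lev m (θ m a) with hz
  have hdhC : ∀ m a, ‖dh m (θ m a)‖ ≤ C := fun m a => (hlevel m).norm_dh _
  have hψn : ∀ ψ : ℝ → ℝ, (∀ t, |ψ t| ≤ 1) → ∀ᵐ ω ∂ν, SeriesConverges fun m =>
      γ m * (inner ℝ (ψ (z m (hist m ω)) • dh m (θ m (hist m ω))) (F m (hist m ω) (word m ω))
            + (ψ (z m (hist m ω)) * η) * G m (hist m ω) (word m ω)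
          - (inner ℝ (ψ (z m (hist m ω)) • dh m (θ m (hist m ω))) (J m (hist m ω))
            + (ψ (z m (hist m ω)) * η) * g m (hist m ω))) := fun ψ hψ =>
    hnoise (fun m a => ψ (z m a) • dh m (θ m a)) (fun m a => ψ (z m a) * η) (C + η)
      (by positivity) (fun m a => by
        rw [norm_smul, Real.norm_eq_abs]
        refine (mul_le_mul (hψ _) (hdhC m a) (norm_nonneg _) zero_le_one).trans ?_
        linarith) (fun m a => by
        rw [abs_mul, abs_of_pos hη]
        refine (mul_le_mul_of_nonneg_right (hψ _) hη.le).trans ?_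
        linarith)
  have n1 : ∀ᵐ ω ∂ν, ∀ i : Fin l, _ := ae_all_iff.2 fun i : Fin l =>
    hnoise (fun _ _ => EuclideanSpace.single i 1) (fun _ _ => 0) 1 zero_le_one (by simp) (by simp)
  have n2 := hnoise (fun _ _ => 0) (fun _ _ => 1) 1 zero_le_one (by simp) (by simp)
  have n3 := hnoise (fun m a => dh m (θ m a)) (fun _ _ => 0) C hC hdhC
    (fun _ _ => by simpa using hC)
  obtain ⟨CP, hCP, hUP⟩ := UpdateRule.exists_onParam_sub_le (l := l) U
  obtain ⟨CC, hCC, hUC⟩ := U.exists_onCost_sub_le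
  filter_upwards [n1, n2, n3, hψn ψ₁ hψ₁, hψn ψ₂ hψ₂, ae_summable_sq h hM hγM hb, hθ, hΛ]
    with ω h1 h2 h3 h4 h5 hq hθω hΛω
  set Q : ℕ → ℝ := fun m => (γ m * (𝓛.n (word m ω) * G m (hist m ω) (word m ω))) ^ 2 with hQ
  have hQs : Summable Q := hq
  set Fω : ℕ → Param l := fun m => F m (hist m ω) (word m ω) with hFω
  set Gω : ℕ → ℝ := fun m => G m (hist m ω) (word m ω) with hGω
  set Jω : ℕ → Param l := fun m => J m (hist m ω) with hJω
  set gω : ℕ → ℝ := fun m => g m (hist m ω) with hgω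
  set rP : ℕ → Param l := fun m => U.onParam (γ m • Fω m) - γ m • Fω m with hrP
  set rC : ℕ → ℝ := fun m => U.onCost (η * γ m * (Gω m - 1)) - η * γ m * (Gω m - 1) with hrC
  have hFQ : ∀ m, ‖γ m • Fω m‖ ^ 2 ≤ (2 * 𝓛.A) ^ 2 * Q m := fun m => by
    rw [norm_smul, Real.norm_of_nonneg (hγ m).le, hQ, ← mul_pow]
    refine pow_le_pow_left₀ (mul_nonneg (hγ m).le (norm_nonneg _)) ?_ 2
    rw [mul_left_comm]
    exact mul_le_mul_of_nonneg_left (hF1 m _ _) (hγ m).le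
  have hrPs : Summable fun m => ‖rP m‖ :=
    Summable.of_nonneg_of_le (fun m => norm_nonneg _) (fun m => (hUP _).trans
      (mul_le_mul_of_nonneg_left (hFQ m) hCP)) ((hQs.mul_left _).mul_left CP)
  have hsq : ∀ m, (η * γ m * (Gω m - 1)) ^ 2 ≤ 2 * η ^ 2 * Q m + 2 * η ^ 2 * γ m ^ 2 := fun m =>
    sq_increment_le η (hG0 m _ _) (LoopFamily.one_le_n _)
  have hsqs : Summable fun m => 2 * η ^ 2 * Q m + 2 * η ^ 2 * γ m ^ 2 :=
    (hQs.mul_left _).add (hγ2.mul_left _)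
  have hrCs : Summable fun m => |rC m| :=
    Summable.of_nonneg_of_le (fun m => abs_nonneg _) (fun m => (hUC _).trans
      (mul_le_mul_of_nonneg_left (hsq m) hCC)) (hsqs.mul_left CC)
  have hdrP : Summable fun m => inner ℝ (dh m (θ m (hist m ω))) (rP m) :=
    (hrPs.mul_left C).of_norm_bounded fun m =>
      (norm_inner_le_norm _ _).trans (mul_le_mul_of_nonneg_right (hdhC m _) (norm_nonneg _))
  set ξ : ℕ → Param l := fun m => -(γ m • (Fω m - Jω m)) - rP m with hξ
  set ζ : ℕ → ℝ := fun m => η * γ m * (Gω m - gω m) + rC m with hζ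
  have hψseries : ∀ ψ : ℝ → ℝ, (∀ t, |ψ t| ≤ 1) → (SeriesConverges fun m =>
      γ m * (inner ℝ (ψ (z m (hist m ω)) • dh m (θ m (hist m ω))) (Fω m)
            + (ψ (z m (hist m ω)) * η) * Gω m
          - (inner ℝ (ψ (z m (hist m ω)) • dh m (θ m (hist m ω))) (Jω m)
            + (ψ (z m (hist m ω)) * η) * gω m))) →
      SeriesConverges fun m =>
        ψ (z m (hist m ω)) * (ζ m - inner ℝ (dh m (θ m (hist m ω))) (ξ m)) := by
    intro ψ hψ hs
    have hr : Summable fun m =>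
        ψ (z m (hist m ω)) * (rC m + inner ℝ (dh m (θ m (hist m ω))) (rP m)) :=
      (hrCs.add hdrP.norm).of_norm_bounded fun m => by
        rw [norm_mul]
        refine (mul_le_of_le_one_left (norm_nonneg _) (hψ _)).trans ?_
        exact norm_add_le _ _
    refine (congrArg SeriesConverges (funext fun m => ?_)).mp
      (hs.add (SeriesConverges.of_summable hr))
    simp only [hζ, hξ, inner_sub_right, inner_neg_right, inner_smul_right, real_inner_smul_left]
    ring
  refine hmain γ (fun m ϑ x => 𝓛.g (truncExp (M m)) ϑ x)
    (fun m ϑ x => 𝓛.J (truncExp (M m)) (truncExpDeriv (M m)) ϑ x) lev dh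
    (fun m => θ m (hist m ω)) ξ (fun m => Λ m (hist m ω)) ζ ρ hγ hγs hlevel hρ hρs
    (fun m => ?_) (fun m => ?_) (SeriesConverges.of_coordinates fun i => ?_) ?_ ?_
    (hψseries ψ₁ hψ₁ h4) (hψseries ψ₂ hψ₂ h5) ?_ ?_
  · rw [hθω m]
    simp only [hξ, hrP, hFω, hJω, hF, hJ, smul_sub]
    abel
  · rw [hΛω m]
    simp only [hζ, hrC, hGω, hgω, hG, hg]
    ring
  · have hr : Summable fun m => rP m i :=
      hrPs.of_norm_bounded fun m => PiLp.norm_apply_le (rP m) i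
    refine (congrArg SeriesConverges (funext fun m => ?_)).mp
      ((h1 i).neg.sub (SeriesConverges.of_summable hr))
    simp only [EuclideanSpace.inner_single_left, map_one, one_mul, zero_mul, add_zero, hξ,
      PiLp.sub_apply, PiLp.neg_apply, PiLp.smul_apply, smul_eq_mul, hFω, hJω]
  · refine (congrArg SeriesConverges (funext fun m => ?_)).mp
      ((h2.const_mul η).add (SeriesConverges.of_summable hrCs.of_abs))
    simp only [inner_zero_left, zero_add, one_mul, hζ, hGω, hgω]
    ring
  · refine (congrArg SeriesConverges (funext fun m => ?_)).mp
      (h3.neg.sub (SeriesConverges.of_summable hdrP))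
    simp only [zero_mul, add_zero, hξ, inner_sub_right, inner_neg_right, inner_smul_right, hFω,
      hJω]
  · refine Summable.of_nonneg_of_le (fun m => sq_nonneg _) (fun m => ?_)
      (hQs.mul_left ((2 * 𝓛.A) ^ 2))
    rw [hθω m, sub_sub_cancel_left, norm_neg]
    exact (pow_le_pow_left₀ (norm_nonneg _) (U.norm_onParam_le _) 2).trans (hFQ m)
  · refine Summable.of_nonneg_of_le (fun m => sq_nonneg _) (fun m => ?_) hsqs
    rw [hΛω m, add_sub_cancel_left, ← sq_abs]
    refine (pow_le_pow_left₀ (abs_nonneg _) (U.abs_onCost_le _) 2).trans ?_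
    rw [sq_abs]
    exact hsq m

end Convergence

/-! ### Convergence of the algorithm along controlled paths -/

section Main

variable {l : ℕ} {X : Type*} [Fintype X] [DecidableEq X] [MeasurableSpace X]
  [DiscreteMeasurableSpace X] {S : Model l X}
  {𝓛 : LoopFamily (Param l) (List {x : X // x ≠ S.xstar})}

namespace IsLoopFamilyOf

theorem hasGradientAt_truncCost (h𝓛 : IsLoopFamilyOf S 𝓛) {M : ℝ} (hM : 1 < M) (θ : Param l) :
    HasGradientAt (S.truncCost M)
      (𝓛.gradRoot (truncExp M) (truncExpDeriv M) (S.truncCost M) θ) θ := by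
  obtain ⟨C, ε, -, hgood, -⟩ := 𝓛.exists_goodLevel
  exact hasGradientAt_of_taylor (hgood M hM _ (h𝓛.g_truncCost hM)).taylor θ

theorem truncCost_mono (h𝓛 : IsLoopFamilyOf S 𝓛) {M M' : ℝ} (hM : 1 < M) (hMM' : M ≤ M')
    (θ : Param l) : S.truncCost M θ ≤ S.truncCost M' θ :=
  LoopFamily.root_mono hM hMM' (h𝓛.g_truncCost hM θ) (h𝓛.g_truncCost (hM.trans_le hMM') θ)

/-- Almost sure convergence of the algorithm for truncation levels whose costs have summable
uniform increments. The first cycle, which need not start at `xstar`, is left out: the loops after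
it form a process of words. -/
theorem ae_tendsto_truncCost (h𝓛 : IsLoopFamilyOf S 𝓛) {γ : ℕ → ℝ} (hγ : IsStepSize γ) {η : ℝ}
    (hη : 0 < η) (U : UpdateRule) (θ₀ : Param l) (Λ₀ : ℝ) {Ω : Type*} [mΩ : MeasurableSpace Ω]
    {μ : Measure Ω} [IsProbabilityMeasure μ] {𝓕 : Filtration ℕ mΩ} {Φ : ℕ → Ω → X} {M : ℕ → ℝ}
    (hM : ∀ m, 1 < M m) (hγM : Summable fun m => (γ m * M m) ^ 2) {ρ : ℕ → ℝ}
    (hρ : ∀ m ϑ, |S.truncCost (M (m + 1)) ϑ - S.truncCost (M m) ϑ| ≤ ρ m) (hρs : Summable ρ)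
    (hΦ : S.IsControlledPath U γ η M θ₀ Λ₀ μ 𝓕 Φ) :
    ∀ᵐ w ∂μ,
      (∃ c : ℝ, Tendsto (fun m => S.truncCost (M m)
        (S.iterate U γ η M θ₀ Λ₀ (fun k => Φ k w) m).1) atTop (𝓝 c)) ∧
      Tendsto (fun m => gradient (S.truncCost (M m))
        (S.iterate U γ η M θ₀ Λ₀ (fun k => Φ k w) m).1) atTop (𝓝 0) := by
  have hpath : Measurable fun ω k => Φ k ω :=
    measurable_pi_lambda _ fun k => (hΦ.adapted k).mono (𝓕.le k) le_rfl
  set ν : Measure (ℕ → X) := μ.map fun ω k => Φ k ω with hν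
  have : IsProbabilityMeasure ν := Measure.isProbabilityMeasure_map hpath.aemeasurable
  have hstep := hΦ.real_prefixSet_succ U γ η M θ₀ Λ₀
  have hfol := ae_follows_words U γ η M θ₀ Λ₀ hstep h𝓛.hasSum_loopProb
  have hword := isWordProcess_words U γ η M θ₀ Λ₀ hstep h𝓛.hasSum_loopProb
  simp only [← h𝓛.p_eq] at hword
  have hrec : ∀ (ω : ℕ → X) (m : ℕ), stateOf S U γ η M θ₀ Λ₀ (ω 0) (words S.xstar ω (m + 2))
      = ((stateOf S U γ η M θ₀ Λ₀ (ω 0) (words S.xstar ω (m + 1))).1 - U.onParam (γ (m + 1) •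
          𝓛.est (truncExp (M (m + 1))) (truncExpDeriv (M (m + 1)))
            (firstLoop S.xstar fun i => ω (duration (words S.xstar ω (m + 1)) + i))
            (stateOf S U γ η M θ₀ Λ₀ (ω 0) (words S.xstar ω (m + 1))).1
            (stateOf S U γ η M θ₀ Λ₀ (ω 0) (words S.xstar ω (m + 1))).2),
        (stateOf S U γ η M θ₀ Λ₀ (ω 0) (words S.xstar ω (m + 1))).2 + U.onCost (η * γ (m + 1) *
          (truncExp (M (m + 1)) (𝓛.logH
            (firstLoop S.xstar fun i => ω (duration (words S.xstar ω (m + 1)) + i))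
            (stateOf S U γ η M θ₀ Λ₀ (ω 0) (words S.xstar ω (m + 1))).1
            (stateOf S U γ η M θ₀ Λ₀ (ω 0) (words S.xstar ω (m + 1))).2) - 1))) := by
    intro ω m
    have he : endpoint (ω 0) (words S.xstar ω (m + 1)) = S.xstar := rfl
    have hl := isLoop_loopPath S.xstar S.xstar
      (firstLoop S.xstar fun i => ω (duration (words S.xstar ω (m + 1)) + i))
    conv_lhs => rw [words, stateOf]
    rw [length_words, he, h𝓛.F_eq (loopPath_zero _ _ _) hl (hM _),
      h𝓛.G_eq (loopPath_zero _ _ _) hl (hM _)]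
  have hmain := ae_tendsto_levels (𝓛 := 𝓛)
    (θ := fun _ (a : X × List (List {y : X // y ≠ S.xstar})) => (stateOf S U γ η M θ₀ Λ₀ a.1 a.2).1)
    (Λ := fun _ (a : X × List (List {y : X // y ≠ S.xstar})) => (stateOf S U γ η M θ₀ Λ₀ a.1 a.2).2)
    (γ := fun m => γ (m + 1)) (M := fun m => M (m + 1)) hword (fun m => hγ.pos _)
    (by
      have h1 := tendsto_atTop_add_const_right atTop (-γ 0)
        ((tendsto_add_atTop_iff_nat 1).2 hγ.sum_diverges)
      refine h1.congr fun n => ?_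
      rw [Finset.sum_range_succ', add_neg_cancel_right])
    ((summable_nat_add_iff 1).2 hγ.sum_sq) (fun m => hM _) ((summable_nat_add_iff 1).2 hγM) hη U
    (ae_of_all _ fun ω m => congrArg Prod.fst (hrec ω m))
    (ae_of_all _ fun ω m => congrArg Prod.snd (hrec ω m))
    (lev := fun m => S.truncCost (M (m + 1))) (fun m ϑ => h𝓛.g_truncCost (hM _) ϑ)
    (ρ := fun m => ρ (m + 1)) (fun m ϑ => hρ (m + 1) ϑ) ((summable_nat_add_iff 1).2 hρs)
  have hμ := (ae_of_ae_map hpath.aemeasurable hmain).and (ae_of_ae_map hpath.aemeasurable hfol)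
  filter_upwards [hμ] with w ⟨⟨⟨c, hc⟩, hg⟩, hf⟩
  have hit : ∀ m, S.iterate U γ η M θ₀ Λ₀ (fun k => Φ k w) (m + 1)
      = stateOf S U γ η M θ₀ Λ₀ (Φ 0 w) (words S.xstar (fun k => Φ k w) (m + 1)) := fun m => by
    have := (hf (m + 1)).iterate_eq U γ η M θ₀ Λ₀
    rwa [length_words] at this
  refine ⟨⟨c, (tendsto_add_atTop_iff_nat 1).1 ?_⟩, (tendsto_add_atTop_iff_nat 1).1 ?_⟩
  · simpa only [hit] using hc
  · simpa only [hit, (h𝓛.hasGradientAt_truncCost (hM _) _).gradient] using hg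

/-- Along a nondecreasing choice of levels in a truncation sequence with summable uniform
increments of the costs, the increments stay summable. -/
theorem exists_summable_increments (h𝓛 : IsLoopFamilyOf S 𝓛) {N : ℕ → ℝ} (hN : ∀ i, 1 < N i)
    (hS : S.SummableTruncation N) {M : ℕ → ℝ} (hM : Monotone M) (hMN : ∀ m, ∃ i, M m = N i) :
    ∃ ρ : ℕ → ℝ, Summable ρ ∧
      ∀ m ϑ, |S.truncCost (M (m + 1)) ϑ - S.truncCost (M m) ϑ| ≤ ρ m := by
  obtain ⟨hNmono, -, hsum⟩ := hS
  set s : ℕ → ℝ≥0∞ := fun i =>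
    ⨆ θ, ENNReal.ofReal (S.truncCost (N (i + 1)) θ - S.truncCost (N i) θ) with hs
  have hd : Summable fun i => (s i).toReal := ENNReal.summable_toReal hsum
  have hd0 : ∀ i, 0 ≤ (s i).toReal := fun i => ENNReal.toReal_nonneg
  have hinc : ∀ i ϑ, S.truncCost (N (i + 1)) ϑ - S.truncCost (N i) ϑ ≤ (s i).toReal := fun i ϑ =>
    (ENNReal.ofReal_le_iff_le_toReal (ENNReal.ne_top_of_tsum_ne_top hsum i)).1
      (le_iSup (fun θ => ENNReal.ofReal (S.truncCost (N (i + 1)) θ - S.truncCost (N i) θ)) ϑ)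
  set T : ℕ → ℝ := fun n => ∑ i ∈ Finset.range n, (s i).toReal with hT
  have hTmono : Monotone T := monotone_nat_of_le_succ fun n => by
    simp only [hT, Finset.sum_range_succ, le_add_iff_nonneg_right, hd0]
  have hinc' : ∀ {i k}, i ≤ k → ∀ ϑ, S.truncCost (N k) ϑ - S.truncCost (N i) ϑ ≤ T k - T i := by
    intro i k hik ϑ
    induction k, hik using Nat.le_induction with
    | base => simp
    | succ k _ ih =>
      have h1 := hinc k ϑ
      have h2 : T (k + 1) = T k + (s k).toReal := Finset.sum_range_succ _ _
      linarith
  -- the least index of a level is a monotone function of the level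
  set j : ℕ → ℕ := fun m => sInf {i | M m = N i} with hj
  have hjN : ∀ m, M m = N (j m) := fun m => Nat.sInf_mem (hMN m)
  have hjmono : ∀ m, j m ≤ j (m + 1) := by
    intro m
    rcases (hM m.le_succ).eq_or_lt with h | h
    · exact le_of_eq (by simp only [hj, h])
    · by_contra! hlt
      have := hNmono hlt.le
      rw [← hjN, ← hjN] at this
      exact absurd this (not_le.2 h)
  refine ⟨fun m => T (j (m + 1)) - T (j m), ?_, fun m ϑ => ?_⟩
  · refine summable_of_sum_range_le (c := ∑' i, (s i).toReal)
      (fun m => sub_nonneg.2 (hTmono (hjmono m))) fun n => ?_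
    rw [Finset.sum_range_sub fun m => T (j m)]
    have h1 : T (j n) ≤ ∑' i, (s i).toReal := hd.sum_le_tsum _ fun i _ => hd0 i
    have h2 : 0 ≤ T (j 0) := Finset.sum_nonneg fun i _ => hd0 i
    linarith
  · rw [hjN m, hjN (m + 1), abs_of_nonneg (sub_nonneg.2
      (h𝓛.truncCost_mono (hN _) (hNmono (hjmono m)) ϑ))]
    exact hinc' (hjmono m) ϑ

end IsLoopFamilyOf

/-- Functions with uniform Taylor bounds that converge uniformly along a sequence of points have
gradients that approach each other along it. -/
theorem tendsto_grad_of_tendsto {Θ : Type*} [NormedAddCommGroup Θ] [InnerProductSpace ℝ Θ]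
    {C : ℝ} {h : Θ → ℝ} {dh : Θ → Θ} {hs : ℕ → Θ → ℝ} {dhs : ℕ → Θ → Θ} (hC : 0 ≤ C)
    (H : ∀ θ v, |h (θ + v) - h θ - inner ℝ (dh θ) v| ≤ C * ‖v‖ ^ 2)
    (Hs : ∀ m θ v, |hs m (θ + v) - hs m θ - inner ℝ (dhs m θ) v| ≤ C * ‖v‖ ^ 2)
    (hlim : ∀ δ > 0, ∀ᶠ m in atTop, ∀ θ, |h θ - hs m θ| ≤ δ) {θ : ℕ → Θ}
    (hg : Tendsto (fun m => dhs m (θ m)) atTop (𝓝 0)) :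
    Tendsto (fun m => dh (θ m)) atTop (𝓝 0) := by
  have h1 : Tendsto (fun m => dh (θ m) - dhs m (θ m)) atTop (𝓝 0) := by
    rw [Metric.tendsto_atTop']
    intro ε hε
    set r := ε / (4 * (C + 1)) with hr
    have hr0 : 0 < r := by positivity
    obtain ⟨n, hn⟩ := eventually_atTop.1 (hlim (ε * r / 8) (by positivity))
    refine ⟨n, fun m hm => ?_⟩
    rw [dist_zero_right]
    refine (norm_grad_sub_le H (Hs m) hC hr0 (hn m hm.le) (θ m)).trans_lt ?_
    have e1 : 2 * (ε * r / 8) / r = ε / 4 := by field_simp; ring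
    have e2 : 2 * C * r ≤ ε / 2 := by
      rw [hr, mul_div_assoc', div_le_iff₀ (by positivity)]
      nlinarith
    linarith
  simpa using h1.add hg

/-- Truncation levels of order at most `γ ^ (-β)` leave the second moments summable. -/
theorem summable_sq_mul_of_le_rpow {γ M : ℕ → ℝ} {β : ℝ} (hγ : ∀ m, 0 < γ m) (hM : ∀ m, 1 < M m)
    (hMγ : ∀ m, M m ≤ 1 / γ m ^ β) (hs : Summable fun m => γ m ^ (2 * (1 - β))) :
    Summable fun m => (γ m * M m) ^ 2 := by
  refine Summable.of_nonneg_of_le (fun m => sq_nonneg _) (fun m => ?_) hs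
  have h0 := hγ m
  have h1 : γ m * M m ≤ γ m ^ (1 - β) := by
    rw [Real.rpow_sub h0, Real.rpow_one, div_eq_mul_one_div]
    exact mul_le_mul_of_nonneg_left (hMγ m) h0.le
  have h2 : 0 ≤ γ m * M m := mul_nonneg h0.le (by linarith [hM m])
  calc (γ m * M m) ^ 2 ≤ (γ m ^ (1 - β)) ^ 2 := by gcongr
    _ = γ m ^ (2 * (1 - β)) := by
      rw [← Real.rpow_natCast, ← Real.rpow_mul h0.le, mul_comm]; norm_num

/-- The largest levels below `γ ^ (-β)` in a sequence that tends to infinity tend to infinity. -/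
theorem tendsto_atTop_of_isGreatest {γ N M : ℕ → ℝ} {β : ℝ} (hβ : 0 < β) (hγ : ∀ m, 0 < γ m)
    (hγ0 : Tendsto γ atTop (𝓝 0)) (hN : Tendsto N atTop atTop)
    (hM : ∀ m, IsGreatest {a | (∃ i, a = N i) ∧ a ≤ 1 / γ m ^ β} (M m)) :
    Tendsto M atTop atTop := by
  have h1 : Tendsto (fun m => 1 / γ m ^ β) atTop atTop := by
    have h2 : Tendsto (fun m => (γ m)⁻¹) atTop atTop :=
      tendsto_inv_nhdsGT_zero.comp (tendsto_nhdsWithin_iff.2 ⟨hγ0, Eventually.of_forall hγ⟩)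
    refine ((tendsto_rpow_atTop hβ).comp h2).congr fun m => ?_
    rw [Function.comp_apply, Real.inv_rpow (hγ m).le, one_div]
  refine tendsto_atTop.2 fun b => ?_
  obtain ⟨i, hi⟩ := (tendsto_atTop.1 hN b).exists
  filter_upwards [tendsto_atTop.1 h1 (N i)] with m hm
  exact hi.trans ((hM m).2 ⟨⟨i, rfl⟩, hm⟩)

end Main

end RiskSensitive

end

theorem mainTheorem1 {l : ℕ} {X : Type*} [Fintype X] [DecidableEq X] [MeasurableSpace X]
    [DiscreteMeasurableSpace X] (S : RiskSensitive.Model l X)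
    (h_erg : S.Ergodic) (h_smooth : S.Smooth) (h_ratio : S.LikelihoodRatio)
    (γ : ℕ → ℝ) (hγ : RiskSensitive.IsStepSize γ) (η : ℝ) (hη : 0 < η)
    (U : RiskSensitive.UpdateRule) (θ₀ : RiskSensitive.Param l) (Λ₀ : ℝ)
    {Ω : Type*} [mΩ : MeasurableSpace Ω] (μ : Measure Ω) [IsProbabilityMeasure μ]
    (𝓕 : Filtration ℕ mΩ) (Φ : ℕ → Ω → X) :
    -- the truncated cost is well defined, and differentiable in the parameter
    (∀ M : ℝ, 1 < M → (∀ θ, ∃! Λ : ℝ, S.g M θ Λ = 1) ∧ Differentiable ℝ (S.truncCost M)) ∧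
    -- the risk-sensitive cost is well defined, and differentiable in the parameter
    (∀ θ x, Tendsto (S.finiteCost θ x) atTop (𝓝 (S.riskCost θ))) ∧
    Differentiable ℝ S.riskCost ∧
    -- (i) fixed truncation
    (∀ M : ℝ, 1 < M →
      S.IsControlledPath U γ η (fun _ => M) θ₀ Λ₀ μ 𝓕 Φ →
      ∀ᵐ w ∂μ,
        (∃ c : ℝ, Tendsto (fun m => S.truncCost M
          (S.iterate U γ η (fun _ => M) θ₀ Λ₀ (fun k => Φ k w) m).1) atTop (𝓝 c)) ∧
        Tendsto (fun m => gradient (S.truncCost M)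
          (S.iterate U γ η (fun _ => M) θ₀ Λ₀ (fun k => Φ k w) m).1) atTop (𝓝 0)) ∧
    -- (ii) increasing truncations
    (∀ β : ℝ, 0 < β → β < 1 / 2 → Summable (fun m => γ m ^ (2 * (1 - β))) →
      ∀ N : ℕ → ℝ, (∀ i, 1 < N i) → S.SummableTruncation N →
      ∀ M : ℕ → ℝ, Monotone M →
      (∀ m, IsGreatest {a | (∃ i, a = N i) ∧ a ≤ 1 / γ m ^ β} (M m)) →
      S.IsControlledPath U γ η M θ₀ Λ₀ μ 𝓕 Φ →
      ∀ᵐ w ∂μ,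
        (∃ c : ℝ, Tendsto (fun m => S.riskCost
          (S.iterate U γ η M θ₀ Λ₀ (fun k => Φ k w) m).1) atTop (𝓝 c)) ∧
        Tendsto (fun m => gradient S.riskCost
          (S.iterate U γ η M θ₀ Λ₀ (fun k => Φ k w) m).1) atTop (𝓝 0)) := by
  obtain ⟨𝓛, h𝓛, hlim⟩ := RiskSensitive.exists_loopFamily S h_erg h_smooth h_ratio
  have hrisk : S.riskCost = 𝓛.risk := funext fun θ => (hlim θ S.xstar).limUnder_eq
  obtain ⟨C, ε, -, hgood, hexp⟩ := 𝓛.exists_goodLevel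
  have hgrad : ∀ θ, HasGradientAt S.riskCost (𝓛.gradRoot Real.exp Real.exp 𝓛.risk θ) θ := fun θ =>
    hrisk ▸ RiskSensitive.hasGradientAt_of_taylor hexp.taylor θ
  refine ⟨fun M hM => ⟨h𝓛.existsUnique_truncCost hM,
    fun θ => (h𝓛.hasGradientAt_truncCost hM θ).differentiableAt⟩, fun θ x => hrisk ▸ hlim θ x,
    fun θ => (hgrad θ).differentiableAt, fun M hM hΦ => ?_, ?_⟩
  · refine h𝓛.ae_tendsto_truncCost hγ hη U θ₀ Λ₀ (fun _ => hM) ?_ (ρ := fun _ => 0)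
      (fun m ϑ => by simp) summable_zero hΦ
    simpa only [mul_pow] using hγ.sum_sq.mul_right (M ^ 2)
  · intro β hβ _ hβs N hN hNs M hMmono hMgr hΦ
    have hM : ∀ m, 1 < M m := fun m => by
      obtain ⟨i, hi⟩ := (hMgr m).1.1
      exact hi ▸ hN i
    obtain ⟨ρ, hρs, hρ⟩ := h𝓛.exists_summable_increments hN hNs hMmono fun m => (hMgr m).1.1
    have hγ0 : Tendsto γ atTop (𝓝 0) := by
      have := hγ.sum_sq.tendsto_atTop_zero.sqrt
      simpa only [Real.sqrt_sq (hγ.pos _).le, Real.sqrt_zero] using this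
    have hMtop := RiskSensitive.tendsto_atTop_of_isGreatest hβ hγ.pos hγ0 hNs.2.1 hMgr
    have hclose : ∀ δ > 0, ∀ᶠ m in atTop, ∀ θ, |𝓛.risk θ - S.truncCost (M m) θ| ≤ δ := by
      intro δ hδ
      have hκ := 𝓛.κ_pos
      obtain ⟨M₀, -, hM₀⟩ := RiskSensitive.LoopFamily.exists_risk_sub_le_root (𝓛 := 𝓛)
        (ε := min δ (𝓛.κ / 4)) (lt_min hδ (by linarith)) (min_le_right _ _)
      filter_upwards [hMtop.eventually_ge_atTop M₀] with m hm θ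
      have h1 := hM₀ _ hm θ _ (h𝓛.g_truncCost (hM m) θ)
      have h2 := RiskSensitive.LoopFamily.root_le_risk (hM m) (h𝓛.g_truncCost (hM m) θ)
      have h3 := min_le_left δ (𝓛.κ / 4)
      exact abs_le.2 ⟨by linarith, by linarith⟩
    have hC : 0 ≤ C := (norm_nonneg _).trans (hexp.norm_dh θ₀)
    filter_upwards [h𝓛.ae_tendsto_truncCost hγ hη U θ₀ Λ₀ hM
      (RiskSensitive.summable_sq_mul_of_le_rpow hγ.pos hM (fun m => (hMgr m).1.2) hβs) hρ hρs hΦ]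
      with w ⟨⟨c, hc⟩, hg⟩
    refine ⟨⟨c, ?_⟩, ?_⟩
    · have h0 : Tendsto (fun m => 𝓛.risk (S.iterate U γ η M θ₀ Λ₀ (fun k => Φ k w) m).1
          - S.truncCost (M m) (S.iterate U γ η M θ₀ Λ₀ (fun k => Φ k w) m).1) atTop (𝓝 0) := by
        rw [Metric.tendsto_nhds]
        intro δ hδ
        filter_upwards [hclose (δ / 2) (half_pos hδ)] with m hm
        rw [Real.dist_0_eq_abs]
        linarith [hm (S.iterate U γ η M θ₀ Λ₀ (fun k => Φ k w) m).1]
      rw [hrisk]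
      simpa using h0.add hc
    · simp only [(hgrad _).gradient]
      refine RiskSensitive.tendsto_grad_of_tendsto hC hexp.taylor
        (fun m => (hgood _ (hM m) _ (h𝓛.g_truncCost (hM m))).taylor) hclose ?_
      simpa only [(h𝓛.hasGradientAt_truncCost (hM _) _).gradient] using hg
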